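/- Let $p$ be an odd prime and let $\psi$ be an additive character of $\mathbb Q_p$ with kernel $\mathbb Z_p$ (for instance the standard one). Let $dx$ be the Haar measure on $\mathbb Q_p$ with $\mathrm{vol}(\mathbb Z_p)=1$, and normalize Haar measures by $\mathrm{vol}(\mathrm{GL}_2(\mathbb Z_p))=1$ and $\mathrm{vol}(\mathrm{SL}_2(\mathbb Z_p))=\zeta_p(2)^{-1}=1-p^{-2}$. Data. (i) $\pi_p=\xi_0\,\mathrm{St}_p$ is the twist of the Steinberg representation of $\mathrm{GL}_2(\mathbb Q_p)$ by an unramified quadratic (possibly trivial) character $\xi_0$, with root number $w_p=\varepsilon(1/2,\pi_p)=-\xi_0(p)=-1$. (ii) $\tau_p=\pi(\xi_1,\xi_2)$ is the principal series of $\mathrm{GL}_2(\mathbb Q_p)$, realized on the locally constant functions $\varphi:\mathrm{GL}_2(\mathbb Q_p)\to\mathbb C$ with $\varphi\left(\left(\begin{smallmatrix}a&b\\0&d\end{smallmatrix}\right)x\right)=\xi_1(a)\xi_2(d)|a/d|_p^{1/2}\varphi(x)$, where $\xi_1$ is unramified, $\xi_2$ is ramified and trivial on $1+p\mathbb Z_p$,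 and $\chi:=\xi_1\xi_2$ satisfies $\chi(-1)=-1$; put $\langle\varphi_1,\varphi_2\rangle=\int_{\mathrm{GL}_2(\mathbb Z_p)}\varphi_1\overline{\varphi_2}$. (iii) $D$ is an integer with $\left(\frac Dp\right)=-w_p=1$. For an additive character $\psi'$ with kernel $\mathbb Z_p$ let $r_{\psi'}$ be the Weil representation of the metaplectic double cover $\widetilde{\mathrm{SL}}_2(\mathbb Q_p)$ (given by Kubota's cocycle) on the space $\mathcal S(\mathbb Q_p)$ of locally constant compactly supported functions, for the quadratic form $x\mapsto x^2$, that is $$r_{\psi'}\!\left[\left(\begin{smallmatrix}a&\\&a^{-1}\end{smallmatrix}\right),\epsilon\right]\varphi(x)=\epsilon\,\chi_{\psi'}(a)|a|_p^{1/2}\varphi(ax),\quad r_{\psi'}\!\left[\left(\begin{smallmatrix}1&b\\&1\end{smallmatrix}\right),1\right]\varphi(x)=\psi'(bx^2)\varphi(x),$$ $$r_{\psi'}\!\left[\left(\begin{smallmatrix}0&1\\-1&0\end{smallmatrix}\right),1\right]\varphi(x)=\gamma(\psi')\int_{\mathbb Q_p}\varphi(y)\psi'(2xy)\,dy$$ with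 $\gamma(\psi')$ the Weil index of $x\mapsto\psi'(x^2)$ and $\chi_{\psi'}(a)=(a,-1)_p\,\gamma(\psi'(a\,\cdot))/\gamma(\psi')$, where $\gamma(\psi'(a\,\cdot))$ is the Weil index of $x\mapsto\psi'(ax^2)$; put $\langle\varphi_1,\varphi_2\rangle=\int_{\mathbb Q_p}\varphi_1\overline{\varphi_2}\,dx$. Write $\overline\psi^{D}(x)=\psi(-Dx)$ and $\overline\psi(x)=\psi(-x)$. Test vectors. (a) $\mathbf h_p$ is a newvector of the odd Weil representation $r^-_{\overline\psi^D}$: a non-zero odd function in $\mathcal S(\mathbb Q_p)$ on which every $k=\left(\begin{smallmatrix}a&b\\c&d\end{smallmatrix}\right)\in\Gamma_{00}=\{k\in\mathrm{SL}_2(\mathbb Z_p):p^2\mid c\}$, lifted to $\widetilde{\mathrm{SL}}_2(\mathbb Q_p)$ by the standard splitting over $\mathrm{SL}_2(\mathbb Z_p)$, acts by $\chi(d)$. (b) $\mathbf g_p\in\tau_p$ is a non-zero vector invariant under $\{\left(\begin{smallmatrix}a&b\\c&d\end{smallmatrix}\right)\in\mathrm{GL}_2(\mathbb Z_p):c\equiv0,\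 d\equiv1\ (\mathrm{mod}\ p)\}$, and $\breve{\mathbf g}_p=\tau_p\!\left(\left(\begin{smallmatrix}p^{-1}&0\\0&1\end{smallmatrix}\right)\right)\mathbf g_p$. (c) $\pmb\phi_p=\mathbf 1_{\mathbb Z_p}$. Claim. Such vectors exist; for instance $\mathbf h_p=\mathbf 1_{\mathbb Z_p^\times}\cdot\chi^{-1}$ satisfies (a). For every choice of $\mathbf h_p$ and $\mathbf g_p$ as above, the function $$x\mapsto\overline{\langle r_{\overline\psi^D}(x)\mathbf h_p,\mathbf h_p\rangle}\,\langle\tau_p(x)\breve{\mathbf g}_p,\breve{\mathbf g}_p\rangle\,\langle r_{\overline\psi}(x)\pmb\phi_p,\pmb\phi_p\rangle$$ (which is well defined on $\mathrm{SL}_2(\mathbb Q_p)$) is integrable over $\mathrm{SL}_2(\mathbb Q_p)$, and the normalized local period $$\mathcal I_p^\sharp=\frac{L(1,\pi_p,\mathrm{ad})\,L(1,\tau_p,\mathrm{ad})}{L(1/2,\pi_p\times\mathrm{ad}\,\tau_p)}\cdot\frac{\displaystyle\int_{\mathrm{SL}_2(\mathbb Q_p)}\overline{\langle r_{\overline\psi^D}(x)\mathbf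 h_p,\mathbf h_p\rangle}\,\langle\tau_p(x)\breve{\mathbf g}_p,\breve{\mathbf g}_p\rangle\,\langle r_{\overline\psi}(x)\pmb\phi_p,\pmb\phi_p\rangle\,dx}{\|\mathbf h_p\|^2\,\|\breve{\mathbf g}_p\|^2\,\|\pmb\phi_p\|^2}$$ equals $$\mathcal I_p^\sharp=\frac{2}{p(p+1)}.$$ Here the local $L$-factors are those of the Weil--Deligne representations attached to $\pi_p$ and $\tau_p$ by the local Langlands correspondence. -/

import Mathlib

open MeasureTheory Filter Topology TopologicalSpace
open scoped ComplexConjugate TensorProduct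

namespace LocalPeriod

noncomputable section

/-! ### Groups, subgroups and Haar measures -/

/-- `SL₂(ℚ_p)`. -/
abbrev SL2 (p : ℕ) [Fact p.Prime] : Type := Matrix.SpecialLinearGroup (Fin 2) ℚ_[p]

/-- `GL₂(ℚ_p)`. -/
abbrev GL2 (p : ℕ) [Fact p.Prime] : Type := Matrix.GeneralLinearGroup (Fin 2) ℚ_[p]

/-- Homomorphisms `ℚ_pˣ → ℂˣ`. Those in use are smooth, by the
ramification conditions put on them. -/
abbrev MulCharQp (p : ℕ) [Fact p.Prime] : Type := ℚ_[p]ˣ →* ℂˣ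

instance instMeasurableSpaceQp (p : ℕ) [Fact p.Prime] : MeasurableSpace ℚ_[p] := borel _

instance instBorelSpaceQp (p : ℕ) [Fact p.Prime] : BorelSpace ℚ_[p] := ⟨rfl⟩

instance instMeasurableSpaceSL2 (p : ℕ) [Fact p.Prime] : MeasurableSpace (SL2 p) := borel _

instance instBorelSpaceSL2 (p : ℕ) [Fact p.Prime] : BorelSpace (SL2 p) := ⟨rfl⟩

instance instMeasurableSpaceGL2 (p : ℕ) [Fact p.Prime] : MeasurableSpace (GL2 p) := borel _

instance instBorelSpaceGL2 (p : ℕ) [Fact p.Prime] : BorelSpace (GL2 p) := ⟨rfl⟩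

variable {p : ℕ} [Fact p.Prime]

theorem isOpen_norm_le_one : IsOpen {x : ℚ_[p] | ‖x‖ ≤ 1} := by
  have h : {x : ℚ_[p] | ‖x‖ ≤ 1} = Metric.closedBall 0 1 := by ext; simp
  rw [h]
  exact IsUltrametricDist.isOpen_closedBall 0 one_ne_zero

theorem isCompact_norm_le_one : IsCompact {x : ℚ_[p] | ‖x‖ ≤ 1} := by
  have h : {x : ℚ_[p] | ‖x‖ ≤ 1} = Metric.closedBall 0 1 := by ext; simp
  rw [h]
  exact isCompact_closedBall 0 1

/-- `M₂(ℤ_p)` inside `M₂(ℚ_p)`. -/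
def integralMatrices (p : ℕ) [Fact p.Prime] : Set (Matrix (Fin 2) (Fin 2) ℚ_[p]) :=
  {x | ∀ i j, ‖x i j‖ ≤ 1}

theorem integralMatrices_eq_pi :
    integralMatrices p =
      Set.univ.pi fun _ : Fin 2 => Set.univ.pi fun _ : Fin 2 => {x : ℚ_[p] | ‖x‖ ≤ 1} := by
  ext x
  exact ⟨fun h i _ j _ => h i j, fun h i j => h i trivial j trivial⟩

theorem isCompact_integralMatrices : IsCompact (integralMatrices p) := by
  rw [integralMatrices_eq_pi]
  exact isCompact_univ_pi fun _ => isCompact_univ_pi fun _ => isCompact_norm_le_one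

theorem isOpen_integralMatrices : IsOpen (integralMatrices p) := by
  rw [integralMatrices_eq_pi]
  exact isOpen_set_pi Set.finite_univ fun _ _ =>
    isOpen_set_pi Set.finite_univ fun _ _ => isOpen_norm_le_one

theorem one_mem_integralMatrices :
    (1 : Matrix (Fin 2) (Fin 2) ℚ_[p]) ∈ integralMatrices p := by
  intro i j
  by_cases h : i = j
  · subst h; simp [Matrix.one_apply_eq]
  · simp [Matrix.one_apply_ne h]

/-- `SL₂(ℤ_p)` as a subset of `SL₂(ℚ_p)`. -/
def SL2Zp (p : ℕ) [Fact p.Prime] : Set (SL2 p) :=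
  {x | (x : Matrix (Fin 2) (Fin 2) ℚ_[p]) ∈ integralMatrices p}

/-- `GL₂(ℤ_p)` as a subset of `GL₂(ℚ_p)`: both the matrix and its inverse are integral. -/
def GL2Zp (p : ℕ) [Fact p.Prime] : Set (GL2 p) :=
  {x | (x : Matrix (Fin 2) (Fin 2) ℚ_[p]) ∈ integralMatrices p ∧
    ((x⁻¹ : GL2 p) : Matrix (Fin 2) (Fin 2) ℚ_[p]) ∈ integralMatrices p}

/-- `Γ₀₀ = Γ₀(p²)`, the matrices of `SL₂(ℤ_p)` with lower left entry divisible by `p²`. -/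
def Gamma00 (p : ℕ) [Fact p.Prime] : Set (SL2 p) :=
  {x | x ∈ SL2Zp p ∧ ‖x 1 0‖ ≤ ((p : ℝ) ^ 2)⁻¹}

/-- `K₀¹`: the matrices of `GL₂(ℤ_p)` with bottom row congruent to `(0, 1)` modulo `p`. -/
def K01 (p : ℕ) [Fact p.Prime] : Set (GL2 p) :=
  {x | x ∈ GL2Zp p ∧ ‖x 1 0‖ ≤ (p : ℝ)⁻¹ ∧ ‖x 1 1 - 1‖ ≤ (p : ℝ)⁻¹}

/-- `ℤ_p` as a compact set with non-empty interior in `ℚ_p`. -/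
def ZpCompacts (p : ℕ) [Fact p.Prime] : PositiveCompacts ℚ_[p] where
  carrier := {x | ‖x‖ ≤ 1}
  isCompact' := isCompact_norm_le_one
  interior_nonempty' := by
    rw [isOpen_norm_le_one.interior_eq]
    exact ⟨0, by simp⟩

/-- `SL₂(ℤ_p)` as a compact set with non-empty interior in `SL₂(ℚ_p)`. -/
def SL2ZpCompacts (p : ℕ) [Fact p.Prime] : PositiveCompacts (SL2 p) where
  carrier := SL2Zp p
  isCompact' :=
    Matrix.SpecialLinearGroup.isClosedEmbedding_val.isCompact_preimage isCompact_integralMatrices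
  interior_nonempty' := by
    have h : IsOpen (SL2Zp p) := isOpen_integralMatrices.preimage continuous_subtype_val
    rw [h.interior_eq]
    exact ⟨1, one_mem_integralMatrices⟩

/-- `GL₂(ℤ_p)` as a compact set with non-empty interior in `GL₂(ℚ_p)`. -/
def GL2ZpCompacts (p : ℕ) [Fact p.Prime] : PositiveCompacts (GL2 p) where
  carrier := GL2Zp p
  isCompact' := by
    have h : GL2Zp p = Units.embedProduct (Matrix (Fin 2) (Fin 2) ℚ_[p]) ⁻¹'
        (integralMatrices p ×ˢ (MulOpposite.unop ⁻¹' integralMatrices p)) := by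
      ext x; simp [GL2Zp]
    rw [h]
    refine Units.isClosedEmbedding_embedProduct.isCompact_preimage
      (isCompact_integralMatrices.prod ?_)
    exact (MulOpposite.opHomeomorph.symm.isClosedEmbedding).isCompact_preimage
      isCompact_integralMatrices
  interior_nonempty' := by
    have h : IsOpen (GL2Zp p) :=
      (isOpen_integralMatrices.preimage Units.continuous_val).inter
        (isOpen_integralMatrices.preimage (Units.continuous_val.comp continuous_inv))
    rw [h.interior_eq]
    exact ⟨1, by simpa using one_mem_integralMatrices, by simpa using one_mem_integralMatrices⟩

/-- The Haar measure on `ℚ_p` with `vol(ℤ_p) = 1`. -/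
def haarQp (p : ℕ) [Fact p.Prime] : Measure ℚ_[p] := Measure.addHaarMeasure (ZpCompacts p)

/-- The Haar measure on `GL₂(ℚ_p)` with `vol(GL₂(ℤ_p)) = 1`. -/
def haarGL2 (p : ℕ) [Fact p.Prime] : Measure (GL2 p) := Measure.haarMeasure (GL2ZpCompacts p)

/-- The Haar measure on `SL₂(ℚ_p)` with `vol(SL₂(ℤ_p)) = ζ_p(2)⁻¹ = 1 - p⁻²`. -/
def haarSL2 (p : ℕ) [Fact p.Prime] : Measure (SL2 p) :=
  ENNReal.ofReal (1 - ((p : ℝ) ^ 2)⁻¹) • Measure.haarMeasure (SL2ZpCompacts p)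

/-! ### Characters -/

open Classical in
/-- Extension by zero of a character of `ℚ_pˣ` to `ℚ_p`. -/
def charExt (χ : MulCharQp p) (x : ℚ_[p]) : ℂ :=
  if hx : x ≠ 0 then (χ (Units.mk0 x hx) : ℂ) else 0

/-- The prime `p` as an element of `ℚ_pˣ`. -/
def pUnit (p : ℕ) [Fact p.Prime] : ℚ_[p]ˣ :=
  Units.mk0 (p : ℚ_[p]) (by exact_mod_cast (Fact.out : p.Prime).ne_zero)

/-- A character of `ℚ_pˣ` is unramified if it is trivial on `ℤ_pˣ`. -/
def IsUnramified (χ : MulCharQp p) : Prop :=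
  ∀ u : ℚ_[p]ˣ, ‖(u : ℚ_[p])‖ = 1 → χ u = 1

/-- A character of `ℚ_pˣ` has conductor exponent one: it is ramified, and trivial on
`1 + p ℤ_p`. -/
def HasConductorOne (χ : MulCharQp p) : Prop :=
  ¬ IsUnramified χ ∧ ∀ u : ℚ_[p]ˣ, ‖(u : ℚ_[p]) - 1‖ ≤ (p : ℝ)⁻¹ → χ u = 1

/-! ### The metaplectic group -/

open Classical in
/-- The Hilbert symbol `(a, b)` of a field, for non-zero `a` and `b`. -/
def hilbertSymbol {K : Type*} [Field K] (a b : K) : ℤˣ :=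
  if ∃ x y z : K, ¬ (x = 0 ∧ y = 0 ∧ z = 0) ∧ z ^ 2 = a * x ^ 2 + b * y ^ 2 then 1 else -1

open Classical in
/-- `x(g)` is the lower left entry of `g` if that is non-zero, and the lower right one
otherwise. -/
def kubotaX (g : SL2 p) : ℚ_[p] := if g 1 0 ≠ 0 then g 1 0 else g 1 1

/-- The two-fold metaplectic cover of `SL₂(ℚ_p)`, with elements `[g, ε]`. -/
structure Mp2 (p : ℕ) [Fact p.Prime] where
  /-- The image in `SL₂(ℚ_p)`. -/
  g : SL2 p
  /-- The sign. -/
  sign : ℤˣ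

/-- `[g₁, ε₁][g₂, ε₂] = [g₁g₂, ε(g₁, g₂) ε₁ ε₂]` with Kubota's cocycle. -/
instance instMulMp2 : Mul (Mp2 p) where
  mul m₁ m₂ :=
    { g := m₁.g * m₂.g
      sign := hilbertSymbol (kubotaX m₁.g * kubotaX (m₁.g * m₂.g))
          (kubotaX m₂.g * kubotaX (m₁.g * m₂.g)) * m₁.sign * m₂.sign }

/-- The upper unipotent matrix `u(b)`. -/
def uMat (b : ℚ_[p]) : SL2 p := ⟨!![1, b; 0, 1], by simp⟩

/-- The diagonal matrix `t(a) = diag(a, a⁻¹)`. -/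
def tMat (a : ℚ_[p]ˣ) : SL2 p := ⟨!![(a : ℚ_[p]), 0; 0, (a : ℚ_[p])⁻¹], by simp⟩

/-- The matrix `s` with rows `(0, 1)` and `(-1, 0)`. -/
def sMat (p : ℕ) [Fact p.Prime] : SL2 p := ⟨!![0, 1; -1, 0], by simp⟩

/-- Matrices with lower left entry `c ≠ 0` lie in the big cell. -/
theorem bruhat_big_cell (g : SL2 p) (hc : g 1 0 ≠ 0) :
    g = uMat (g 0 0 / g 1 0) * tMat (-(Units.mk0 (g 1 0) hc)⁻¹) * sMat p *
      uMat (g 1 1 / g 1 0) := by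
  have hdet : g 0 0 * g 1 1 - g 0 1 * g 1 0 = 1 := by
    have := g.det_coe
    rwa [Matrix.det_fin_two] at this
  have hu (b : ℚ_[p]) : (uMat b : Matrix (Fin 2) (Fin 2) ℚ_[p]) = !![1, b; 0, 1] := rfl
  have ht (a : ℚ_[p]ˣ) : (tMat a : Matrix (Fin 2) (Fin 2) ℚ_[p]) =
    !![(a : ℚ_[p]), 0; 0, (a : ℚ_[p])⁻¹] := rfl
  have hs : (sMat p : Matrix (Fin 2) (Fin 2) ℚ_[p]) = !![0, 1; -1, 0] := rfl
  refine Matrix.SpecialLinearGroup.ext _ _ fun i j => ?_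
  simp only [Matrix.SpecialLinearGroup.coe_mul, hu, ht, hs, Matrix.mul_fin_two]
  fin_cases i <;> fin_cases j <;> simp <;> field_simp
  linear_combination -hdet

/-- Matrices with lower left entry `0` are upper triangular. -/
theorem bruhat_borel (g : SL2 p) (hc : g 1 0 = 0) (ha : g 0 0 ≠ 0) :
    g = uMat (g 0 0 * g 0 1) * tMat (Units.mk0 (g 0 0) ha) := by
  have hdet : g 0 0 * g 1 1 - g 0 1 * g 1 0 = 1 := by
    have := g.det_coe
    rwa [Matrix.det_fin_two] at this
  rw [hc] at hdet
  have hu (b : ℚ_[p]) : (uMat b : Matrix (Fin 2) (Fin 2) ℚ_[p]) = !![1, b; 0, 1] := rfl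
  have ht (a : ℚ_[p]ˣ) : (tMat a : Matrix (Fin 2) (Fin 2) ℚ_[p]) =
    !![(a : ℚ_[p]), 0; 0, (a : ℚ_[p])⁻¹] := rfl
  refine Matrix.SpecialLinearGroup.ext _ _ fun i j => ?_
  simp only [Matrix.SpecialLinearGroup.coe_mul, hu, ht, Matrix.mul_fin_two]
  fin_cases i <;> fin_cases j <;> simp [hc] <;> field_simp
  linear_combination hdet

open Classical in
/-- The section `g ↦ [g, s_p(g)]`, which splits the cover over `SL₂(ℤ_p)` for odd `p`. -/
def splitting (g : SL2 p) : Mp2 p where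
  g := g
  sign :=
    if g 1 0 * g 1 1 ≠ 0 ∧ Odd (g 1 0).valuation then hilbertSymbol (g 1 0) (g 1 1) else 1

/-! ### The Weil representation on `S(ℚ_p)` for the quadratic form `x ↦ x²` -/

/-- The Weil index `γ(ψ)` of `x ↦ ψ(x²)`: the common argument of the integrals
`∫_{p⁻ⁿ ℤ_p} ψ(x²) dx`, for large `n`, as a complex number of modulus one. -/
def weilIndex (ψ : AddChar ℚ_[p] Circle) : ℂ :=
  limUnder atTop fun n : ℕ =>
    (∫ x in {x : ℚ_[p] | ‖x‖ ≤ (p : ℝ) ^ n}, (ψ (x ^ 2) : ℂ) ∂haarQp p) /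
      (‖∫ x in {x : ℚ_[p] | ‖x‖ ≤ (p : ℝ) ^ n}, (ψ (x ^ 2) : ℂ) ∂haarQp p‖ : ℂ)

/-- `χ_ψ(a) = (a, -1) γ(ψᵃ) / γ(ψ)`, where `ψᵃ(x) = ψ(ax)`. -/
def chiPsi (ψ : AddChar ℚ_[p] Circle) (a : ℚ_[p]) : ℂ :=
  ((hilbertSymbol a (-1) : ℤ) : ℂ) * weilIndex (ψ.mulShift a) / weilIndex ψ

/-- The action of `[u(b), 1]`. -/
def weilU (ψ : AddChar ℚ_[p] Circle) (b : ℚ_[p]) (φ : ℚ_[p] → ℂ) : ℚ_[p] → ℂ :=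
  fun x => (ψ (b * x ^ 2) : ℂ) * φ x

/-- The action of `[t(a), 1]`. -/
def weilT (ψ : AddChar ℚ_[p] Circle) (a : ℚ_[p]) (φ : ℚ_[p] → ℂ) : ℚ_[p] → ℂ :=
  fun x => chiPsi ψ a * (√‖a‖ : ℂ) * φ (a * x)

/-- The action of `[s, 1]`. -/
def weilS (ψ : AddChar ℚ_[p] Circle) (φ : ℚ_[p] → ℂ) : ℚ_[p] → ℂ :=
  fun x => weilIndex ψ * ∫ y, φ y * (ψ (2 * x * y) : ℂ) ∂haarQp p

open Classical in
/-- The action of `[g, ε]` in the Weil representation attached to `ψ`. It is read off from the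
action of `[u(b), 1]`, `[t(a), 1]`, `[s, 1]` and of the sign `[1, -1]` (which acts by `-1`)
by writing `[g, ε]` as a product of such elements in the metaplectic group: `g = u(ab) t(a)` if
`c = 0`, where `[u(ab), 1][t(a), 1] = [g, 1]`, and `g = u(a/c) t(-1/c) s u(d/c)` if `c ≠ 0`. -/
def weilRep (ψ : AddChar ℚ_[p] Circle) (m : Mp2 p) (φ : ℚ_[p] → ℂ) : ℚ_[p] → ℂ :=
  if hc : m.g 1 0 = 0 then
    fun x => ((m.sign : ℤ) : ℂ) * weilU ψ (m.g 0 0 * m.g 0 1) (weilT ψ (m.g 0 0) φ) x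
  else
    fun x => ((m.sign *
        ((⟨uMat (m.g 0 0 / m.g 1 0), 1⟩ : Mp2 p) * ⟨tMat (-(Units.mk0 (m.g 1 0) hc)⁻¹), 1⟩ *
          ⟨sMat p, 1⟩ * ⟨uMat (m.g 1 1 / m.g 1 0), 1⟩).sign : ℤˣ) : ℤ) *
      weilU ψ (m.g 0 0 / m.g 1 0) (weilT ψ (-(m.g 1 0)⁻¹)
        (weilS ψ (weilU ψ (m.g 1 1 / m.g 1 0) φ))) x

/-- The pairing `⟨φ₁, φ₂⟩` on `S(ℚ_p)`. -/
def pairingQp (φ₁ φ₂ : ℚ_[p] → ℂ) : ℂ := ∫ x, φ₁ x * conj (φ₂ x) ∂haarQp p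

/-- The characteristic function of `ℤ_p`. -/
def indZp (p : ℕ) [Fact p.Prime] : ℚ_[p] → ℂ :=
  Set.indicator {x | ‖x‖ ≤ 1} fun _ => 1

/-- Newvectors of the odd Weil representation `r_ψ⁻` relative to `χ`: the non-zero odd
Bruhat-Schwartz functions on which the image of `Γ₀₀` in the metaplectic group acts through
`k ↦ χ(d)`, where `d` is the lower right entry of `k`. -/
structure IsOddWeilNewvector (ψ : AddChar ℚ_[p] Circle) (χ : MulCharQp p)
    (h : ℚ_[p] → ℂ) : Prop where
  locallyConstant : IsLocallyConstant h
  compactSupport : HasCompactSupport h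
  odd : ∀ x, h (-x) = -h x
  ne_zero : h ≠ 0
  equivariant : ∀ k ∈ Gamma00 p, ∀ x, weilRep ψ (splitting k) h x = charExt χ (k 1 1) * h x

/-- The function `1_{ℤ_pˣ} · χ⁻¹`. -/
def oddWeilVector (χ : MulCharQp p) : ℚ_[p] → ℂ :=
  Set.indicator {x | ‖x‖ = 1} fun x => (charExt χ x)⁻¹

/-! ### Principal series of `GL₂(ℚ_p)` -/

/-- The upper triangular matrix with rows `(a, b)` and `(0, d)`. -/
def borelMat (a d : ℚ_[p]ˣ) (b : ℚ_[p]) : GL2 p :=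
  Matrix.GeneralLinearGroup.mkOfDetNeZero !![(a : ℚ_[p]), b; 0, (d : ℚ_[p])] (by simp)

/-- The induced model of the principal series `π(ξ₁, ξ₂)`. -/
structure IsPrincipalSeriesVector (ξ₁ ξ₂ : MulCharQp p) (φ : GL2 p → ℂ) : Prop where
  locallyConstant : IsLocallyConstant φ
  rule : ∀ (a d : ℚ_[p]ˣ) (b : ℚ_[p]) (x : GL2 p),
    φ (borelMat a d b * x) =
      (ξ₁ a : ℂ) * (ξ₂ d : ℂ) * (√‖(a : ℚ_[p]) / (d : ℚ_[p])‖ : ℂ) * φ x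

/-- The action of `GL₂(ℚ_p)` by right translation. -/
def rightTranslate (y : GL2 p) (φ : GL2 p → ℂ) : GL2 p → ℂ := fun x => φ (x * y)

/-- Newvectors of `π(ξ₁, ξ₂)` (for `ξ₁` unramified and `ξ₂` of conductor exponent one): the
non-zero `K₀¹`-invariant vectors. -/
structure IsPrincipalSeriesNewvector (ξ₁ ξ₂ : MulCharQp p) (φ : GL2 p → ℂ) : Prop where
  mem : IsPrincipalSeriesVector ξ₁ ξ₂ φ
  ne_zero : φ ≠ 0
  invariant : ∀ k ∈ K01 p, rightTranslate k φ = φ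

/-- The level raising operator `V_p`: the action of `diag(p⁻¹, 1)`. -/
def levelRaise (φ : GL2 p → ℂ) : GL2 p → ℂ := rightTranslate (borelMat (pUnit p)⁻¹ 1 0) φ

/-- The pairing on the induced model: integration over `GL₂(ℤ_p)`. -/
def pairingGL2 (φ₁ φ₂ : GL2 p → ℂ) : ℂ := ∫ x in GL2Zp p, φ₁ x * conj (φ₂ x) ∂haarGL2 p

/-! ### Weil-Deligne representations and local `L`-factors

All Langlands parameters that occur factor, on the Weil group, through its abelianization, which
is identified with `ℚ_pˣ` so that `p` corresponds to a geometric Frobenius element and `ℤ_pˣ` is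
the image of inertia. -/

/-- A Weil-Deligne representation `(ρ, N)` whose Weil group action factors through `ℚ_pˣ`. If `V`
has finite dimension, then `N` is nilpotent by the relation `commutes`. -/
structure WDRep (p : ℕ) [Fact p.Prime] (V : Type*) [AddCommGroup V] [Module ℂ V] where
  /-- The action of the abelianized Weil group. -/
  ρ : ℚ_[p]ˣ →* (V →ₗ[ℂ] V)
  /-- The monodromy operator. -/
  N : V →ₗ[ℂ] V
  commutes : ∀ x v, ρ x (N v) = (‖(x : ℚ_[p])‖ : ℂ) • N (ρ x v)

namespace WDRep

variable {V W : Type*} [AddCommGroup V] [Module ℂ V] [AddCommGroup W] [Module ℂ W]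

/-- The inertia invariants of the kernel of `N`. -/
def invariants (R : WDRep p V) : Submodule ℂ V where
  carrier := {v | R.N v = 0 ∧ ∀ u : ℚ_[p]ˣ, ‖(u : ℚ_[p])‖ = 1 → R.ρ u v = v}
  zero_mem' := by simp
  add_mem' := by
    rintro v w ⟨hv, hv'⟩ ⟨hw, hw'⟩
    exact ⟨by simp [hv, hw], fun u hu => by simp [hv' u hu, hw' u hu]⟩
  smul_mem' := by
    rintro c v ⟨hv, hv'⟩
    exact ⟨by simp [hv], fun u hu => by simp [hv' u hu]⟩

theorem mapsTo_invariants (R : WDRep p V) (x : ℚ_[p]ˣ) :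
    ∀ v ∈ R.invariants, R.ρ x v ∈ R.invariants := by
  rintro v ⟨hv, hv'⟩
  refine ⟨?_, fun u hu => ?_⟩
  · have h := R.commutes x v
    rw [hv, map_zero] at h
    have hx : ((‖(x : ℚ_[p])‖ : ℝ) : ℂ) ≠ 0 := by
      exact_mod_cast norm_ne_zero_iff.mpr x.ne_zero
    exact (smul_eq_zero.mp h.symm).resolve_left hx
  · have h : R.ρ u (R.ρ x v) = R.ρ x (R.ρ u v) := by
      rw [← Module.End.mul_apply, ← map_mul, mul_comm, map_mul, Module.End.mul_apply]
    rw [h, hv' u hu]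

/-- The local `L`-factor `L(s, (ρ, N)) = det(1 - p⁻ˢ Frob | (ker N)^I)⁻¹`. -/
def LFactor (R : WDRep p V) (s : ℂ) : ℂ :=
  (LinearMap.det (LinearMap.id -
    (p : ℂ) ^ (-s) • (R.ρ (pUnit p)).restrict (R.mapsTo_invariants (pUnit p))))⁻¹

/-- The tensor product. -/
def tensor (R : WDRep p V) (S : WDRep p W) : WDRep p (V ⊗[ℂ] W) where
  ρ :=
    { toFun := fun x => TensorProduct.map (R.ρ x) (S.ρ x)
      map_one' := by simp [Module.End.one_eq_id, TensorProduct.map_id]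
      map_mul' := fun x y => by
        simp only [map_mul]
        exact TensorProduct.map_mul _ _ _ _ }
  N := TensorProduct.map R.N LinearMap.id + TensorProduct.map LinearMap.id S.N
  commutes := fun x v => by
    induction v using TensorProduct.induction_on with
    | zero => simp
    | tmul v w =>
      simp [R.commutes, S.commutes, TensorProduct.smul_tmul', TensorProduct.tmul_smul]
    | add v w hv hw => simp only [map_add, smul_add, hv, hw] at *

/-- The adjoint representation, on the endomorphisms of trace zero: `x` acts by
`X ↦ ρ(x) X ρ(x)⁻¹`, and the monodromy operator is `X ↦ N X - X N`. -/
def adjoint (R : WDRep p V) : WDRep p (LinearMap.ker (LinearMap.trace ℂ V)) where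
  ρ :=
    { toFun := fun x =>
        (LinearMap.mulLeft ℂ (R.ρ x) ∘ₗ LinearMap.mulRight ℂ (R.ρ x⁻¹)).restrict (by
          intro X hX
          rw [LinearMap.mem_ker] at hX ⊢
          simp only [LinearMap.comp_apply, LinearMap.mulLeft_apply, LinearMap.mulRight_apply]
          rw [LinearMap.trace_mul_comm, mul_assoc, ← map_mul, inv_mul_cancel, map_one, mul_one, hX])
      map_one' := by ext; simp
      map_mul' := fun x y => by
        ext X : 2
        simp [mul_assoc] }
  N := (LinearMap.mulLeft ℂ R.N - LinearMap.mulRight ℂ R.N).restrict (by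
    intro X hX
    rw [LinearMap.mem_ker]
    simp only [LinearMap.sub_apply, LinearMap.mulLeft_apply, LinearMap.mulRight_apply, map_sub]
    rw [LinearMap.trace_mul_comm, sub_self])
  commutes := fun x X => by
    have hx : ((‖(x : ℚ_[p])‖ : ℝ) : ℂ) ≠ 0 := by
      exact_mod_cast norm_ne_zero_iff.mpr x.ne_zero
    have h1 : R.ρ x * R.N = (‖(x : ℚ_[p])‖ : ℂ) • (R.N * R.ρ x) := by
      ext v; exact R.commutes x v
    have h2 : R.N * R.ρ x⁻¹ = (‖(x : ℚ_[p])‖ : ℂ) • (R.ρ x⁻¹ * R.N) := by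
      ext v
      have h := R.commutes x⁻¹ v
      simp only [Module.End.mul_apply, LinearMap.smul_apply, h, smul_smul]
      simp [hx]
    apply Subtype.ext
    simp only [MonoidHom.coe_mk, OneHom.coe_mk, LinearMap.coe_restrict_apply, LinearMap.comp_apply,
      LinearMap.sub_apply, LinearMap.mulLeft_apply, LinearMap.mulRight_apply, Submodule.coe_smul]
    calc R.ρ x * ((R.N * X - X * R.N) * R.ρ x⁻¹)
        = (R.ρ x * R.N) * (X * R.ρ x⁻¹) - R.ρ x * X * (R.N * R.ρ x⁻¹) := by noncomm_ring
      _ = _ := by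
        rw [h1, h2]
        simp only [smul_mul_assoc, mul_smul_comm, smul_sub, mul_assoc]

end WDRep

/-- The Langlands parameter `ξ₁ ⊕ ξ₂` of the principal series `π(ξ₁, ξ₂)`. -/
def principalSeriesParameter (ξ₁ ξ₂ : MulCharQp p) : WDRep p (Fin 2 → ℂ) where
  ρ :=
    { toFun := fun x => Matrix.toLin' (Matrix.diagonal ![(ξ₁ x : ℂ), (ξ₂ x : ℂ)])
      map_one' := by
        ext i j; fin_cases i <;> fin_cases j <;> simp
      map_mul' := fun x y => by
        ext i j; fin_cases i <;> fin_cases j <;> simp }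
  N := 0
  commutes := by simp

/-- The Langlands parameter of the twist `ξ St` of the Steinberg representation, that is of the
irreducible subrepresentation of `π(ξ|·|^{1/2}, ξ|·|^{-1/2})`: the characters
`ξ|·|^{1/2}`, `ξ|·|^{-1/2}`, with `N` sending the second basis vector to the first. -/
def steinbergParameter (ξ : MulCharQp p) : WDRep p (Fin 2 → ℂ) where
  ρ :=
    { toFun := fun x => Matrix.toLin' (Matrix.diagonal
        ![(ξ x : ℂ) * (√‖(x : ℚ_[p])‖ : ℂ), (ξ x : ℂ) * (√‖(x : ℚ_[p])‖ : ℂ)⁻¹])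
      map_one' := by
        ext i j; fin_cases i <;> fin_cases j <;> simp
      map_mul' := fun x y => by
        ext i j
        fin_cases i <;> fin_cases j <;> simp <;> ring }
  N := Matrix.toLin' !![0, 1; 0, 0]
  commutes := fun x v => by
    have hx : ((√‖(x : ℚ_[p])‖ : ℝ) : ℂ) ≠ 0 := by
      exact_mod_cast (Real.sqrt_pos.mpr (norm_pos_iff.mpr x.ne_zero)).ne'
    have hs : ((‖(x : ℚ_[p])‖ : ℝ) : ℂ) = (√‖(x : ℚ_[p])‖ : ℂ) * (√‖(x : ℚ_[p])‖ : ℂ) := by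
      exact_mod_cast (Real.mul_self_sqrt (norm_nonneg _)).symm
    ext i
    fin_cases i
    · simp [Matrix.toLin'_apply, Matrix.mulVec, dotProduct, Fin.sum_univ_two, Matrix.diagonal]
      rw [hs]
      field_simp
    · simp [Matrix.toLin'_apply, Matrix.mulVec, dotProduct, Fin.sum_univ_two, Matrix.diagonal]

/-- The root number `ε(1/2, ξ St) = -ξ(p)` for an unramified quadratic character `ξ`. -/
def steinbergRootNumber (ξ : MulCharQp p) : ℂ := -(ξ (pUnit p) : ℂ)

/-! ### The local period -/

/-- The integrand of the local period on `SL₂(ℚ_p)`: the product of the complex conjugate of the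
matrix coefficient of `h` in `r_{ψ'}`, of the matrix coefficient of `g` under right translation,
and of the matrix coefficient of `φ` in `r_{ψ''}`. The two metaplectic matrix coefficients are
taken at the lift `[x, 1]`; both change sign if the lift is changed, so their product does not. -/
def periodIntegrand (ψ' ψ'' : AddChar ℚ_[p] Circle) (h : ℚ_[p] → ℂ) (g : GL2 p → ℂ)
    (φ : ℚ_[p] → ℂ) (x : SL2 p) : ℂ :=
  conj (pairingQp (weilRep ψ' ⟨x, 1⟩ h) h) *
    pairingGL2 (rightTranslate (Matrix.SpecialLinearGroup.toGL x) g) g *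
    pairingQp (weilRep ψ'' ⟨x, 1⟩ φ) φ

/-- The local period
`L(1, π, ad) L(1, τ, ad) / L(1/2, π × ad τ) · ∫_{SL₂(ℚ_p)} (matrix coefficients) dx`, where `π`
and `τ` enter through their Langlands parameters. -/
def period {V W : Type*} [AddCommGroup V] [Module ℂ V] [AddCommGroup W] [Module ℂ W]
    (π : WDRep p V) (τ : WDRep p W) (ψ' ψ'' : AddChar ℚ_[p] Circle)
    (h : ℚ_[p] → ℂ) (g : GL2 p → ℂ) (φ : ℚ_[p] → ℂ) : ℂ :=
  π.adjoint.LFactor 1 * τ.adjoint.LFactor 1 / (π.tensor τ.adjoint).LFactor (1 / 2) *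
    ∫ x, periodIntegrand ψ' ψ'' h g φ x ∂haarSL2 p

/-- The normalized local period `I^♯ = I / (‖h‖² ‖g‖² ‖φ‖²)`. -/
def normalizedPeriod {V W : Type*} [AddCommGroup V] [Module ℂ V] [AddCommGroup W] [Module ℂ W]
    (π : WDRep p V) (τ : WDRep p W) (ψ' ψ'' : AddChar ℚ_[p] Circle)
    (h : ℚ_[p] → ℂ) (g : GL2 p → ℂ) (φ : ℚ_[p] → ℂ) : ℂ :=
  period π τ ψ' ψ'' h g φ / (pairingQp h h * pairingGL2 g g * pairingQp φ φ)

end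

end LocalPeriod

open LocalPeriod

namespace LocalPeriod

noncomputable section

variable {p : ℕ} [Fact p.Prime]

/-! ### Integration on `ℚ_p` -/

/-! The root number `-1` forces `ξ₀(p) = 1` and makes `D` the square of a `p`-adic unit `u`. Put
`θ(x) = ψ(-x)`. Both Weil representations are then attached to `θ`, up to a twist by `u²` that
changes none of the Weil indices and Gauss integrals that occur. The proof computes the three matrix
coefficients explicitly at `x` with rows `(a, b)` and `(c, d)`, and integrates their product.

The test vectors are rigid. Every odd newvector is supported on the units and transforms there by
`χ⁻¹` (`IsOddWeilNewvector.isUnitVector`); every newvector of the principal series is a multiple of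
`newvec`, which lives on the cell `‖c‖ < ‖d‖` (`IsPrincipalSeriesNewvector.eq_newvec`).

Oscillation and oddness kill the coefficient of `h` unless `p² ∣ c` and `d` is a unit, or `c` has
valuation one and `a`, `d` are integral (`pairing_weilRep_eq_zero`). On the second set the
coefficient of the level raised vector vanishes (`pairing_levelRaise_eq_zero`). On the first set,
completing the square gives a phase times `χ(d) ‖h(1)‖² ∫_{units} θ((b/d) y²) dy` for `h`
(`pairing_weilRep_unitVector`), zero once `‖b‖ > p`, and the same phase times `∫_{ℤ_p} θ((b/d) y²)
dy` for the characteristic function of `ℤ_p` (`pairing_weilRep_indZp`). For `‖b‖ ≤ p` the principal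
series contributes `ξ₂(d)` times the norm (`pairing_levelRaise`). Because of the complex conjugate
the phases cancel, and so do `χ(d)` and `ξ₂(d)`.

What remains depends on `b/d` modulo `ℤ_p` only, and lives on the `p` disjoint translates `u(j/p)
Γ₀₀`. Each has volume `(1 - p⁻²)/(p(p+1))`, since `Γ₀₀` has index `p² + p` in `SL₂(ℤ_p)`. Let `G_j`
be the integral of `θ(j x²/p)` over `ℤ_p`; over the units the integral is `G_j - 1/p`. Since `|G_0|²
= 1`, `|G_j|² = 1/p` for `0 < j < p`, and the `G_j` add up to `1`, the sum of `|G_j|² - G_j/p` is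
`2(1 - 1/p)` (`sum_conj_unitGauss_mul_gaussInt`). The factor `1 - 1/p` is absorbed by `‖h‖² =
‖h(1)‖² (1 - 1/p)`.

Among the `L`-factors, `L(1, τ, ad)` and `L(1/2, π × ad τ)` are both `(1 - 1/p)⁻¹` and cancel, while
`L(1, π, ad) = (1 - p⁻²)⁻¹` removes the volume factor. This leaves `2/(p(p+1))`. -/

theorem one_lt_prime_cast : (1 : ℝ) < p := by exact_mod_cast (Fact.out : p.Prime).one_lt

theorem prime_cast_pos : (0 : ℝ) < p := one_lt_prime_cast.trans' one_pos

theorem prime_cast_ne_zero : (p : ℚ_[p]) ≠ 0 := by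
  exact_mod_cast (Fact.out : p.Prime).ne_zero

theorem norm_prime_zpow (k : ℤ) : ‖(p : ℚ_[p]) ^ k‖ = (p : ℝ) ^ (-k) := by
  rw [norm_zpow, Padic.norm_p, inv_zpow, zpow_neg]

theorem norm_two_eq_one (hp : p ≠ 2) : ‖(2 : ℚ_[p])‖ = 1 := by
  have h := Padic.norm_natCast_eq_one_iff (p := p) (n := 2)
  rw [show (2 : ℚ_[p]) = ((2 : ℕ) : ℚ_[p]) by norm_num, h]
  exact (Nat.coprime_primes (Fact.out : p.Prime) Nat.prime_two).mpr hp

theorem norm_le_zpow_of_lt {x : ℚ_[p]} {k : ℤ} (h : ‖x‖ < (p : ℝ) ^ (k + 1)) :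
    ‖x‖ ≤ (p : ℝ) ^ k :=
  (Padic.norm_le_pow_iff_norm_lt_pow_add_one x k).mpr h

theorem norm_le_inv_of_lt_one {x : ℚ_[p]} (h : ‖x‖ < 1) : ‖x‖ ≤ (p : ℝ)⁻¹ := by
  have := norm_le_zpow_of_lt (x := x) (k := -1) (by simpa using h)
  simpa using this

theorem exists_norm_eq_zpow {x : ℚ_[p]} (hx : x ≠ 0) : ∃ k : ℤ, ‖x‖ = (p : ℝ) ^ k :=
  ⟨-x.valuation, Padic.norm_eq_zpow_neg_valuation hx⟩

theorem norm_add_eq_of_lt {x z : ℚ_[p]} (h : ‖z‖ < ‖x‖) : ‖x + z‖ = ‖x‖ := by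
  rw [IsUltrametricDist.norm_add_eq_max_of_norm_ne_norm h.ne', max_eq_left h.le]

theorem norm_add_le_of_le {x z : ℚ_[p]} {r : ℝ} (hx : ‖x‖ ≤ r) (hz : ‖z‖ ≤ r) : ‖x + z‖ ≤ r :=
  (IsUltrametricDist.norm_add_le_max x z).trans (max_le hx hz)

theorem norm_sub_le_of_le {x z : ℚ_[p]} {r : ℝ} (hx : ‖x‖ ≤ r) (hz : ‖z‖ ≤ r) : ‖x - z‖ ≤ r := by
  rw [sub_eq_add_neg]
  exact norm_add_le_of_le hx (by rwa [norm_neg])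

theorem norm_add_le_iff {x z : ℚ_[p]} {r : ℝ} (hz : ‖z‖ ≤ r) : ‖x + z‖ ≤ r ↔ ‖x‖ ≤ r := by
  refine ⟨fun h => ?_, fun h => norm_add_le_of_le h hz⟩
  simpa using norm_sub_le_of_le h hz

/-- The closed ball of radius `p ^ k` in `ℚ_p`. -/
def qball (p : ℕ) [Fact p.Prime] (k : ℤ) : Set ℚ_[p] := {x | ‖x‖ ≤ (p : ℝ) ^ k}

theorem mem_qball {k : ℤ} {x : ℚ_[p]} : x ∈ qball p k ↔ ‖x‖ ≤ (p : ℝ) ^ k := Iff.rfl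

theorem qball_zero : qball p 0 = {x | ‖x‖ ≤ 1} := by simp [qball]

theorem qball_eq_closedBall (k : ℤ) : qball p k = Metric.closedBall 0 ((p : ℝ) ^ k) := by
  ext; simp [qball]

theorem isOpen_qball (k : ℤ) : IsOpen (qball p k) := by
  rw [qball_eq_closedBall]
  exact IsUltrametricDist.isOpen_closedBall 0 (zpow_pos prime_cast_pos k).ne'

theorem isCompact_qball (k : ℤ) : IsCompact (qball p k) := by
  rw [qball_eq_closedBall]
  exact isCompact_closedBall 0 _

theorem measurableSet_qball (k : ℤ) : MeasurableSet (qball p k) := (isOpen_qball k).measurableSet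

instance instIsAddHaarMeasureQp : (haarQp p).IsAddHaarMeasure := by
  unfold haarQp; infer_instance

theorem haarQp_qball_zero : haarQp p (qball p 0) = 1 := by
  rw [qball_zero]
  exact Measure.addHaarMeasure_self

/-- The coset of `x` is determined by the residue `t` of `x p^(k+1)` modulo `p`. -/
theorem qball_succ_eq (k : ℤ) :
    qball p (k + 1) = ⋃ t ∈ Finset.range p,
      (fun x => -((t : ℚ_[p]) * (p : ℚ_[p]) ^ (-(k + 1))) + x) ⁻¹' qball p k := by
  have hp0 := prime_cast_pos (p := p)
  ext x
  simp only [Set.mem_iUnion, Set.mem_preimage, Finset.mem_range, exists_prop, mem_qball]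
  constructor
  · intro hx
    have hy : ‖x * (p : ℚ_[p]) ^ (k + 1)‖ ≤ 1 := by
      rw [norm_mul, norm_prime_zpow]
      calc _ ≤ (p : ℝ) ^ (k + 1) * (p : ℝ) ^ (-(k + 1)) := by gcongr
        _ = 1 := by rw [← zpow_add₀ hp0.ne']; simp
    obtain ⟨t, ht, h⟩ := PadicInt.exists_mem_range (p := p) ⟨_, hy⟩
    refine ⟨t, ht, ?_⟩
    rw [IsLocalRing.mem_maximalIdeal, PadicInt.mem_nonunits, PadicInt.norm_def] at h
    apply norm_le_zpow_of_lt
    have e : -((t : ℚ_[p]) * (p : ℚ_[p]) ^ (-(k + 1))) + x =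
        (x * (p : ℚ_[p]) ^ (k + 1) - t) * (p : ℚ_[p]) ^ (-(k + 1)) := by
      rw [sub_mul, mul_assoc, ← zpow_add₀ prime_cast_ne_zero]; simp; ring
    rw [e, norm_mul, norm_prime_zpow, neg_neg]
    exact mul_lt_of_lt_one_left (zpow_pos hp0 _) h
  · rintro ⟨t, -, h⟩
    have h1 : ‖(t : ℚ_[p]) * (p : ℚ_[p]) ^ (-(k + 1))‖ ≤ (p : ℝ) ^ (k + 1) := by
      rw [norm_mul, norm_prime_zpow, neg_neg]
      exact mul_le_of_le_one_left (zpow_pos hp0 _).le (by exact_mod_cast Padic.norm_int_le_one (t : ℤ))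
    have h2 : ‖-((t : ℚ_[p]) * (p : ℚ_[p]) ^ (-(k + 1))) + x‖ ≤ (p : ℝ) ^ (k + 1) :=
      h.trans (zpow_le_zpow_right₀ one_lt_prime_cast.le (by omega))
    simpa using norm_add_le_of_le h1 h2

theorem natCast_eq_of_norm_sub_lt_one {s t : ℕ} (hs : s < p) (ht : t < p)
    (h : ‖(s : ℚ_[p]) - t‖ < 1) : s = t := by
  have h2 : ‖(((s : ℤ) - (t : ℤ) : ℤ) : ℚ_[p])‖ < 1 := by push_cast; exact h
  rw [Padic.norm_intCast_lt_one_iff] at h2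
  have := Int.eq_zero_of_abs_lt_dvd h2 (by rw [abs_lt]; omega)
  omega

theorem haarQp_qball_succ (k : ℤ) : haarQp p (qball p (k + 1)) = p * haarQp p (qball p k) := by
  have hp0 := prime_cast_pos (p := p)
  rw [qball_succ_eq, measure_biUnion_finset]
  · simp only [measure_preimage_add]
    simp
  · intro s hs t ht hst
    rw [Function.onFun, Set.disjoint_left]
    intro x hx hx'
    apply hst
    simp only [Set.mem_preimage, mem_qball] at hx hx'
    refine natCast_eq_of_norm_sub_lt_one (Finset.mem_range.mp hs) (Finset.mem_range.mp ht) ?_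
    have h := norm_sub_le_of_le hx' hx
    rw [show -((t : ℚ_[p]) * (p : ℚ_[p]) ^ (-(k + 1))) + x -
      (-((s : ℚ_[p]) * (p : ℚ_[p]) ^ (-(k + 1))) + x) =
      ((s : ℚ_[p]) - t) * (p : ℚ_[p]) ^ (-(k + 1)) by ring, norm_mul, norm_prime_zpow, neg_neg,
      zpow_add_one₀ hp0.ne'] at h
    have hk := zpow_pos hp0 k
    have h3 := one_lt_prime_cast (p := p)
    by_contra! h4
    have h5 := mul_le_mul_of_nonneg_right h4 (mul_pos hk hp0).le
    nlinarith
  · intro t _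
    exact (measurableSet_qball k).preimage (measurable_const_add _)

theorem haarQp_qball (k : ℤ) : haarQp p (qball p k) = ENNReal.ofReal ((p : ℝ) ^ k) := by
  have hp0 := prime_cast_pos (p := p)
  have hstep : ∀ k : ℤ, ENNReal.ofReal ((p : ℝ) ^ (k + 1)) = p * ENNReal.ofReal ((p : ℝ) ^ k) := by
    intro k
    rw [zpow_add_one₀ hp0.ne', mul_comm, ENNReal.ofReal_mul hp0.le, ENNReal.ofReal_natCast]
  induction k using Int.induction_on with
  | zero => simp [haarQp_qball_zero]
  | succ n ih => rw [haarQp_qball_succ, ih, hstep]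
  | pred n ih =>
    have h := haarQp_qball_succ (p := p) (-(n : ℤ) - 1)
    have h2 := hstep (-(n : ℤ) - 1)
    rw [sub_add_cancel] at h h2
    rw [ih, h2] at h
    refine ((ENNReal.mul_right_inj ?_ ?_).mp h).symm
    · exact_mod_cast (Fact.out : p.Prime).ne_zero
    · exact ENNReal.natCast_ne_top p

theorem haarQp_real_qball (k : ℤ) : (haarQp p).real (qball p k) = (p : ℝ) ^ k := by
  rw [Measure.real, haarQp_qball, ENNReal.toReal_ofReal (zpow_pos prime_cast_pos k).le]

theorem haarQp_qball_lt_top (k : ℤ) : haarQp p (qball p k) < ⊤ := by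
  rw [haarQp_qball]; exact ENNReal.ofReal_lt_top

/-- Uniqueness of Haar measure: multiplication by a unit preserves `ℤ_p`, so the image measure has
the same normalization. -/
theorem measurePreserving_unit_mul {u : ℚ_[p]} (hu : ‖u‖ = 1) :
    MeasurePreserving (fun x => u * x) (haarQp p) (haarQp p) := by
  have hu0 : u ≠ 0 := by rintro rfl; simp at hu
  have hm : Measurable fun x : ℚ_[p] => u * x := (continuous_const_mul u).measurable
  refine ⟨hm, ?_⟩
  let e : ℚ_[p] ≃+ ℚ_[p] :=
    { Equiv.mulLeft₀ u hu0 with map_add' := fun x y => mul_add u x y }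
  have he : (fun x => u * x) = (e : ℚ_[p] → ℚ_[p]) := rfl
  have : ((haarQp p).map (fun x => u * x)).IsAddHaarMeasure := by
    rw [he]
    refine AddEquiv.isAddHaarMeasure_map _ e (continuous_const_mul u) ?_
    have : (e.symm : ℚ_[p] → ℚ_[p]) = fun x => u⁻¹ * x := rfl
    rw [this]
    exact continuous_const_mul _
  have h := Measure.addHaarMeasure_unique ((haarQp p).map (fun x => u * x)) (ZpCompacts p)
  rw [h, Measure.map_apply hm (ZpCompacts p).isCompact.measurableSet]
  have h2 : (fun x => u * x) ⁻¹' (ZpCompacts p : Set ℚ_[p]) = qball p 0 := by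
    rw [qball_zero]
    ext x
    show ‖u * x‖ ≤ 1 ↔ ‖x‖ ≤ 1
    rw [norm_mul, hu, one_mul]
  rw [h2, haarQp_qball_zero, one_smul, haarQp]

theorem integral_unit_mul {u : ℚ_[p]} (hu : ‖u‖ = 1) (f : ℚ_[p] → ℂ) :
    ∫ x, f (u * x) ∂haarQp p = ∫ x, f x ∂haarQp p := by
  have hu0 : u ≠ 0 := by rintro rfl; simp at hu
  exact (measurePreserving_unit_mul hu).integral_comp
    (Homeomorph.mulLeft₀ u hu0).measurableEmbedding f

theorem setIntegral_qball_unit_mul {u : ℚ_[p]} (hu : ‖u‖ = 1) (k : ℤ) (f : ℚ_[p] → ℂ) :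
    ∫ x in qball p k, f (u * x) ∂haarQp p = ∫ x in qball p k, f x ∂haarQp p := by
  rw [← integral_indicator (measurableSet_qball k), ← integral_indicator (measurableSet_qball k),
    ← integral_unit_mul hu ((qball p k).indicator f)]
  congr 1 with x
  simp [Set.indicator, mem_qball, hu]

theorem setIntegral_qball_add {z : ℚ_[p]} {k : ℤ} (hz : ‖z‖ ≤ (p : ℝ) ^ k) (f : ℚ_[p] → ℂ) :
    ∫ x in qball p k, f (x + z) ∂haarQp p = ∫ x in qball p k, f x ∂haarQp p := by
  rw [← integral_indicator (measurableSet_qball k), ← integral_indicator (measurableSet_qball k),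
    ← integral_add_right_eq_self ((qball p k).indicator f) z]
  congr 1 with x
  simp [Set.indicator, mem_qball, norm_add_le_iff hz]

theorem isLocallyConstant_of_shift {X : Type*} {f : ℚ_[p] → X} {r : ℝ} (hr : 0 < r)
    (h : ∀ x z, ‖z‖ ≤ r → f (x + z) = f x) : IsLocallyConstant f := by
  rw [IsLocallyConstant.iff_eventually_eq]
  intro x
  filter_upwards [Metric.closedBall_mem_nhds x hr] with y hy
  rw [← h x (y - x) (by simpa [dist_eq_norm] using hy), add_sub_cancel]

/-! ### Orthogonality for characters with kernel `ℤ_p`, and localization of oscillatory integrals -/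

section AdditiveCharacter

variable {ψ : AddChar ℚ_[p] Circle} (hψ : ∀ x : ℚ_[p], ψ x = 1 ↔ ‖x‖ ≤ 1)
include hψ

theorem addChar_add_of_norm_le {x z : ℚ_[p]} (hz : ‖z‖ ≤ 1) : ψ (x + z) = ψ x := by
  rw [AddChar.map_add_eq_mul, (hψ z).mpr hz, mul_one]

theorem continuous_addChar : Continuous fun x => (ψ x : ℂ) := by
  have : IsLocallyConstant ψ :=
    isLocallyConstant_of_shift one_pos fun x z hz => addChar_add_of_norm_le hψ hz
  exact continuous_subtype_val.comp this.continuous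

theorem kernel_mulShift_unit {u : ℚ_[p]} (hu : ‖u‖ = 1) (x : ℚ_[p]) :
    ψ.mulShift u x = 1 ↔ ‖x‖ ≤ 1 := by
  rw [AddChar.mulShift_apply, hψ, norm_mul, hu, one_mul]

/-- Orthogonality: the integral is invariant under translation in the ball, which multiplies it by a
value of the character; a non-trivial value forces it to vanish. -/
theorem setIntegral_qball_addChar (l : ℚ_[p]) (k : ℤ) :
    ∫ z in qball p k, (ψ (l * z) : ℂ) ∂haarQp p =
      if ‖l‖ * (p : ℝ) ^ k ≤ 1 then (p : ℂ) ^ k else 0 := by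
  split_ifs with h
  · have : ∫ z in qball p k, (ψ (l * z) : ℂ) ∂haarQp p = ∫ z in qball p k, 1 ∂haarQp p := by
      refine setIntegral_congr_fun (measurableSet_qball k) fun z hz => ?_
      have : ψ (l * z) = 1 := by
        rw [hψ, norm_mul]
        exact (mul_le_mul_of_nonneg_left hz (norm_nonneg l)).trans h
      simp [this]
    rw [this, setIntegral_const, haarQp_real_qball]
    simp
  · have hz : ‖(p : ℚ_[p]) ^ (-k)‖ = (p : ℝ) ^ k := by rw [norm_prime_zpow, neg_neg]
    have h1 := setIntegral_qball_add (k := k) hz.le fun z => (ψ (l * z) : ℂ)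
    simp only [mul_add, AddChar.map_add_eq_mul, Circle.coe_mul] at h1
    rw [integral_mul_const] at h1
    have h2 : (ψ (l * (p : ℚ_[p]) ^ (-k)) : ℂ) ≠ 1 := by
      rw [Ne, Circle.coe_eq_one, hψ, norm_mul, hz]; exact h
    by_contra h3
    exact h2 (mul_left_cancel₀ h3 (by rw [h1, mul_one]))

theorem integrable_mul_addChar {f : ℚ_[p] → ℂ} (hf : Integrable f (haarQp p))
    {l : ℚ_[p] → ℚ_[p]} (hl : Continuous l) :
    Integrable (fun y => f y * (ψ (l y) : ℂ)) (haarQp p) :=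
  hf.mul_bdd (c := 1) ((continuous_addChar hψ).comp hl).aestronglyMeasurable
    (Eventually.of_forall fun _ => (Circle.norm_coe _).le)

/-- If small translations change `F` by an additive character with slope `l`, then only
the points where the slope is small contribute to the integral of `F`. -/
theorem integral_eq_setIntegral_of_shift {F : ℚ_[p] → ℂ} (hF : Integrable F (haarQp p))
    {l : ℚ_[p] → ℚ_[p]} (hl : Continuous l) (k : ℤ)
    (h : ∀ y z, ‖z‖ ≤ (p : ℝ) ^ k → F (y + z) = F y * (ψ (l y * z) : ℂ)) :
    ∫ y, F y ∂haarQp p = ∫ y in {y | ‖l y‖ * (p : ℝ) ^ k ≤ 1}, F y ∂haarQp p := by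
  have hE : MeasurableSet {y : ℚ_[p] | ‖l y‖ * (p : ℝ) ^ k ≤ 1} :=
    (isClosed_le (by fun_prop) continuous_const).measurableSet
  have : IsFiniteMeasure ((haarQp p).restrict (qball p k)) :=
    ⟨by rw [Measure.restrict_apply_univ]; exact haarQp_qball_lt_top k⟩
  have hint : Integrable (Function.uncurry fun z y => F y * (ψ (l y * z) : ℂ))
      (((haarQp p).restrict (qball p k)).prod (haarQp p)) := by
    refine (hF.comp_snd ((haarQp p).restrict (qball p k))).mul_bdd (c := 1) ?_
      (Eventually.of_forall fun _ => (Circle.norm_coe _).le)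
    exact ((continuous_addChar hψ).comp (by fun_prop : Continuous fun q : ℚ_[p] × ℚ_[p] =>
      l q.2 * q.1)).aestronglyMeasurable
  -- Average the translation formula over `z` in the ball. After exchanging the integrals,
  -- orthogonality in `z` keeps the points of small slope only.
  have h1 : (p : ℂ) ^ k * ∫ y, F y ∂haarQp p =
      ∫ z in qball p k, ∫ y, F y * (ψ (l y * z) : ℂ) ∂haarQp p ∂haarQp p := by
    have : ∫ z in qball p k, ∫ y, F y * (ψ (l y * z) : ℂ) ∂haarQp p ∂haarQp p =
        ∫ z in qball p k, ∫ y, F y ∂haarQp p ∂haarQp p := by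
      refine setIntegral_congr_fun (measurableSet_qball k) fun z hz => ?_
      rw [← integral_add_right_eq_self F z]
      exact integral_congr_ae (Eventually.of_forall fun y => (h y z hz).symm)
    rw [this, setIntegral_const, haarQp_real_qball, Complex.real_smul]
    push_cast
    rfl
  rw [integral_integral_swap hint] at h1
  simp only [integral_const_mul, setIntegral_qball_addChar hψ] at h1
  have h2 : ∫ y, F y * (if ‖l y‖ * (p : ℝ) ^ k ≤ 1 then (p : ℂ) ^ k else 0) ∂haarQp p =
      (p : ℂ) ^ k * ∫ y in {y | ‖l y‖ * (p : ℝ) ^ k ≤ 1}, F y ∂haarQp p := by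
    rw [← integral_indicator hE, ← integral_const_mul]
    congr 1 with y
    by_cases hy : ‖l y‖ * (p : ℝ) ^ k ≤ 1 <;> simp [Set.indicator, hy, mul_comm (F y)]
  rw [h2] at h1
  exact mul_left_cancel₀ (zpow_ne_zero _ (by exact_mod_cast (Fact.out : p.Prime).ne_zero)) h1

end AdditiveCharacter

/-! ### Squares and Hilbert symbols -/

/-- Hensel's lemma for `X² - x` at `y`: the derivative `2y` is a unit because `p` is odd. -/
theorem isSquare_of_norm_sub_sq_lt_one (hp : p ≠ 2) {x y : ℚ_[p]} (hy : ‖y‖ = 1)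
    (h : ‖x - y ^ 2‖ < 1) : IsSquare x := by
  have hx : ‖x‖ ≤ 1 := by
    have := norm_add_le_of_le h.le (show ‖y ^ 2‖ ≤ 1 by simp [hy])
    simpa using this
  let X : ℤ_[p] := ⟨x, hx⟩
  let Y : ℤ_[p] := ⟨y, hy.le⟩
  have hd : ‖(Polynomial.X ^ 2 - Polynomial.C X).derivative.aeval Y‖ = 1 := by
    have h2 : ‖(2 : ℤ_[p])‖ = 1 := by
      rw [PadicInt.norm_def]; exact_mod_cast norm_two_eq_one hp
    have hY : ‖Y‖ = 1 := hy
    have e : (Polynomial.X ^ 2 - Polynomial.C X).derivative.aeval Y = 2 * Y := by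
      simp [one_add_one_eq_two]
    rw [e, norm_mul, h2, hY, one_mul]
  obtain ⟨z, hz, -⟩ := hensels_lemma (p := p) (F := Polynomial.X ^ 2 - Polynomial.C X) (a := Y) (by
    rw [hd]
    have e : (Polynomial.X ^ 2 - Polynomial.C X).aeval Y = Y ^ 2 - X := by simp
    rw [e, norm_sub_rev, one_pow, PadicInt.norm_def]
    exact_mod_cast h)
  refine ⟨(z : ℚ_[p]), ?_⟩
  have e : z ^ 2 - X = 0 := by simpa using hz
  have e2 : (z : ℚ_[p]) ^ 2 - x = 0 := by
    have h3 : ((z ^ 2 - X : ℤ_[p]) : ℚ_[p]) = 0 := by rw [e]; rfl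
    push_cast at h3
    exact h3
  linear_combination -e2

theorem norm_lt_one_iff_toZMod (x : ℤ_[p]) : ‖(x : ℚ_[p])‖ < 1 ↔ PadicInt.toZMod x = 0 := by
  rw [← RingHom.mem_ker, PadicInt.ker_toZMod, IsLocalRing.mem_maximalIdeal, PadicInt.mem_nonunits,
    PadicInt.norm_def]

theorem isSquare_of_isSquare_toZMod (hp : p ≠ 2) {x : ℤ_[p]} (hx : ‖(x : ℚ_[p])‖ = 1)
    (h : IsSquare (PadicInt.toZMod x)) : IsSquare (x : ℚ_[p]) := by
  obtain ⟨t, ht⟩ := h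
  have h1 : ‖((x - (t.val : ℤ_[p]) ^ 2 : ℤ_[p]) : ℚ_[p])‖ < 1 := by
    rw [norm_lt_one_iff_toZMod, map_sub, map_pow, map_natCast, ZMod.natCast_zmod_val, ht]; ring
  push_cast at h1
  refine isSquare_of_norm_sub_sq_lt_one hp ?_ h1
  have h2 : ‖(x : ℚ_[p]) + ((t.val : ℚ_[p]) ^ 2 - x)‖ = 1 := by
    rw [norm_add_eq_of_lt, hx]
    rwa [hx, norm_sub_rev]
  rw [add_sub_cancel, norm_pow] at h2
  exact (pow_eq_one_iff_of_nonneg (norm_nonneg _) two_ne_zero).mp h2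

/-- Square classes of units are detected in the residue field, where the quadratic character is
multiplicative. -/
theorem isSquare_mul_of_not_isSquare (hp : p ≠ 2) {x y : ℚ_[p]} (hx : ‖x‖ = 1) (hy : ‖y‖ = 1)
    (hx' : ¬ IsSquare x) (hy' : ¬ IsSquare y) : IsSquare (x * y) := by
  let X : ℤ_[p] := ⟨x, hx.le⟩
  let Y : ℤ_[p] := ⟨y, hy.le⟩
  have hX : ¬ IsSquare (PadicInt.toZMod X) := fun h => hx' (isSquare_of_isSquare_toZMod hp hx h)
  have hY : ¬ IsSquare (PadicInt.toZMod Y) := fun h => hy' (isSquare_of_isSquare_toZMod hp hy h)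
  have hXY : IsSquare (PadicInt.toZMod (X * Y)) := by
    have hc : ringChar (ZMod p) ≠ 2 := by rwa [ZMod.ringChar_zmod_n]
    have h1 := (quadraticChar_neg_one_iff_not_isSquare (F := ZMod p)).mpr hX
    have h2 := (quadraticChar_neg_one_iff_not_isSquare (F := ZMod p)).mpr hY
    have h0 : PadicInt.toZMod X * PadicInt.toZMod Y ≠ 0 := by
      refine mul_ne_zero ?_ ?_
      · intro h; rw [h] at hX; exact hX (IsSquare.zero)
      · intro h; rw [h] at hY; exact hY (IsSquare.zero)
    rw [map_mul, ← quadraticChar_one_iff_isSquare h0, map_mul, h1, h2]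
    norm_num
  have e : ((X * Y : ℤ_[p]) : ℚ_[p]) = x * y := PadicInt.coe_mul X Y
  have h := isSquare_of_isSquare_toZMod hp (x := X * Y) (by rw [e, norm_mul, hx, hy, one_mul]) hXY
  rwa [e] at h

theorem hilbertSymbol_eq_one {K : Type*} [Field K] {a b : K} (x y z : K)
    (h0 : ¬ (x = 0 ∧ y = 0 ∧ z = 0)) (h : z ^ 2 = a * x ^ 2 + b * y ^ 2) :
    hilbertSymbol a b = 1 := if_pos ⟨x, y, z, h0, h⟩

theorem hilbertSymbol_of_isSquare_right {K : Type*} [Field K] {a b : K} (h : IsSquare b) :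
    hilbertSymbol a b = 1 := by
  obtain ⟨t, rfl⟩ := h
  exact hilbertSymbol_eq_one 0 1 t (by simp) (by ring)

theorem hilbertSymbol_of_isSquare_left {K : Type*} [Field K] {a b : K} (h : IsSquare a) :
    hilbertSymbol a b = 1 := by
  obtain ⟨t, rfl⟩ := h
  exact hilbertSymbol_eq_one 1 0 t (by simp) (by ring)

/-- The substitution `X = c y`, `Y = c x` turns `-c² x² - c y²` into `-c⁻¹ X² - Y²`. This matches
the cocycle of the Bruhat factorization with the Hilbert symbol in `chiPsi`. -/
theorem hilbertSymbol_neg_sq_neg {K : Type*} [Field K] {c : K} (hc : c ≠ 0) :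
    hilbertSymbol (-c * c) (-1 * c) = hilbertSymbol (-c⁻¹) (-1) := by
  unfold hilbertSymbol
  congr 1
  refine propext ⟨?_, ?_⟩
  · rintro ⟨x, y, z, h0, h⟩
    refine ⟨c * y, c * x, z, ?_, ?_⟩
    · simp only [mul_eq_zero, hc, false_or]
      tauto
    · rw [h]; field_simp; ring
  · rintro ⟨x, y, z, h0, h⟩
    refine ⟨c⁻¹ * y, c⁻¹ * x, z, ?_, ?_⟩
    · simp only [mul_eq_zero, inv_eq_zero, hc, false_or]
      tauto
    · rw [h]; field_simp; ring

/-- Every residue class is a sum of two squares `s² + t²`. As `a` is a unit, one of them is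
non-zero, and Hensel lifts it to give `a = s² + z²`. -/
theorem hilbertSymbol_unit_neg_one (hp : p ≠ 2) {a : ℚ_[p]} (ha : ‖a‖ = 1) :
    hilbertSymbol a (-1) = 1 := by
  let A : ℤ_[p] := ⟨a, ha.le⟩
  have hA : PadicInt.toZMod A ≠ 0 := by
    rw [Ne, ← norm_lt_one_iff_toZMod]; exact not_lt.mpr ha.ge
  have key : ∀ s t : ZMod p, t ≠ 0 → s ^ 2 + t ^ 2 = PadicInt.toZMod A →
      hilbertSymbol a (-1) = 1 := by
    intro s t ht h
    have h1 : ‖((A - (s.val : ℤ_[p]) ^ 2 - (t.val : ℤ_[p]) ^ 2 : ℤ_[p]) : ℚ_[p])‖ < 1 := by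
      rw [norm_lt_one_iff_toZMod]
      simp only [map_sub, map_pow, map_natCast, ZMod.natCast_zmod_val, ← h]; ring
    push_cast at h1
    have h2 : ‖((t.val : ℤ_[p]) : ℚ_[p])‖ = 1 := by
      refine le_antisymm (PadicInt.norm_le_one _) (not_lt.mp ?_)
      rw [norm_lt_one_iff_toZMod, map_natCast, ZMod.natCast_zmod_val]
      exact ht
    push_cast at h2
    obtain ⟨z, hz⟩ := isSquare_of_norm_sub_sq_lt_one hp h2 h1
    refine hilbertSymbol_eq_one 1 (s.val : ℚ_[p]) z (by simp) ?_
    have : a - (s.val : ℚ_[p]) ^ 2 = z * z := hz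
    linear_combination -this
  obtain ⟨s, t, h⟩ := ZMod.sq_add_sq p (PadicInt.toZMod A)
  by_cases ht : t = 0
  · refine key t s ?_ (by rw [← h]; ring)
    rintro rfl
    rw [ht] at h
    exact hA (by rw [← h]; ring)
  · exact key s t ht h

/-- If `v ≠ 0`, the two valuations have opposite parity; if `v = 0`, only the left norm is zero. -/
theorem not_norm_mul_sq_eq {c v w : ℚ_[p]} (hc : Odd c.valuation) (hw : w ≠ 0) :
    ‖c * v ^ 2‖ ≠ ‖w ^ 2‖ := by
  intro h
  have hw2 : w ^ 2 ≠ 0 := pow_ne_zero 2 hw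
  have hcv : c * v ^ 2 ≠ 0 := by
    intro h0; rw [h0, norm_zero] at h; exact hw2 (norm_eq_zero.mp h.symm)
  have hc0 : c ≠ 0 := left_ne_zero_of_mul hcv
  have hv0 : v ^ 2 ≠ 0 := right_ne_zero_of_mul hcv
  rw [Padic.norm_eq_zpow_neg_valuation hcv, Padic.norm_eq_zpow_neg_valuation hw2] at h
  have h2 := zpow_right_injective₀ prime_cast_pos one_lt_prime_cast.ne' h
  rw [Padic.valuation_mul hc0 hv0, Padic.valuation_pow, Padic.valuation_pow] at h2
  obtain ⟨k, hk⟩ := hc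
  push_cast at h2
  omega

/-- A solution with `y ≠ 0` gives `c v² = w² - d`. The right side has even valuation: `‖w‖ < 1` and
`‖w‖ = 1` give a unit (in the latter case because `d` is not a square modulo `p`), and `‖w‖ > 1`
gives the valuation of `w²`. -/
theorem hilbertSymbol_odd_nonsquare (hp : p ≠ 2) {c d : ℚ_[p]} (hc : Odd c.valuation)
    (hd : ‖d‖ = 1) (hds : ¬ IsSquare d) : hilbertSymbol c d = -1 := by
  refine if_neg ?_
  rintro ⟨x, y, z, h0, h⟩
  by_cases hy : y = 0
  · subst hy
    by_cases hz : z = 0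
    · subst hz
      have hx : x ≠ 0 := fun hx => h0 ⟨hx, rfl, rfl⟩
      -- The valuation of `0` is `0` by convention, hence even.
      have hc0 : c ≠ 0 := by rintro rfl; simp at hc
      have : c * x ^ 2 ≠ 0 := mul_ne_zero hc0 (pow_ne_zero 2 hx)
      apply this
      linear_combination -h
    · exact not_norm_mul_sq_eq (v := x) hc hz (by rw [h]; simp)
  · set w := z / y with hw
    have e : c * (x / y) ^ 2 = w ^ 2 - d := by
      rw [hw]; field_simp; linear_combination -h
    rcases lt_trichotomy ‖w‖ 1 with h1 | h1 | h1
    · refine not_norm_mul_sq_eq (v := x / y) (w := 1) hc one_ne_zero ?_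
      have h2 : ‖w ^ 2‖ < ‖-d‖ := by
        rw [norm_neg, hd, norm_pow]; exact pow_lt_one₀ (norm_nonneg _) h1 two_ne_zero
      rw [e, sub_eq_neg_add, norm_add_eq_of_lt h2, norm_neg, hd]; simp
    · have h2 : ‖w ^ 2 - d‖ ≤ 1 := norm_sub_le_of_le (by simp [h1]) hd.le
      rcases h2.lt_or_eq with h3 | h3
      · rw [norm_sub_rev] at h3
        exact hds (isSquare_of_norm_sub_sq_lt_one hp h1 h3)
      · exact not_norm_mul_sq_eq (v := x / y) (w := 1) hc one_ne_zero (by rw [e, h3]; simp)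
    · have hw0 : w ≠ 0 := by rintro h2; rw [h2, norm_zero] at h1; linarith
      refine not_norm_mul_sq_eq (v := x / y) (w := w) hc hw0 ?_
      have h2 : ‖-d‖ < ‖w ^ 2‖ := by
        rw [norm_neg, hd, norm_pow]; exact one_lt_pow₀ h1 two_ne_zero
      rw [e, sub_eq_add_neg, norm_add_eq_of_lt h2]

/-! ### Quadratic Gauss integrals and the Weil index -/

/-- The integral of `ψ(e x²)` over the ball of radius `p ^ k`. -/
def gaussInt (ψ : AddChar ℚ_[p] Circle) (k : ℤ) (e : ℚ_[p]) : ℂ :=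
  ∫ x in qball p k, (ψ (e * x ^ 2) : ℂ) ∂haarQp p

theorem gaussInt_mul_sq (ψ : AddChar ℚ_[p] Circle) (k : ℤ) (e : ℚ_[p]) {u : ℚ_[p]}
    (hu : ‖u‖ = 1) : gaussInt ψ k (e * u ^ 2) = gaussInt ψ k e := by
  unfold gaussInt
  rw [← setIntegral_qball_unit_mul hu k fun x => (ψ (e * x ^ 2) : ℂ)]
  simp only [mul_pow, mul_assoc]

theorem circle_mul_conj (z : Circle) : (z : ℂ) * conj (z : ℂ) = 1 := by
  rw [Complex.mul_conj, Complex.normSq_eq_norm_sq, Circle.norm_coe]; simp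

theorem gaussInt_neg (ψ : AddChar ℚ_[p] Circle) (k : ℤ) (e : ℚ_[p]) :
    gaussInt ψ k (-e) = conj (gaussInt ψ k e) := by
  unfold gaussInt
  rw [← integral_conj]
  simp only [neg_mul, AddChar.map_neg_eq_inv, Circle.coe_inv_eq_conj]

section

variable {ψ : AddChar ℚ_[p] Circle} (hψ : ∀ x : ℚ_[p], ψ x = 1 ↔ ‖x‖ ≤ 1)
include hψ

theorem addChar_mul_add_sq {e y z : ℚ_[p]} (h : ‖e * z ^ 2‖ ≤ 1) :
    (ψ (e * (y + z) ^ 2) : ℂ) = ψ (e * y ^ 2) * ψ (2 * e * y * z) := by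
  rw [show e * (y + z) ^ 2 = (e * y ^ 2 + 2 * e * y * z) + e * z ^ 2 by ring,
    addChar_add_of_norm_le hψ h, AddChar.map_add_eq_mul, Circle.coe_mul]

theorem integrableOn_addChar_comp {l : ℚ_[p] → ℚ_[p]} (hl : Continuous l) (k : ℤ) :
    IntegrableOn (fun x => (ψ (l x) : ℂ)) (qball p k) (haarQp p) :=
  ((continuous_addChar hψ).comp hl).continuousOn.integrableOn_compact (isCompact_qball k)

/-- Stationary phase: `e x²` has its critical point at `0`, and the part of the larger ball outside
radius `p^k` integrates to zero. -/
theorem gaussInt_stable (hp : p ≠ 2) {e : ℚ_[p]} {m k n : ℤ} (he : ‖e‖ = (p : ℝ) ^ m)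
    (hk : 0 ≤ m + 2 * k) (hn : k ≤ n) : gaussInt ψ n e = gaussInt ψ k e := by
  have hp0 := prime_cast_pos (p := p)
  have hp1 := one_lt_prime_cast (p := p)
  unfold gaussInt
  rw [← integral_indicator (measurableSet_qball n)]
  have hF : Integrable ((qball p n).indicator fun x => (ψ (e * x ^ 2) : ℂ)) (haarQp p) :=
    (integrable_indicator_iff (measurableSet_qball n)).mpr
      (integrableOn_addChar_comp hψ (by fun_prop) n)
  -- For shifts of norm at most `p^(-k-m)` the term `e z²` is integral, as `m + 2k ≥ 0`, and the
  -- slope condition reads `‖y‖ ≤ p^k`.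
  rw [integral_eq_setIntegral_of_shift hψ hF (l := fun y => 2 * e * y) (by fun_prop) (-k - m)]
  · have hs : {y : ℚ_[p] | ‖2 * e * y‖ * (p : ℝ) ^ (-k - m) ≤ 1} = qball p k := by
      ext y
      rw [Set.mem_ofPred_eq, mem_qball, norm_mul, norm_mul, norm_two_eq_one hp, he, one_mul,
        mul_right_comm, ← zpow_add₀ hp0.ne', show m + (-k - m) = -k by ring, zpow_neg,
        inv_mul_le_iff₀ (zpow_pos hp0 k), mul_one]
    rw [hs, setIntegral_indicator (measurableSet_qball n)]
    congr 2
    refine Set.inter_eq_left.mpr fun x hx => ?_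
    exact (mem_qball.mp hx).trans (zpow_le_zpow_right₀ hp1.le hn)
  · intro y z hz
    have h1 : ‖z‖ ≤ (p : ℝ) ^ n := hz.trans (zpow_le_zpow_right₀ hp1.le (by omega))
    have h2 : ‖e * z ^ 2‖ ≤ 1 := by
      rw [norm_mul, norm_pow, he]
      calc (p : ℝ) ^ m * ‖z‖ ^ 2 ≤ (p : ℝ) ^ m * ((p : ℝ) ^ (-k - m)) ^ 2 := by gcongr
        _ = (p : ℝ) ^ (-(m + 2 * k)) := by
          rw [← zpow_natCast, ← zpow_mul, ← zpow_add₀ hp0.ne']; congr 1; push_cast; ring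
        _ ≤ (p : ℝ) ^ (0 : ℤ) := zpow_le_zpow_right₀ hp1.le (by omega)
        _ = 1 := zpow_zero _
    by_cases hy : ‖y‖ ≤ (p : ℝ) ^ n
    · rw [Set.indicator_of_mem (mem_qball.mpr hy),
        Set.indicator_of_mem (mem_qball.mpr ((norm_add_le_iff h1).mpr hy)),
        addChar_mul_add_sq hψ h2]
    · rw [Set.indicator_of_notMem (fun h => hy (mem_qball.mp h)),
        Set.indicator_of_notMem (fun h => hy ((norm_add_le_iff h1).mp (mem_qball.mp h))), zero_mul]

/-- Write the squared modulus as a double integral and substitute `x + y` for `x`, which leaves `ψ(e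
x²) ψ(2exy)`. Integrating over `y` confines `x` to the ball of radius `p^(-k-m)`, where `ψ(e x²) =
1`; the total is `p^k p^(-k-m) = p^(-m)`. -/
theorem norm_gaussInt (hp : p ≠ 2) {e : ℚ_[p]} {m k : ℤ} (he : ‖e‖ = (p : ℝ) ^ m)
    (hk : 0 ≤ m + 2 * k) : ‖gaussInt ψ k e‖ = √(‖e‖⁻¹) := by
  have hp0 := prime_cast_pos (p := p)
  have hp1 := one_lt_prime_cast (p := p)
  have hpc : (p : ℂ) ≠ 0 := by exact_mod_cast (Fact.out : p.Prime).ne_zero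
  have hfin : IsFiniteMeasure ((haarQp p).restrict (qball p k)) :=
    ⟨by rw [Measure.restrict_apply_univ]; exact haarQp_qball_lt_top k⟩
  have hsq : gaussInt ψ k e * conj (gaussInt ψ k e) = (p : ℂ) ^ (-m) := by
    calc gaussInt ψ k e * conj (gaussInt ψ k e)
        = ∫ y in qball p k, gaussInt ψ k e * conj (ψ (e * y ^ 2) : ℂ) ∂haarQp p := by
          rw [integral_const_mul]
          congr 1
          rw [gaussInt, ← integral_conj]
      _ = ∫ y in qball p k, ∫ x in qball p k,
            (ψ (e * x ^ 2) : ℂ) * ψ (2 * e * x * y) ∂haarQp p ∂haarQp p := by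
          refine setIntegral_congr_fun (measurableSet_qball k) fun y hy => ?_
          simp only [gaussInt]
          rw [← setIntegral_qball_add (mem_qball.mp hy), ← integral_mul_const]
          congr 1 with x
          rw [show e * (x + y) ^ 2 = e * x ^ 2 + 2 * e * x * y + e * y ^ 2 by ring,
            AddChar.map_add_eq_mul, AddChar.map_add_eq_mul, Circle.coe_mul, Circle.coe_mul,
            mul_assoc, circle_mul_conj, mul_one]
      _ = ∫ x in qball p k, ∫ y in qball p k,
            (ψ (e * x ^ 2) : ℂ) * ψ (2 * e * x * y) ∂haarQp p ∂haarQp p := by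
          refine integral_integral_swap ?_
          refine Integrable.of_bound (C := 1) ?_ (Eventually.of_forall fun q => ?_)
          · refine Continuous.aestronglyMeasurable ?_
            exact ((continuous_addChar hψ).comp (by fun_prop)).mul
              ((continuous_addChar hψ).comp (by fun_prop))
          · simp [Function.uncurry, Circle.norm_coe]
      _ = ∫ x in qball p k, (qball p (-k - m)).indicator (fun _ => (p : ℂ) ^ k) x ∂haarQp p := by
          refine setIntegral_congr_fun (measurableSet_qball k) fun x hx => ?_
          rw [integral_const_mul, setIntegral_qball_addChar hψ]
          have hs : ‖2 * e * x‖ * (p : ℝ) ^ k ≤ 1 ↔ x ∈ qball p (-k - m) := by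
            rw [mem_qball, norm_mul, norm_mul, norm_two_eq_one hp, he, one_mul,
              mul_right_comm, ← zpow_add₀ hp0.ne', show -k - m = -(m + k) by ring, zpow_neg,
              ← div_eq_mul_inv (1 : ℝ) _ |>.trans (one_mul _) , le_div_iff₀ (zpow_pos hp0 _),
              mul_comm]
          by_cases h : x ∈ qball p (-k - m)
          · have h1 : ψ (e * x ^ 2) = 1 := by
              rw [hψ, norm_mul, norm_pow, he]
              have := mem_qball.mp h
              calc (p : ℝ) ^ m * ‖x‖ ^ 2 ≤ (p : ℝ) ^ m * ((p : ℝ) ^ (-k - m)) ^ 2 := by gcongr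
                _ = (p : ℝ) ^ (-(m + 2 * k)) := by
                  rw [← zpow_natCast, ← zpow_mul, ← zpow_add₀ hp0.ne']; congr 1; push_cast; ring
                _ ≤ (p : ℝ) ^ (0 : ℤ) := zpow_le_zpow_right₀ hp1.le (by omega)
                _ = 1 := zpow_zero _
            rw [if_pos (hs.mpr h), Set.indicator_of_mem h, h1]; simp
          · rw [if_neg (fun h' => h (hs.mp h')), Set.indicator_of_notMem h, mul_zero]
      _ = (p : ℂ) ^ (-m) := by
          rw [setIntegral_indicator (measurableSet_qball _), Set.inter_eq_right.mpr,
            setIntegral_const, haarQp_real_qball, Complex.real_smul]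
          · push_cast
            rw [← zpow_add₀ hpc]; congr 1; ring
          · intro x hx
            exact (mem_qball.mp hx).trans (zpow_le_zpow_right₀ hp1.le (by omega))
  rw [Complex.mul_conj, Complex.normSq_eq_norm_sq] at hsq
  have h2 : ‖gaussInt ψ k e‖ ^ 2 = ‖e‖⁻¹ := by
    rw [he, ← zpow_neg]
    apply Complex.ofReal_injective
    rw [hsq]
    push_cast
    rfl
  rw [← h2, Real.sqrt_sq (norm_nonneg _)]

theorem gaussInt_ne_zero (hp : p ≠ 2) {e : ℚ_[p]} {m k : ℤ} (he : ‖e‖ = (p : ℝ) ^ m)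
    (hk : 0 ≤ m + 2 * k) : gaussInt ψ k e ≠ 0 := by
  rw [← norm_ne_zero_iff, norm_gaussInt hψ hp he hk, he]
  have := zpow_pos (prime_cast_pos (p := p)) m
  positivity

/-- The sequence defining the Weil index is eventually constant, by `gaussInt_stable`. -/
theorem weilIndex_mulShift (hp : p ≠ 2) {e : ℚ_[p]} {m k : ℤ} (he : ‖e‖ = (p : ℝ) ^ m)
    (hk : 0 ≤ m + 2 * k) :
    weilIndex (ψ.mulShift e) = gaussInt ψ k e / (‖gaussInt ψ k e‖ : ℂ) := by
  have hset : ∀ n : ℕ, {x : ℚ_[p] | ‖x‖ ≤ (p : ℝ) ^ n} = qball p (n : ℤ) := by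
    intro n; ext x; simp [qball]
  unfold weilIndex
  refine Tendsto.limUnder_eq (tendsto_const_nhds.congr' ?_)
  filter_upwards [eventually_ge_atTop k.toNat] with n hn
  simp only [hset, AddChar.mulShift_apply]
  rw [← gaussInt_stable hψ hp he hk (n := n) (by omega)]
  rfl

theorem gaussInt_eq (hp : p ≠ 2) {e : ℚ_[p]} {m k : ℤ} (he : ‖e‖ = (p : ℝ) ^ m)
    (hk : 0 ≤ m + 2 * k) :
    gaussInt ψ k e = weilIndex (ψ.mulShift e) * (√(‖e‖⁻¹) : ℝ) := by
  rw [weilIndex_mulShift hψ hp he hk, ← norm_gaussInt hψ hp he hk, div_mul_cancel₀]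
  simpa using gaussInt_ne_zero hψ hp he hk

theorem norm_weilIndex_mulShift (hp : p ≠ 2) {e : ℚ_[p]} (he : e ≠ 0) :
    ‖weilIndex (ψ.mulShift e)‖ = 1 := by
  obtain ⟨m, hm⟩ := exists_norm_eq_zpow he
  have hk : 0 ≤ m + 2 * |m| := by have := neg_abs_le m; have := abs_nonneg m; omega
  rw [weilIndex_mulShift hψ hp hm hk, norm_div, Complex.norm_real, norm_norm, div_self]
  exact norm_ne_zero_iff.mpr (gaussInt_ne_zero hψ hp hm hk)

theorem weilIndex_mulShift_mul_sq (hp : p ≠ 2) {e u : ℚ_[p]} (he : e ≠ 0) (hu : ‖u‖ = 1) :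
    weilIndex (ψ.mulShift (e * u ^ 2)) = weilIndex (ψ.mulShift e) := by
  obtain ⟨m, hm⟩ := exists_norm_eq_zpow he
  have hk : 0 ≤ m + 2 * |m| := by have := neg_abs_le m; have := abs_nonneg m; omega
  rw [weilIndex_mulShift hψ hp hm hk, weilIndex_mulShift hψ hp (e := e * u ^ 2) (m := m)
    (by simp [hu, hm]) hk, gaussInt_mul_sq _ _ _ hu]

theorem weilIndex_mulShift_neg (hp : p ≠ 2) {e : ℚ_[p]} (he : e ≠ 0) :
    weilIndex (ψ.mulShift (-e)) = conj (weilIndex (ψ.mulShift e)) := by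
  obtain ⟨m, hm⟩ := exists_norm_eq_zpow he
  have hk : 0 ≤ m + 2 * |m| := by have := neg_abs_le m; have := abs_nonneg m; omega
  rw [weilIndex_mulShift hψ hp hm hk, weilIndex_mulShift hψ hp (e := -e) (m := m)
    (by simp [hm]) hk, gaussInt_neg]
  simp

/-- The ball of radius `p^k` is already large enough to compute the index, and there the integrand
is `1`. -/
theorem weilIndex_mulShift_even (hp : p ≠ 2) {e : ℚ_[p]} {k : ℤ}
    (he : ‖e‖ = (p : ℝ) ^ (-(2 * k))) : weilIndex (ψ.mulShift e) = 1 := by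
  have hp0 := prime_cast_pos (p := p)
  have hpc : (p : ℂ) ≠ 0 := by exact_mod_cast (Fact.out : p.Prime).ne_zero
  have h : gaussInt ψ k e = ((p : ℝ) ^ k : ℝ) := by
    unfold gaussInt
    rw [setIntegral_congr_fun (g := fun _ => (1 : ℂ)) (measurableSet_qball k), setIntegral_const,
      haarQp_real_qball]
    · simp
    · intro x hx
      have h1 : ψ (e * x ^ 2) = 1 := by
        rw [hψ, norm_mul, norm_pow, he]
        have := mem_qball.mp hx
        calc (p : ℝ) ^ (-(2 * k)) * ‖x‖ ^ 2 ≤ (p : ℝ) ^ (-(2 * k)) * ((p : ℝ) ^ k) ^ 2 := by gcongr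
          _ = 1 := by
            rw [← zpow_natCast, ← zpow_mul, ← zpow_add₀ hp0.ne']
            rw [show -(2 * k) + k * ((2 : ℕ) : ℤ) = 0 by push_cast; ring, zpow_zero]
      simp [h1]
  rw [weilIndex_mulShift hψ hp he (k := k) (by omega), h, Complex.norm_real, Real.norm_eq_abs,
    abs_of_pos (zpow_pos hp0 k), div_self]
  exact_mod_cast (zpow_pos hp0 k).ne'

theorem weilIndex_unit (hp : p ≠ 2) {e : ℚ_[p]} (he : ‖e‖ = 1) :
    weilIndex (ψ.mulShift e) = 1 :=
  weilIndex_mulShift_even hψ hp (k := 0) (by simpa using he)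

end

/-- The units of `ℤ_p`, as a subset of `ℚ_p`. -/
def unitSet (p : ℕ) [Fact p.Prime] : Set ℚ_[p] := {x | ‖x‖ = 1}

theorem mem_unitSet {x : ℚ_[p]} : x ∈ unitSet p ↔ ‖x‖ = 1 := Iff.rfl

theorem unitSet_eq_diff : unitSet p = qball p 0 \ qball p (-1) := by
  ext x
  simp only [mem_unitSet, Set.mem_sdiff, mem_qball, zpow_zero]
  constructor
  · intro h
    refine ⟨h.le, fun h' => ?_⟩
    rw [h, zpow_neg_one] at h'
    exact absurd h' (not_le.mpr (inv_lt_one_of_one_lt₀ one_lt_prime_cast))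
  · rintro ⟨h, h'⟩
    refine le_antisymm h (not_lt.mp fun h1 => h' ?_)
    exact norm_le_zpow_of_lt (by simpa using h1)

theorem measurableSet_unitSet : MeasurableSet (unitSet p) := by
  rw [unitSet_eq_diff]
  exact (measurableSet_qball 0).diff (measurableSet_qball (-1))

theorem unitSet_subset_qball : unitSet p ⊆ qball p 0 := by
  rw [unitSet_eq_diff]; exact Set.sdiff_subset

theorem qball_neg_one_subset : qball p (-1) ⊆ qball p 0 := fun x hx =>
  (mem_qball.mp hx).trans (zpow_le_zpow_right₀ one_lt_prime_cast.le (by omega))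

theorem setIntegral_unitSet {f : ℚ_[p] → ℂ} (hf : IntegrableOn f (qball p 0) (haarQp p)) :
    ∫ x in unitSet p, f x ∂haarQp p =
      ∫ x in qball p 0, f x ∂haarQp p - ∫ x in qball p (-1), f x ∂haarQp p := by
  rw [unitSet_eq_diff, setIntegral_sdiff (measurableSet_qball _) hf qball_neg_one_subset]

theorem haarQp_real_unitSet : (haarQp p).real (unitSet p) = 1 - (p : ℝ)⁻¹ := by
  rw [unitSet_eq_diff, measureReal_sdiff qball_neg_one_subset (measurableSet_qball _)
    (haarQp_qball_lt_top _).ne, haarQp_real_qball, haarQp_real_qball]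
  simp

/-! ### Sign change of Gauss integrals between square classes -/

section

variable {ψ : AddChar ℚ_[p] Circle} (hψ : ∀ x : ℚ_[p], ψ x = 1 ↔ ‖x‖ ≤ 1)
include hψ

/-- Integrate over `u` first. Since `‖e‖` is an odd power of `p`, the inner integral is `1 - 1/p`
for `‖x‖ ≤ p^(k-1)` and `-1/p` on the rest of the ball; the total is `p^(k-1) - p^k/p = 0`. -/
theorem setIntegral_unitSet_gaussInt {e : ℚ_[p]} {k : ℤ} (he : ‖e‖ = (p : ℝ) ^ (1 - 2 * k)) :
    ∫ u in unitSet p, gaussInt ψ k (e * u) ∂haarQp p = 0 := by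
  have hp0 := prime_cast_pos (p := p)
  have hp1 := one_lt_prime_cast (p := p)
  have hpc : (p : ℂ) ≠ 0 := by exact_mod_cast (Fact.out : p.Prime).ne_zero
  have hfin : ∀ k, IsFiniteMeasure ((haarQp p).restrict (qball p k)) := fun k =>
    ⟨by rw [Measure.restrict_apply_univ]; exact haarQp_qball_lt_top k⟩
  have hfinU : IsFiniteMeasure ((haarQp p).restrict (unitSet p)) :=
    ⟨by
      rw [Measure.restrict_apply_univ]
      exact (measure_mono unitSet_subset_qball).trans_lt (haarQp_qball_lt_top 0)⟩
  calc ∫ u in unitSet p, gaussInt ψ k (e * u) ∂haarQp p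
      = ∫ u in unitSet p, ∫ x in qball p k, (ψ (e * x ^ 2 * u) : ℂ) ∂haarQp p ∂haarQp p := by
        simp only [gaussInt, mul_right_comm]
    _ = ∫ x in qball p k, ∫ u in unitSet p, (ψ (e * x ^ 2 * u) : ℂ) ∂haarQp p ∂haarQp p := by
        refine integral_integral_swap ?_
        refine Integrable.of_bound (C := 1) ?_
          (Eventually.of_forall fun q => (Circle.norm_coe _).le)
        exact ((continuous_addChar hψ).comp (by fun_prop : Continuous fun q : ℚ_[p] × ℚ_[p] =>
          e * q.2 ^ 2 * q.1)).aestronglyMeasurable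
    _ = ∫ x in qball p k, ((qball p (k - 1)).indicator (fun _ => (1 : ℂ)) x - (p : ℂ)⁻¹)
          ∂haarQp p := by
        refine setIntegral_congr_fun (measurableSet_qball k) fun x hx => ?_
        rw [setIntegral_unitSet (integrableOn_addChar_comp hψ (by fun_prop) 0),
          setIntegral_qball_addChar hψ, setIntegral_qball_addChar hψ]
        have hx2 : ‖e * x ^ 2‖ ≤ p := by
          rw [norm_mul, norm_pow, he]
          have := mem_qball.mp hx
          calc (p : ℝ) ^ (1 - 2 * k) * ‖x‖ ^ 2 ≤ (p : ℝ) ^ (1 - 2 * k) * ((p : ℝ) ^ k) ^ 2 := by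
                gcongr
            _ = (p : ℝ) := by
              rw [← zpow_natCast, ← zpow_mul, ← zpow_add₀ hp0.ne']
              rw [show 1 - 2 * k + k * ((2 : ℕ) : ℤ) = 1 by push_cast; ring, zpow_one]
        have h2 : ‖e * x ^ 2‖ * (p : ℝ) ^ (-1 : ℤ) ≤ 1 := by
          rw [zpow_neg_one, ← div_eq_mul_inv, div_le_one hp0]; exact hx2
        rw [if_pos h2]
        have hiff : ‖e * x ^ 2‖ * (p : ℝ) ^ (0 : ℤ) ≤ 1 ↔ x ∈ qball p (k - 1) := by
          rw [zpow_zero, mul_one, mem_qball, norm_mul, norm_pow, he]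
          constructor
          · intro h
            apply norm_le_zpow_of_lt
            by_contra! h3
            rw [sub_add_cancel] at h3
            have : (p : ℝ) ^ (1 - 2 * k) * ((p : ℝ) ^ k) ^ 2 ≤ 1 := le_trans (by gcongr) h
            rw [← zpow_natCast, ← zpow_mul, ← zpow_add₀ hp0.ne',
              show 1 - 2 * k + k * ((2 : ℕ) : ℤ) = 1 by push_cast; ring, zpow_one] at this
            linarith
          · intro h
            calc (p : ℝ) ^ (1 - 2 * k) * ‖x‖ ^ 2
                ≤ (p : ℝ) ^ (1 - 2 * k) * ((p : ℝ) ^ (k - 1)) ^ 2 := by gcongr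
              _ = (p : ℝ) ^ (-1 : ℤ) := by
                rw [← zpow_natCast, ← zpow_mul, ← zpow_add₀ hp0.ne']; congr 1; push_cast; ring
              _ ≤ 1 := by rw [zpow_neg_one]; exact inv_le_one_of_one_le₀ hp1.le
        by_cases h : x ∈ qball p (k - 1)
        · rw [if_pos (hiff.mpr h), Set.indicator_of_mem h, zpow_zero, zpow_neg_one]
        · rw [if_neg (fun h' => h (hiff.mp h')), Set.indicator_of_notMem h, zpow_neg_one]
    _ = 0 := by
        rw [integral_sub, setIntegral_indicator (measurableSet_qball _), Set.inter_eq_right.mpr,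
          setIntegral_const, setIntegral_const, haarQp_real_qball, haarQp_real_qball]
        · simp only [Complex.real_smul, mul_one]
          push_cast
          rw [zpow_sub_one₀ hpc, sub_self]
        · intro x hx
          exact (mem_qball.mp hx).trans (zpow_le_zpow_right₀ hp1.le (by omega))
        · exact (integrable_const _).indicator (measurableSet_qball _)
        · exact integrable_const _

/-- As a function of the unit `u`, the integral at `e u` depends on the square class only. The two
classes have equal positive measure, and the average over the units is zero by
`setIntegral_unitSet_gaussInt`. -/
theorem gaussInt_odd_nonsquare (hp : p ≠ 2) {e d : ℚ_[p]} {k : ℤ}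
    (he : ‖e‖ = (p : ℝ) ^ (1 - 2 * k)) (hd : ‖d‖ = 1) (hds : ¬ IsSquare d) :
    gaussInt ψ k (e * d) = -gaussInt ψ k e := by
  set Q : Set ℚ_[p] := {u | ‖u‖ = 1 ∧ IsSquare u} with hQ
  set N : Set ℚ_[p] := {u | ‖u‖ = 1 ∧ ¬ IsSquare u} with hN
  have hd0 : d ≠ 0 := by rintro rfl; simp at hd
  have hQo : IsOpen Q := by
    rw [Metric.isOpen_iff]
    rintro x ⟨hx, y, hy⟩
    refine ⟨1, one_pos, fun z hz => ?_⟩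
    rw [Metric.mem_ball, dist_eq_norm] at hz
    have hy1 : ‖y‖ = 1 := by
      rw [hy, norm_mul, ← sq] at hx
      exact (pow_eq_one_iff_of_nonneg (norm_nonneg _) two_ne_zero).mp hx
    refine ⟨?_, isSquare_of_norm_sub_sq_lt_one hp hy1 (by rw [sq, ← hy]; exact hz)⟩
    have := norm_add_eq_of_lt (x := x) (z := z - x) (by rwa [hx])
    rwa [add_sub_cancel, hx] at this
  have hNQ : N = (fun x => d * x) ⁻¹' Q := by
    ext u
    simp only [hN, hQ, Set.mem_preimage, Set.mem_ofPred_eq, norm_mul, hd, one_mul]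
    refine and_congr_right fun hu => ⟨fun h => isSquare_mul_of_not_isSquare hp hd hu hds h, ?_⟩
    rintro h1 h2
    have hu0 : u ≠ 0 := by rintro rfl; simp at hu
    exact hds (by simpa [hu0] using h1.div h2)
  have hNm : MeasurableSet N := by
    rw [hNQ]; exact hQo.measurableSet.preimage (continuous_const_mul d).measurable
  have hμ : (haarQp p).real N = (haarQp p).real Q := by
    rw [Measure.real, Measure.real, hNQ,
      (measurePreserving_unit_mul hd).measure_preimage hQo.measurableSet.nullMeasurableSet]
  have hQU : Q ⊆ qball p 0 := fun x hx => by rw [mem_qball, zpow_zero]; exact hx.1.le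
  have hQpos : (haarQp p).real Q ≠ 0 := by
    refine (ENNReal.toReal_pos ?_ ((measure_mono hQU).trans_lt (haarQp_qball_lt_top 0)).ne).ne'
    exact (hQo.measure_pos _ ⟨1, by simp [hQ]⟩).ne'
  have hNU : N ⊆ qball p 0 := fun x hx => by rw [mem_qball, zpow_zero]; exact hx.1.le
  have hfQ : Set.EqOn (fun u => gaussInt ψ k (e * u)) (fun _ => gaussInt ψ k e) Q := by
    rintro u ⟨hu, v, rfl⟩
    have hv : ‖v‖ = 1 := by
      rw [norm_mul, ← sq] at hu
      exact (pow_eq_one_iff_of_nonneg (norm_nonneg _) two_ne_zero).mp hu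
    simp only [← sq, gaussInt_mul_sq ψ k e hv]
  have hfN : Set.EqOn (fun u => gaussInt ψ k (e * u)) (fun _ => gaussInt ψ k (e * d)) N := by
    rintro u hu
    have h1 : d * u ∈ Q := by rw [hNQ] at hu; exact hu
    obtain ⟨h2, v, hv⟩ := h1
    have hv1 : ‖v / d‖ = 1 := by
      rw [hv, norm_mul, ← sq] at h2
      rw [norm_div, hd, div_one]
      exact (pow_eq_one_iff_of_nonneg (norm_nonneg _) two_ne_zero).mp h2
    have e1 : e * u = e * d * (v / d) ^ 2 := by
      field_simp; linear_combination e * hv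
    simp only [e1, gaussInt_mul_sq ψ k (e * d) hv1]
  have hU : unitSet p = Q ∪ N := by
    ext u
    simp only [mem_unitSet, hQ, hN, Set.mem_union, Set.mem_ofPred_eq]
    tauto
  have hdisj : Disjoint Q N := Set.disjoint_left.mpr fun u h1 h2 => h2.2 h1.2
  have h0 := setIntegral_unitSet_gaussInt hψ he
  have hiQ : IntegrableOn (fun u => gaussInt ψ k (e * u)) Q (haarQp p) :=
    (integrableOn_const ((measure_mono hQU).trans_lt (haarQp_qball_lt_top 0)).ne).congr_fun
      hfQ.symm hQo.measurableSet
  have hiN : IntegrableOn (fun u => gaussInt ψ k (e * u)) N (haarQp p) :=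
    (integrableOn_const ((measure_mono hNU).trans_lt (haarQp_qball_lt_top 0)).ne).congr_fun
      hfN.symm hNm
  rw [hU, setIntegral_union hdisj hNm hiQ hiN, setIntegral_congr_fun hQo.measurableSet hfQ,
    setIntegral_congr_fun hNm hfN, setIntegral_const, setIntegral_const, hμ, ← smul_add,
    smul_eq_zero] at h0
  rcases h0 with h0 | h0
  · exact absurd h0 hQpos
  · linear_combination h0

theorem weilIndex_odd_nonsquare (hp : p ≠ 2) {e d : ℚ_[p]} {k : ℤ}
    (he : ‖e‖ = (p : ℝ) ^ (1 - 2 * k)) (hd : ‖d‖ = 1) (hds : ¬ IsSquare d) :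
    weilIndex (ψ.mulShift (e * d)) = -weilIndex (ψ.mulShift e) := by
  rw [weilIndex_mulShift hψ hp he (k := k) (by omega), weilIndex_mulShift hψ hp
    (e := e * d) (m := 1 - 2 * k) (k := k) (by rw [norm_mul, hd, mul_one, he]) (by omega),
    gaussInt_odd_nonsquare hψ hp he hd hds, norm_neg, neg_div]

end

/-! ### Formulas for the Weil representation -/

theorem kubotaX_of_eq_zero {g : SL2 p} (h : g 1 0 = 0) : kubotaX g = g 1 1 := by
  simp [kubotaX, h]

theorem kubotaX_of_ne_zero {g : SL2 p} (h : g 1 0 ≠ 0) : kubotaX g = g 1 0 := by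
  simp [kubotaX, h]

/-- Only multiplication by `s` contributes: for the factors `u(b)` and `u(b')` one entry of the
cocycle is a square. -/
theorem bruhat_sign (b b' c : ℚ_[p]) (hc : c ≠ 0) :
    ((⟨uMat b, 1⟩ : Mp2 p) * ⟨tMat (-(Units.mk0 c hc)⁻¹), 1⟩ * ⟨sMat p, 1⟩ *
      ⟨uMat b', 1⟩).sign = hilbertSymbol (-c⁻¹) (-1) := by
  have hu (b : ℚ_[p]) : (uMat b : Matrix (Fin 2) (Fin 2) ℚ_[p]) = !![1, b; 0, 1] := rfl
  have ht (a : ℚ_[p]ˣ) : (tMat a : Matrix (Fin 2) (Fin 2) ℚ_[p]) =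
    !![(a : ℚ_[p]), 0; 0, (a : ℚ_[p])⁻¹] := rfl
  have hs : (sMat p : Matrix (Fin 2) (Fin 2) ℚ_[p]) = !![0, 1; -1, 0] := rfl
  set t := tMat (-(Units.mk0 c hc)⁻¹) with htd
  have k1 : ∀ b : ℚ_[p], kubotaX (uMat b) = 1 := fun b => by
    rw [kubotaX_of_eq_zero (by simp [hu])]; simp [hu]
  have k2 : kubotaX t = -c := by
    rw [kubotaX_of_eq_zero (by simp [htd, ht])]; simp [htd, ht]
  have k3 : kubotaX (uMat b * t) = -c := by
    rw [kubotaX_of_eq_zero (by simp [htd, ht, hu])]; simp [htd, ht, hu]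
  have k4 : kubotaX (sMat p) = -1 := by
    rw [kubotaX_of_ne_zero (by simp [hs])]; simp [hs]
  have k5 : kubotaX (uMat b * t * sMat p) = c := by
    rw [kubotaX_of_ne_zero (by simp [htd, ht, hu, hs, hc])]; simp [htd, ht, hu, hs]
  have k6 : kubotaX (uMat b * t * sMat p * uMat b') = c := by
    rw [kubotaX_of_ne_zero (by simp [htd, ht, hu, hs, hc])]; simp [htd, ht, hu, hs]
  change hilbertSymbol (kubotaX (uMat b * t * sMat p) * kubotaX (uMat b * t * sMat p * uMat b'))
      (kubotaX (uMat b') * kubotaX (uMat b * t * sMat p * uMat b')) *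
    (hilbertSymbol (kubotaX (uMat b * t) * kubotaX (uMat b * t * sMat p))
      (kubotaX (sMat p) * kubotaX (uMat b * t * sMat p)) *
    (hilbertSymbol (kubotaX (uMat b) * kubotaX (uMat b * t))
      (kubotaX t * kubotaX (uMat b * t)) * 1 * 1) * 1) * 1 = _
  rw [k1, k1, k2, k3, k4, k5, k6, hilbertSymbol_of_isSquare_left ⟨c, rfl⟩,
    hilbertSymbol_of_isSquare_right (a := 1 * -c) ⟨-c, rfl⟩, hilbertSymbol_neg_sq_neg hc]
  simp

/-- The integral `∫ ψ((d y² - 2 x y) / c) φ(y) dy`. -/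
def quadFourier (ψ : AddChar ℚ_[p] Circle) (c d : ℚ_[p]) (φ : ℚ_[p] → ℂ) (x : ℚ_[p]) : ℂ :=
  ∫ y, (ψ ((d * y ^ 2 - 2 * x * y) / c) : ℂ) * φ y ∂haarQp p

theorem weilRep_of_eq_zero (ψ : AddChar ℚ_[p] Circle) {g : SL2 p} (hc : g 1 0 = 0) (ε : ℤˣ)
    (φ : ℚ_[p] → ℂ) (x : ℚ_[p]) :
    weilRep ψ ⟨g, ε⟩ φ x = ((ε : ℤ) : ℂ) * chiPsi ψ (g 0 0) * (√‖g 0 0‖ : ℝ) *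
      (ψ (g 0 0 * g 0 1 * x ^ 2) * φ (g 0 0 * x)) := by
  rw [weilRep, dif_pos hc]
  simp only [weilU, weilT]
  ring

theorem hilbertSymbol_sq_complex {K : Type*} [Field K] (a b : K) :
    ((hilbertSymbol a b : ℤ) : ℂ) * ((hilbertSymbol a b : ℤ) : ℂ) = 1 := by
  rcases Int.units_eq_one_or (hilbertSymbol a b) with h | h <;> simp [h]

section

variable {ψ : AddChar ℚ_[p] Circle} (hψ : ∀ x : ℚ_[p], ψ x = 1 ↔ ‖x‖ ≤ 1)
include hψ

theorem weilIndex_eq_one (hp : p ≠ 2) : weilIndex ψ = 1 := by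
  have := weilIndex_unit hψ hp (e := 1) (by simp)
  rwa [AddChar.mulShift_one] at this

theorem chiPsi_unit (hp : p ≠ 2) {a : ℚ_[p]} (ha : ‖a‖ = 1) : chiPsi ψ a = 1 := by
  simp [chiPsi, weilIndex_eq_one hψ hp, weilIndex_unit hψ hp ha, hilbertSymbol_unit_neg_one hp ha]

theorem weilRep_of_ne_zero (hp : p ≠ 2) {g : SL2 p} (hc : g 1 0 ≠ 0) (ε : ℤˣ)
    (φ : ℚ_[p] → ℂ) (x : ℚ_[p]) :
    weilRep ψ ⟨g, ε⟩ φ x = ((ε : ℤ) : ℂ) * weilIndex (ψ.mulShift (-(g 1 0)⁻¹)) *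
      (√‖g 1 0‖⁻¹ : ℝ) * (ψ (g 0 0 / g 1 0 * x ^ 2) * quadFourier ψ (g 1 0) (g 1 1) φ x) := by
  rw [weilRep, dif_neg hc]
  simp only [bruhat_sign, weilU, weilT, weilS, chiPsi, weilIndex_eq_one hψ hp, quadFourier]
  have e1 : ∀ y : ℚ_[p], (ψ (g 1 1 / g 1 0 * y ^ 2) : ℂ) * φ y *
      ψ (2 * (-(g 1 0)⁻¹ * x) * y) = ψ ((g 1 1 * y ^ 2 - 2 * x * y) / g 1 0) * φ y := by
    intro y
    rw [mul_right_comm, ← Circle.coe_mul, ← AddChar.map_add_eq_mul]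
    congr 3
    field_simp
    ring
  simp only [e1, norm_neg, norm_inv]
  push_cast
  -- The sign of the Bruhat factorization and the Hilbert symbol in `chiPsi` are the same symbol, so
  -- their product is `1`.
  linear_combination (((ε : ℤ) : ℂ) * weilIndex (ψ.mulShift (-(g 1 0)⁻¹)) *
      (√‖g 1 0‖⁻¹ : ℝ) * (ψ (g 0 0 / g 1 0 * x ^ 2) * 
      ∫ y, (ψ ((g 1 1 * y ^ 2 - 2 * x * y) / g 1 0) : ℂ) * φ y ∂haarQp p)) *
      hilbertSymbol_sq_complex (-(g 1 0)⁻¹) (-1)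

end

/-! ### Newvectors of the odd Weil representation -/

/-- A character of `ℚ_pˣ` is tame if it is trivial on `1 + p ℤ_p`. -/
def IsTame (χ : MulCharQp p) : Prop :=
  ∀ u : ℚ_[p]ˣ, ‖(u : ℚ_[p]) - 1‖ ≤ (p : ℝ)⁻¹ → χ u = 1

theorem inv_prime_lt_one : (p : ℝ)⁻¹ < 1 := inv_lt_one_of_one_lt₀ one_lt_prime_cast

/-- By Fermat `u^(p-1)` lies in `1 + pℤ_p`, so `χ(u)` is a root of unity. No unitarity of `χ` is
needed. -/
theorem IsTame.norm_eq_one {χ : MulCharQp p} (hχ : IsTame χ) {u : ℚ_[p]ˣ}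
    (hu : ‖(u : ℚ_[p])‖ = 1) : ‖(χ u : ℂ)‖ = 1 := by
  have hp1 : p - 1 ≠ 0 := by have := (Fact.out : p.Prime).one_lt; omega
  have h : χ (u ^ (p - 1)) = 1 := by
    apply hχ
    apply norm_le_inv_of_lt_one
    let X : ℤ_[p] := ⟨u, hu.le⟩
    have hX : PadicInt.toZMod X ≠ 0 := by
      rw [Ne, ← norm_lt_one_iff_toZMod]; exact not_lt.mpr hu.ge
    have := (norm_lt_one_iff_toZMod (X ^ (p - 1) - 1)).mpr (by
      rw [map_sub, map_pow, map_one, ZMod.pow_card_sub_one_eq_one hX, sub_self])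
    push_cast at this
    simpa using this
  rw [map_pow] at h
  have h2 : (χ u : ℂ) ^ (p - 1) = 1 := by
    simpa using congrArg Units.val h
  have h3 := congrArg norm h2
  rw [norm_pow, norm_one] at h3
  exact (pow_eq_one_iff_of_nonneg (norm_nonneg _) hp1).mp h3

theorem charExt_of_ne_zero (χ : MulCharQp p) {x : ℚ_[p]} (hx : x ≠ 0) :
    charExt χ x = χ (Units.mk0 x hx) := dif_pos hx

/-- Functions supported on `ℤ_pˣ` on which `ℤ_pˣ` acts through `χ⁻¹`. -/
structure IsUnitVector (χ : MulCharQp p) (h : ℚ_[p] → ℂ) : Prop where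
  eq_zero : ∀ x, ‖x‖ ≠ 1 → h x = 0
  equivariant : ∀ u : ℚ_[p]ˣ, ‖(u : ℚ_[p])‖ = 1 → ∀ x, h (u * x) = (χ u : ℂ)⁻¹ * h x

theorem isUnitVector_oddWeilVector (χ : MulCharQp p) : IsUnitVector χ (oddWeilVector χ) := by
  refine ⟨fun x hx => Set.indicator_of_notMem (show x ∉ {x | ‖x‖ = 1} from hx) _, fun u hu x => ?_⟩
  unfold oddWeilVector
  by_cases hx : ‖x‖ = 1
  · have hx0 : x ≠ 0 := by rintro rfl; simp at hx
    rw [Set.indicator_of_mem (show x ∈ {x | ‖x‖ = 1} from hx),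
      Set.indicator_of_mem (show (u : ℚ_[p]) * x ∈ {x | ‖x‖ = 1} by simp [hu, hx]),
      charExt_of_ne_zero χ hx0, charExt_of_ne_zero χ (mul_ne_zero u.ne_zero hx0), ← mul_inv]
    congr 1
    rw [← Units.val_mul, ← map_mul]
    congr 2
    ext; rfl
  · rw [Set.indicator_of_notMem (show x ∉ {x | ‖x‖ = 1} from hx), Set.indicator_of_notMem, mul_zero]
    simpa [hu] using hx

namespace IsUnitVector

variable {χ : MulCharQp p} {h : ℚ_[p] → ℂ}

theorem map_add (hh : IsUnitVector χ h) (hχ : IsTame χ) {y z : ℚ_[p]}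
    (hz : ‖z‖ ≤ (p : ℝ) ^ (-1 : ℤ)) : h (y + z) = h y := by
  rw [zpow_neg_one] at hz
  by_cases hy : ‖y‖ = 1
  · have hy0 : y ≠ 0 := by rintro rfl; simp at hy
    have h1 : ‖y + z‖ = 1 := by
      rw [norm_add_eq_of_lt, hy]; rw [hy]; exact hz.trans_lt inv_prime_lt_one
    have h0 : y + z ≠ 0 := by intro h0; rw [h0] at h1; simp at h1
    have := hh.equivariant (Units.mk0 ((y + z) / y) (div_ne_zero h0 hy0)) (by simp [h1, hy]) y
    rw [Units.val_mk0, div_mul_cancel₀ _ hy0, hχ, Units.val_one, inv_one, one_mul] at this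
    · exact this
    · rw [Units.val_mk0, add_div, div_self hy0, add_sub_cancel_left, norm_div, hy, div_one]
      exact hz
  · rw [hh.eq_zero y hy, hh.eq_zero]
    intro h1
    apply hy
    have := norm_add_eq_of_lt (x := y + z) (z := -z)
      (by rw [h1, norm_neg]; exact hz.trans_lt inv_prime_lt_one)
    rwa [add_neg_cancel_right, h1] at this

theorem isLocallyConstant (hh : IsUnitVector χ h) (hχ : IsTame χ) : IsLocallyConstant h :=
  isLocallyConstant_of_shift (zpow_pos prime_cast_pos (-1)) fun _ _ hz => hh.map_add hχ hz

theorem hasCompactSupport (hh : IsUnitVector χ h) : HasCompactSupport h :=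
  HasCompactSupport.intro (isCompact_qball 0) fun x hx => hh.eq_zero x fun h1 =>
    hx (by rw [mem_qball, h1, zpow_zero])

theorem integrable (hh : IsUnitVector χ h) (hχ : IsTame χ) : Integrable h (haarQp p) :=
  (hh.isLocallyConstant hχ).continuous.integrable_of_hasCompactSupport hh.hasCompactSupport

theorem map_div (hh : IsUnitVector χ h) {d : ℚ_[p]} (hd : ‖d‖ = 1) (x : ℚ_[p]) :
    h (x / d) = charExt χ d * h x := by
  have hd0 : d ≠ 0 := by rintro rfl; simp at hd
  have := hh.equivariant (Units.mk0 d hd0)⁻¹ (by simp [hd]) x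
  rw [charExt_of_ne_zero χ hd0]
  simp only [map_inv, Units.val_inv_eq_inv_val, inv_inv, Units.val_mk0] at this
  rw [← this, div_eq_inv_mul]

end IsUnitVector

section

variable {ψ : AddChar ℚ_[p] Circle} (hψ : ∀ x : ℚ_[p], ψ x = 1 ↔ ‖x‖ ≤ 1)
include hψ

theorem integrable_quad_mul {h : ℚ_[p] → ℂ} (hh : Integrable h (haarQp p)) (c d x : ℚ_[p]) :
    Integrable (fun y => (ψ ((d * y ^ 2 - 2 * x * y) / c) : ℂ) * h y) (haarQp p) := by
  simp only [mul_comm _ (h _)]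
  exact integrable_mul_addChar hψ hh (by fun_prop)

theorem quad_mul_shift {h : ℚ_[p] → ℂ} {c d x y z : ℚ_[p]} (hc : c ≠ 0) (hz : h (y + z) = h y)
    (hdz : ‖d * z ^ 2 / c‖ ≤ 1) :
    (ψ ((d * (y + z) ^ 2 - 2 * x * (y + z)) / c) : ℂ) * h (y + z) =
      (ψ ((d * y ^ 2 - 2 * x * y) / c) : ℂ) * h y * ψ (2 * (d * y - x) / c * z) := by
  rw [hz, show (d * (y + z) ^ 2 - 2 * x * (y + z)) / c =
    ((d * y ^ 2 - 2 * x * y) / c + 2 * (d * y - x) / c * z) + d * z ^ 2 / c by field_simp; ring,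
    addChar_add_of_norm_le hψ hdz, AddChar.map_add_eq_mul, Circle.coe_mul]
  ring

/-- Stationary phase: when `p² ∣ c`, only the ball of radius `p⁻¹` around the critical point `x/d`
contributes. There `h` is constant by tameness, and completing the square leaves a Gauss integral.
-/
theorem quadFourier_unitVector (hp : p ≠ 2) {χ : MulCharQp p} (hχ : IsTame χ) {h : ℚ_[p] → ℂ}
    (hh : IsUnitVector χ h) {c d : ℚ_[p]} (hc0 : c ≠ 0) (hc : ‖c‖ ≤ ((p : ℝ) ^ 2)⁻¹)
    (hd : ‖d‖ = 1) (x : ℚ_[p]) :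
    quadFourier ψ c d h x = ψ (-(x ^ 2 / (d * c))) * h (x / d) * gaussInt ψ (-1) (d / c) := by
  have hp0 := prime_cast_pos (p := p)
  have hp1 := one_lt_prime_cast (p := p)
  have hd0 : d ≠ 0 := by rintro rfl; simp at hd
  obtain ⟨n, hn⟩ := exists_norm_eq_zpow hc0
  have hn2 : n ≤ -2 := by
    rw [hn, ← zpow_natCast, ← zpow_neg] at hc
    exact (zpow_le_zpow_iff_right₀ hp1).mp hc
  unfold quadFourier
  -- With `‖c‖ = p^n`, shifts of norm at most `p^(n+1)` preserve `h` as `n + 1 ≤ -1`, and make `d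
  -- z²/c` integral as `2(n+1) ≤ n`. Both use `n ≤ -2`.
  rw [integral_eq_setIntegral_of_shift hψ (integrable_quad_mul hψ (hh.integrable hχ) c d x)
    (l := fun y => 2 * (d * y - x) / c) (by fun_prop) (n + 1)]
  · have hs : {y : ℚ_[p] | ‖2 * (d * y - x) / c‖ * (p : ℝ) ^ (n + 1) ≤ 1} =
        (fun y => y + -(x / d)) ⁻¹' qball p (-1) := by
      ext y
      rw [Set.mem_ofPred_eq, Set.mem_preimage, mem_qball, norm_div, norm_mul, norm_two_eq_one hp,
        one_mul, hn, show d * y - x = d * (y + -(x / d)) by field_simp; ring, norm_mul, hd,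
        one_mul, div_mul_eq_mul_div, mul_div_assoc, ← zpow_sub₀ hp0.ne', add_sub_cancel_left,
        zpow_one, zpow_neg_one, ← le_div_iff₀ hp0, one_div]
    rw [hs, ← integral_indicator ((measurableSet_qball (-1)).preimage (by fun_prop)),
      ← integral_add_right_eq_self _ (x / d), gaussInt, ← integral_const_mul,
      ← integral_indicator (measurableSet_qball (-1))]
    congr 1 with v
    by_cases hv : v ∈ qball p (-1)
    · rw [Set.indicator_of_mem hv, Set.indicator_of_mem (by simpa using hv), add_comm v (x / d),
        hh.map_add hχ (mem_qball.mp hv)]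
      rw [show (d * (x / d + v) ^ 2 - 2 * x * (x / d + v)) / c =
        -(x ^ 2 / (d * c)) + d / c * v ^ 2 by field_simp; ring, AddChar.map_add_eq_mul,
        Circle.coe_mul]
      ring
    · rw [Set.indicator_of_notMem hv, Set.indicator_of_notMem (by simpa using hv)]
  · intro y z hz
    refine quad_mul_shift hψ hc0 (hh.map_add hχ (hz.trans (zpow_le_zpow_right₀ hp1.le (by omega)))) ?_
    rw [norm_div, norm_mul, norm_pow, hd, one_mul, hn, div_le_one (zpow_pos hp0 _)]
    calc ‖z‖ ^ 2 ≤ ((p : ℝ) ^ (n + 1)) ^ 2 := by gcongr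
      _ = (p : ℝ) ^ (2 * n + 2) := by rw [← zpow_natCast, ← zpow_mul]; congr 1; push_cast; ring
      _ ≤ (p : ℝ) ^ n := zpow_le_zpow_right₀ hp1.le (by omega)

/-- The sign of the splitting compensates the Weil indices. If `d` is a square, the indices are
conjugate; if `d` is not a square and `c` has odd valuation, both the symbol and the second index
change sign; if the valuation is even, everything is `1`. -/
theorem splitting_sign_mul_weilIndex (hp : p ≠ 2) {k : SL2 p} (hc : k 1 0 ≠ 0) (hd : ‖k 1 1‖ = 1) :
    (((splitting k).sign : ℤ) : ℂ) * weilIndex (ψ.mulShift (-(k 1 0)⁻¹)) *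
      weilIndex (ψ.mulShift (k 1 1 / k 1 0)) = 1 := by
  set c := k 1 0 with hcd
  set d := k 1 1 with hdd
  have hci : c⁻¹ ≠ 0 := inv_ne_zero hc
  have hd0 : d ≠ 0 := by intro h; rw [h] at hd; simp at hd
  have hcn : ‖c⁻¹‖ = (p : ℝ) ^ c.valuation := by
    rw [norm_inv, Padic.norm_eq_zpow_neg_valuation hc, zpow_neg, inv_inv]
  have hsign : (splitting k).sign = if Odd c.valuation then hilbertSymbol c d else 1 := by
    simp only [splitting, ← hcd, ← hdd]
    simp [hc, hd0]
  have hγ : conj (weilIndex (ψ.mulShift c⁻¹)) * weilIndex (ψ.mulShift c⁻¹) = 1 := by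
    rw [mul_comm, Complex.mul_conj, Complex.normSq_eq_norm_sq, norm_weilIndex_mulShift hψ hp hci]
    simp
  rw [hsign, weilIndex_mulShift_neg hψ hp hci, div_eq_inv_mul]
  by_cases hs : IsSquare d
  · obtain ⟨t, ht⟩ := hs
    have ht1 : ‖t‖ = 1 := by
      rw [ht, norm_mul, ← sq] at hd
      exact (pow_eq_one_iff_of_nonneg (norm_nonneg _) two_ne_zero).mp hd
    rw [hilbertSymbol_of_isSquare_right ⟨t, ht⟩, ht, ← sq, weilIndex_mulShift_mul_sq hψ hp hci ht1]
    simpa using hγ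
  · by_cases ho : Odd c.valuation
    · rw [if_pos ho, hilbertSymbol_odd_nonsquare hp ho hd hs]
      obtain ⟨j, hj⟩ := ho
      rw [weilIndex_odd_nonsquare hψ hp (k := -j) (by rw [hcn, hj]; congr 1; ring) hd hs]
      simpa using hγ
    · rw [if_neg ho]
      obtain ⟨j, hj⟩ := Int.not_odd_iff_even.mp ho
      rw [weilIndex_mulShift_even hψ hp (k := -j) (by rw [hcn, hj]; congr 1; ring),
        weilIndex_mulShift_even hψ hp (k := -j) (by rw [norm_mul, hd, hcn, hj, mul_one]; congr 1; ring)]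
      simp

omit hψ in
theorem SL2_det (k : SL2 p) : k 0 0 * k 1 1 - k 0 1 * k 1 0 = 1 := by
  have := k.det_coe
  rwa [Matrix.det_fin_two] at this

omit hψ in
theorem norm_diag_of_mem_Gamma00 {k : SL2 p} (hk : k ∈ Gamma00 p) :
    ‖k 0 0‖ = 1 ∧ ‖k 1 1‖ = 1 := by
  obtain ⟨hk1, hk2⟩ := hk
  have ha : ‖k 0 0‖ ≤ 1 := hk1 0 0
  have hb : ‖k 0 1‖ ≤ 1 := hk1 0 1
  have hd : ‖k 1 1‖ ≤ 1 := hk1 1 1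
  have hlt : ‖k 0 1 * k 1 0‖ < 1 := by
    rw [norm_mul]
    have : ((p : ℝ) ^ 2)⁻¹ < 1 := inv_lt_one_of_one_lt₀ (one_lt_pow₀ one_lt_prime_cast two_ne_zero)
    calc _ ≤ 1 * ‖k 1 0‖ := by gcongr
      _ < 1 := by rw [one_mul]; exact hk2.trans_lt this
  have hn : ‖k 0 0‖ * ‖k 1 1‖ = 1 := by
    rw [← norm_mul, show k 0 0 * k 1 1 = 1 + k 0 1 * k 1 0 by linear_combination SL2_det k,
      norm_add_eq_of_lt (by simpa using hlt), norm_one]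
  have h1 := norm_nonneg (k 0 0)
  have h2 := norm_nonneg (k 1 1)
  constructor <;> nlinarith

/-- For `c ≠ 0`, stationary phase returns `h(x/d) = χ(d) h(x)` times `ψ((b/d) x²)`, which is `1` on
the support. The Weil indices cancel against the splitting, and the absolute values cancel each
other. -/
theorem isOddWeilNewvector_oddWeilVector (hp : p ≠ 2) {χ : MulCharQp p} (hχ : IsTame χ)
    (hodd : χ (-1) = -1) : IsOddWeilNewvector ψ χ (oddWeilVector χ) := by
  have hh := isUnitVector_oddWeilVector χ
  refine ⟨hh.isLocallyConstant hχ, hh.hasCompactSupport, fun x => ?_, fun h0 => ?_, ?_⟩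
  · have := hh.equivariant (-1) (by simp) x
    rw [hodd] at this
    simpa [inv_neg] using this
  · have := congrFun h0 1
    rw [oddWeilVector, Set.indicator_of_mem (by simp), charExt_of_ne_zero χ one_ne_zero] at this
    simp at this
  · intro k hk x
    obtain ⟨ha, hd⟩ := norm_diag_of_mem_Gamma00 hk
    have hb : ‖k 0 1‖ ≤ 1 := hk.1 0 1
    have hd0 : k 1 1 ≠ 0 := by intro h; rw [h] at hd; simp at hd
    have key : ∀ t : ℚ_[p], ‖t‖ ≤ 1 → (ψ (t * x ^ 2) : ℂ) * oddWeilVector χ x = oddWeilVector χ x := by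
      intro t ht
      by_cases hx : ‖x‖ = 1
      · have : ψ (t * x ^ 2) = 1 := by rw [hψ]; simpa [hx] using ht
        simp [this]
      · rw [hh.eq_zero x hx, mul_zero]
    have hdet := SL2_det k
    by_cases hc : k 1 0 = 0
    · have hs : (splitting k).sign = 1 := by simp [splitting, hc]
      have := weilRep_of_eq_zero ψ hc (splitting k).sign (oddWeilVector χ) x
      rw [show splitting k = ⟨k, (splitting k).sign⟩ from rfl, this, hs, chiPsi_unit hψ hp ha, ha]
      rw [hc] at hdet
      have e : k 0 0 * x = x / k 1 1 := by field_simp; linear_combination x * hdet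
      rw [e, hh.map_div hd, mul_left_comm (ψ _ : ℂ), key _ (by rw [norm_mul, ha, one_mul]; exact hb)]
      simp
    · have := weilRep_of_ne_zero hψ hp hc (splitting k).sign (oddWeilVector χ) x
      rw [show splitting k = ⟨k, (splitting k).sign⟩ from rfl, this,
        quadFourier_unitVector hψ hp hχ hh hc hk.2 hd, hh.map_div hd]
      have hcpos : 0 < ‖k 1 0‖ := norm_pos_iff.mpr hc
      obtain ⟨m, hm⟩ := exists_norm_eq_zpow (div_ne_zero hd0 hc)
      have hm2 : 0 ≤ m + 2 * (-1) := by
        have h1 : (p : ℝ) ^ (2 : ℤ) ≤ (p : ℝ) ^ m := by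
          rw [← hm, norm_div, hd, one_div]
          exact_mod_cast (le_inv_comm₀ hcpos (pow_pos prime_cast_pos 2)).mp hk.2
        have := (zpow_le_zpow_iff_right₀ one_lt_prime_cast).mp h1
        omega
      rw [gaussInt_eq hψ hp hm hm2]
      have hsq : ((√‖k 1 0‖⁻¹ : ℝ) : ℂ) * ((√‖k 1 1 / k 1 0‖⁻¹ : ℝ) : ℂ) = 1 := by
        rw [norm_div, hd, one_div, inv_inv, ← Complex.ofReal_mul, ← Real.sqrt_mul (by positivity),
          inv_mul_cancel₀ hcpos.ne']
        simp
      have hψ2 : (ψ (k 0 0 / k 1 0 * x ^ 2) : ℂ) * ψ (-(x ^ 2 / (k 1 1 * k 1 0))) =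
          ψ (k 0 1 / k 1 1 * x ^ 2) := by
        rw [← Circle.coe_mul, ← AddChar.map_add_eq_mul]
        congr 2
        field_simp
        linear_combination x ^ 2 * hdet
      have hk1 := key (k 0 1 / k 1 1) (by rw [norm_div, hd, div_one]; exact hb)
      have hsg := splitting_sign_mul_weilIndex hψ hp hc hd
      calc _ = ((((splitting k).sign : ℤ) : ℂ) * weilIndex (ψ.mulShift (-(k 1 0)⁻¹)) *
            weilIndex (ψ.mulShift (k 1 1 / k 1 0))) *
            (((√‖k 1 0‖⁻¹ : ℝ) : ℂ) * ((√‖k 1 1 / k 1 0‖⁻¹ : ℝ) : ℂ)) *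
            (charExt χ (k 1 1) * (((ψ (k 0 0 / k 1 0 * x ^ 2) : ℂ) *
              ψ (-(x ^ 2 / (k 1 1 * k 1 0)))) * oddWeilVector χ x)) := by ring
        _ = _ := by rw [hsg, hsq, hψ2, hk1]; ring

end

/-- The lower unipotent matrix with lower left entry `c`. -/
def lMat (c : ℚ_[p]) : SL2 p := ⟨!![1, 0; c, 1], by simp⟩

/-! ### Uniqueness of the odd newvector -/

theorem prime_sq_ne_zero : ((p : ℚ_[p]) ^ 2) ≠ 0 := pow_ne_zero 2 prime_cast_ne_zero

theorem norm_prime_sq : ‖(p : ℚ_[p]) ^ 2‖ = ((p : ℝ) ^ 2)⁻¹ := by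
  rw [norm_pow, Padic.norm_p, inv_pow]

theorem uMat_mem_Gamma00 {b : ℚ_[p]} (hb : ‖b‖ ≤ 1) : uMat b ∈ Gamma00 p := by
  refine ⟨fun i j => ?_, ?_⟩
  · fin_cases i <;> fin_cases j <;> simp [uMat, hb]
  · simp [uMat]

theorem tMat_mem_Gamma00 {a : ℚ_[p]ˣ} (ha : ‖(a : ℚ_[p])‖ = 1) : tMat a ∈ Gamma00 p := by
  refine ⟨fun i j => ?_, ?_⟩
  · fin_cases i <;> fin_cases j <;> simp [tMat, ha]
  · simp [tMat]

theorem lMat_mem_Gamma00 : lMat ((p : ℚ_[p]) ^ 2) ∈ Gamma00 p := by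
  refine ⟨fun i j => ?_, ?_⟩
  · fin_cases i <;> fin_cases j <;> simp [lMat]
    exact inv_le_one_of_one_le₀ (one_le_pow₀ one_lt_prime_cast.le)
  · simp [lMat]

theorem integral_odd_eq_zero {f : ℚ_[p] → ℂ} (hf : ∀ x, f (-x) = -f x) :
    ∫ x, f x ∂haarQp p = 0 := by
  have h := integral_neg_eq_self f (haarQp p)
  simp only [hf, integral_neg] at h
  linear_combination (-1 / 2 : ℂ) * h

theorem IsOddWeilNewvector.integrable {ψ : AddChar ℚ_[p] Circle} {χ : MulCharQp p}
    {h : ℚ_[p] → ℂ} (hh : IsOddWeilNewvector ψ χ h) : Integrable h (haarQp p) :=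
  hh.locallyConstant.continuous.integrable_of_hasCompactSupport hh.compactSupport

section

variable {ψ : AddChar ℚ_[p] Circle} (hψ : ∀ x : ℚ_[p], ψ x = 1 ↔ ‖x‖ ≤ 1)
include hψ

/-- Invariance under `u(1)` gives `ψ(x²) h(x) = h(x)`, and `ψ(x²) ≠ 1` outside `ℤ_p`. -/
theorem IsOddWeilNewvector.eq_zero_of_one_lt (hp : p ≠ 2) {χ : MulCharQp p} {h : ℚ_[p] → ℂ}
    (hh : IsOddWeilNewvector ψ χ h) {x : ℚ_[p]} (hx : 1 < ‖x‖) : h x = 0 := by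
  have h1 := hh.equivariant (uMat 1) (uMat_mem_Gamma00 (by simp)) x
  rw [show splitting (uMat (1 : ℚ_[p])) = ⟨uMat 1, 1⟩ by simp [splitting, uMat],
    weilRep_of_eq_zero ψ (by simp [uMat])] at h1
  have e00 : (uMat (1 : ℚ_[p])) 0 0 = 1 := rfl
  have e01 : (uMat (1 : ℚ_[p])) 0 1 = 1 := rfl
  have e11 : (uMat (1 : ℚ_[p])) 1 1 = 1 := rfl
  rw [e00, e01, e11, chiPsi_unit hψ hp (by simp), charExt_of_ne_zero χ one_ne_zero,
    Units.mk0_one, map_one] at h1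
  simp only [Units.val_one, Int.cast_one, norm_one, Real.sqrt_one, Complex.ofReal_one, one_mul] at h1
  have h2 : (ψ (x ^ 2) : ℂ) ≠ 1 := by
    rw [Ne, Circle.coe_eq_one, hψ, norm_pow, not_le]
    exact one_lt_pow₀ hx two_ne_zero
  by_contra h3
  exact h2 (mul_right_cancel₀ h3 (by rw [h1, one_mul]))

theorem IsOddWeilNewvector.map_unit_mul (hp : p ≠ 2) {χ : MulCharQp p} {h : ℚ_[p] → ℂ}
    (hh : IsOddWeilNewvector ψ χ h) (u : ℚ_[p]ˣ) (hu : ‖(u : ℚ_[p])‖ = 1) (x : ℚ_[p]) :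
    h (u * x) = (χ u : ℂ)⁻¹ * h x := by
  have h1 := hh.equivariant (tMat u) (tMat_mem_Gamma00 hu) x
  rw [show splitting (tMat u) = ⟨tMat u, 1⟩ by simp [splitting, tMat],
    weilRep_of_eq_zero ψ (by simp [tMat])] at h1
  have e00 : (tMat u) 0 0 = u := rfl
  have e01 : (tMat u) 0 1 = 0 := rfl
  have e11 : (tMat u) 1 1 = (u : ℚ_[p])⁻¹ := rfl
  rw [e00, e01, e11, chiPsi_unit hψ hp hu, charExt_of_ne_zero χ (inv_ne_zero u.ne_zero), hu] at h1
  have e : Units.mk0 (u : ℚ_[p])⁻¹ (inv_ne_zero u.ne_zero) = u⁻¹ := by ext; simp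
  rw [e, map_inv] at h1
  simpa using h1

/-- Invariance under the lower unipotent with entry `p²`. As `p²` has even valuation, the splitting
sign and the Weil index are trivial; the factor `p` is `‖p²‖^(-1/2)`. -/
theorem IsOddWeilNewvector.eq_quadFourier (hp : p ≠ 2) {χ : MulCharQp p} {h : ℚ_[p] → ℂ}
    (hh : IsOddWeilNewvector ψ χ h) (x : ℚ_[p]) :
    h x = p * (ψ (1 / (p : ℚ_[p]) ^ 2 * x ^ 2) * quadFourier ψ ((p : ℚ_[p]) ^ 2) 1 h x) := by
  have h1 := hh.equivariant (lMat ((p : ℚ_[p]) ^ 2)) lMat_mem_Gamma00 x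
  have e00 : (lMat ((p : ℚ_[p]) ^ 2)) 0 0 = 1 := rfl
  have e10 : (lMat ((p : ℚ_[p]) ^ 2)) 1 0 = (p : ℚ_[p]) ^ 2 := rfl
  have e11 : (lMat ((p : ℚ_[p]) ^ 2)) 1 1 = 1 := rfl
  have hs : splitting (lMat ((p : ℚ_[p]) ^ 2)) = ⟨lMat ((p : ℚ_[p]) ^ 2), 1⟩ := by
    unfold splitting
    congr 1
    rw [e10, e11, Padic.valuation_pow, if_neg]
    rintro ⟨-, h2⟩
    exact (Int.not_odd_iff_even.mpr (Int.even_mul.mpr (Or.inl (by decide)))) h2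
  rw [hs, weilRep_of_ne_zero hψ hp (by rw [e10]; exact prime_sq_ne_zero), e00, e10, e11,
    weilIndex_mulShift_even hψ hp (k := -1) (by
      rw [norm_neg, norm_inv, norm_prime_sq, inv_inv,
        show (-(2 * (-1)) : ℤ) = ((2 : ℕ) : ℤ) by norm_num, zpow_natCast]), charExt_of_ne_zero χ one_ne_zero,
    Units.mk0_one, map_one, norm_prime_sq, inv_inv, Real.sqrt_sq (Nat.cast_nonneg p)] at h1
  simp only [Units.val_one, Int.cast_one, one_mul, Complex.ofReal_natCast] at h1
  exact h1.symm

/-- Subtract the multiple of the explicit newvector with the same value at `1`. The difference lives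
on `pℤ_p`, where oddness and the relation for the lower unipotent force it to vanish. -/
theorem IsOddWeilNewvector.isUnitVector (hp : p ≠ 2) {χ : MulCharQp p} (hχ : IsTame χ)
    (hodd : χ (-1) = -1) {h : ℚ_[p] → ℂ} (hh : IsOddWeilNewvector ψ χ h) : IsUnitVector χ h := by
  have hp0 := prime_cast_pos (p := p)
  have hp1 := one_lt_prime_cast (p := p)
  have hpc : (p : ℂ) ≠ 0 := by exact_mod_cast (Fact.out : p.Prime).ne_zero
  have hh0 := isOddWeilNewvector_oddWeilVector hψ hp hχ hodd
  have hu0 := isUnitVector_oddWeilVector χ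
  set f : ℚ_[p] → ℂ := fun x => h x - h 1 * oddWeilVector χ x with hf
  have hfi : Integrable f (haarQp p) := hh.integrable.sub (hh0.integrable.const_mul _)
  have hfodd : ∀ x, f (-x) = -f x := fun x => by simp only [hf, hh.odd, hh0.odd]; ring
  have hfeq : ∀ u : ℚ_[p]ˣ, ‖(u : ℚ_[p])‖ = 1 → ∀ x, f (u * x) = (χ u : ℂ)⁻¹ * f x := by
    intro u hu x
    simp only [hf, hh.map_unit_mul hψ hp u hu, hu0.equivariant u hu]; ring
  have hfq : ∀ x, f x = p * (ψ (1 / (p : ℚ_[p]) ^ 2 * x ^ 2) *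
      quadFourier ψ ((p : ℚ_[p]) ^ 2) 1 f x) := by
    intro x
    have e : quadFourier ψ ((p : ℚ_[p]) ^ 2) 1 f x = quadFourier ψ ((p : ℚ_[p]) ^ 2) 1 h x -
        h 1 * quadFourier ψ ((p : ℚ_[p]) ^ 2) 1 (oddWeilVector χ) x := by
      unfold quadFourier
      rw [← integral_const_mul, ← integral_sub (integrable_quad_mul hψ hh.integrable _ _ _)
        ((integrable_quad_mul hψ hh0.integrable _ _ _).const_mul _)]
      congr 1 with y
      simp only [hf]; ring
    rw [e]
    simp only [hf]
    rw [hh.eq_quadFourier hψ hp x, hh0.eq_quadFourier hψ hp x]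
    ring
  have hf1 : ∀ x, ‖x‖ = 1 → f x = 0 := by
    intro x hx
    have hx0 : x ≠ 0 := by rintro rfl; simp at hx
    have h1 := hfeq (Units.mk0 x hx0) (by simpa using hx) 1
    have h2 : f 1 = 0 := by
      simp only [hf]
      rw [oddWeilVector, Set.indicator_of_mem (by simp), charExt_of_ne_zero χ one_ne_zero]
      simp
    rw [h2, mul_zero] at h1
    simpa using h1
  have hfbig : ∀ x, 1 < ‖x‖ → f x = 0 := fun x hx => by
    simp only [hf, hh.eq_zero_of_one_lt hψ hp hx, hh0.eq_zero_of_one_lt hψ hp hx]; ring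
  have hfge : ∀ x, ¬ ‖x‖ ≤ (p : ℝ)⁻¹ → f x = 0 := by
    intro x hx
    rcases lt_trichotomy ‖x‖ 1 with h1 | h1 | h1
    · exact absurd (norm_le_inv_of_lt_one h1) hx
    · exact hf1 x h1
    · exact hfbig x h1
  have hf0 : f 0 = 0 := by
    have := hfodd 0
    rw [neg_zero] at this
    linear_combination (1 / 2 : ℂ) * this
  -- As `f` is supported on `pℤ_p`, the term `2(x - x')y/p²` is integral whenever `x - x'` lies in
  -- `pℤ_p`.
  have hcongr : ∀ x x' : ℚ_[p], ∀ a : ℚ_[p], ‖x - x'‖ ≤ (p : ℝ)⁻¹ →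
      quadFourier ψ ((p : ℚ_[p]) ^ 2) a f x = quadFourier ψ ((p : ℚ_[p]) ^ 2) a f x' := by
    intro x x' a hxx
    unfold quadFourier
    congr 1 with y
    by_cases hy : ‖y‖ ≤ (p : ℝ)⁻¹
    · congr 2
      rw [show (a * y ^ 2 - 2 * x * y) / (p : ℚ_[p]) ^ 2 =
        (a * y ^ 2 - 2 * x' * y) / (p : ℚ_[p]) ^ 2 + (-2 * (x - x') * y) / (p : ℚ_[p]) ^ 2 by ring]
      apply addChar_add_of_norm_le hψ
      rw [norm_div, norm_mul, norm_mul, norm_neg, norm_two_eq_one hp, one_mul, norm_prime_sq,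
        div_inv_eq_mul]
      calc ‖x - x'‖ * ‖y‖ * (p : ℝ) ^ 2 ≤ (p : ℝ)⁻¹ * (p : ℝ)⁻¹ * (p : ℝ) ^ 2 := by gcongr
        _ = 1 := by field_simp
    · rw [hfge y hy, mul_zero, mul_zero]
  -- On `pℤ_p` the Fourier transform equals its value at `0`, the integral of an odd function. On
  -- units it vanishes because `f` does: the quadratic term `y²/p²` is integral on the support.
  have hfq0 : ∀ x, ‖x‖ ≤ 1 → quadFourier ψ ((p : ℚ_[p]) ^ 2) 0 f x = 0 := by
    intro x hx
    rcases hx.lt_or_eq with h1 | h1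
    · rw [hcongr x 0 0 (by simpa using norm_le_inv_of_lt_one h1)]
      simp only [quadFourier, mul_zero, zero_mul, sub_zero, zero_div, AddChar.map_zero_eq_one,
        Circle.coe_one, one_mul]
      exact integral_odd_eq_zero hfodd
    · have h2 := hfq x
      rw [hf1 x h1, eq_comm, mul_eq_zero, mul_eq_zero] at h2
      have h3 : quadFourier ψ ((p : ℚ_[p]) ^ 2) 1 f x = 0 :=
        (h2.resolve_left hpc).resolve_left (Circle.coe_ne_zero _)
      rw [← h3]
      unfold quadFourier
      congr 1 with y
      by_cases hy : ‖y‖ ≤ (p : ℝ)⁻¹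
      · congr 2
        rw [show (1 * y ^ 2 - 2 * x * y) / (p : ℚ_[p]) ^ 2 =
          (0 * y ^ 2 - 2 * x * y) / (p : ℚ_[p]) ^ 2 + y ^ 2 / (p : ℚ_[p]) ^ 2 by ring]
        refine (addChar_add_of_norm_le hψ ?_).symm
        rw [norm_div, norm_pow, norm_prime_sq, div_inv_eq_mul]
        calc ‖y‖ ^ 2 * (p : ℝ) ^ 2 ≤ (p : ℝ)⁻¹ ^ 2 * (p : ℝ) ^ 2 := by gcongr
          _ = 1 := by field_simp
      · rw [hfge y hy, mul_zero, mul_zero]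
  have hfp : ∀ y₀, ‖y₀‖ = (p : ℝ)⁻¹ → f y₀ = 0 := by
    intro y₀ hy₀
    have hy00 : y₀ ≠ 0 := by rintro rfl; rw [norm_zero, eq_comm, inv_eq_zero] at hy₀; exact hp0.ne' hy₀
    have hfin : IsFiniteMeasure ((haarQp p).restrict (qball p 0)) :=
      ⟨by rw [Measure.restrict_apply_univ]; exact haarQp_qball_lt_top 0⟩
    -- Fourier inversion over `ℤ_p` recovers the integral of `f` over the ball of radius `p⁻²`
    -- around `y₀`. There `y/y₀` lies in `1 + pℤ_p`, so `f` is constant by tame equivariance.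
    have h1 : ∫ x in qball p 0, (∫ y, f y * (ψ (2 * (y₀ - y) / (p : ℚ_[p]) ^ 2 * x) : ℂ)
        ∂haarQp p) ∂haarQp p = 0 := by
      rw [setIntegral_congr_fun (g := fun _ => (0 : ℂ)) (measurableSet_qball 0)]
      · simp
      · intro x hx
        have h2 := hfq0 x (by simpa using mem_qball.mp hx)
        have h3 : ∫ y, f y * (ψ (2 * (y₀ - y) / (p : ℚ_[p]) ^ 2 * x) : ℂ) ∂haarQp p =
            ψ (2 * y₀ / (p : ℚ_[p]) ^ 2 * x) * quadFourier ψ ((p : ℚ_[p]) ^ 2) 0 f x := by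
          unfold quadFourier
          rw [← integral_const_mul]
          congr 1 with y
          rw [show 2 * (y₀ - y) / (p : ℚ_[p]) ^ 2 * x = 2 * y₀ / (p : ℚ_[p]) ^ 2 * x +
            (0 * y ^ 2 - 2 * x * y) / (p : ℚ_[p]) ^ 2 by ring, AddChar.map_add_eq_mul,
            Circle.coe_mul]
          ring
        simp only [h3, h2, mul_zero]
    rw [integral_integral_swap] at h1
    · simp only [integral_const_mul, setIntegral_qball_addChar hψ, zpow_zero, mul_one] at h1
      have h2 : ∀ y, f y * (if ‖2 * (y₀ - y) / (p : ℚ_[p]) ^ 2‖ ≤ 1 then (1 : ℂ) else 0) =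
          (qball p (-2)).indicator (fun _ => f y₀) (y + -y₀) := by
        intro y
        have hiff : ‖2 * (y₀ - y) / (p : ℚ_[p]) ^ 2‖ ≤ 1 ↔ y + -y₀ ∈ qball p (-2) := by
          rw [mem_qball, norm_div, norm_mul, norm_two_eq_one hp, one_mul, norm_prime_sq,
            div_inv_eq_mul, ← sub_eq_add_neg, norm_sub_rev, ← le_div_iff₀ (by positivity), one_div]
          rfl
        by_cases hy : y + -y₀ ∈ qball p (-2)
        · rw [if_pos (hiff.mpr hy), Set.indicator_of_mem hy, mul_one]
          have hlt : ‖(y + -y₀) / y₀‖ ≤ (p : ℝ)⁻¹ := by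
            rw [norm_div, hy₀, div_inv_eq_mul]
            calc _ ≤ (p : ℝ) ^ (-2 : ℤ) * p := by gcongr; exact mem_qball.mp hy
              _ = (p : ℝ)⁻¹ := by
                rw [← zpow_add_one₀ hp0.ne']; norm_num
          have hyn : ‖y / y₀‖ = 1 := by
            rw [show y / y₀ = 1 + (y + -y₀) / y₀ by field_simp; ring, norm_add_eq_of_lt, norm_one]
            rw [norm_one]; exact hlt.trans_lt inv_prime_lt_one
          have hy0 : y / y₀ ≠ 0 := by intro h; rw [h] at hyn; simp at hyn
          have h3 := hfeq (Units.mk0 _ hy0) (by simpa using hyn) y₀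
          rw [Units.val_mk0, div_mul_cancel₀ _ hy00, hχ, Units.val_one, inv_one, one_mul] at h3
          · exact h3
          · rw [Units.val_mk0, show y / y₀ - 1 = (y + -y₀) / y₀ by field_simp; ring]
            exact hlt
        · rw [if_neg (fun h => hy (hiff.mp h)), Set.indicator_of_notMem hy, mul_zero]
      simp only [h2] at h1
      rw [integral_add_right_eq_self (fun y => (qball p (-2)).indicator (fun _ => f y₀) y),
        integral_indicator (measurableSet_qball _), setIntegral_const, haarQp_real_qball,
        smul_eq_zero] at h1
      exact h1.resolve_left (zpow_pos hp0 _).ne'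
    · refine (hfi.comp_snd ((haarQp p).restrict (qball p 0))).mul_bdd (c := 1) ?_
        (Eventually.of_forall fun _ => (Circle.norm_coe _).le)
      exact ((continuous_addChar hψ).comp (by fun_prop : Continuous fun q : ℚ_[p] × ℚ_[p] =>
        2 * (y₀ - q.2) / (p : ℚ_[p]) ^ 2 * q.1)).aestronglyMeasurable
  have hfall : ∀ x, f x = 0 := by
    intro x
    by_cases hx : ‖x‖ ≤ (p : ℝ)⁻¹
    · rcases hx.lt_or_eq with h1 | h1
      -- The lower unipotent relation makes `f` constant here, equal to `f 0 = 0`. The argument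
      -- needs no more than `‖x‖ ≤ p⁻¹`; the sphere of radius `p⁻¹` is nevertheless referred to
      -- `hfp`.
      · rw [← hf0, hfq x, hfq 0, hcongr x 0 1 (by simpa using hx)]
        have : ψ (1 / (p : ℚ_[p]) ^ 2 * x ^ 2) = 1 := by
          rw [hψ, norm_mul, norm_div, norm_one, norm_prime_sq, norm_pow, one_div, inv_inv]
          calc (p : ℝ) ^ 2 * ‖x‖ ^ 2 ≤ (p : ℝ) ^ 2 * (p : ℝ)⁻¹ ^ 2 := by gcongr
            _ = 1 := by field_simp
        rw [this]
        simp
      · exact hfp x h1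
    · exact hfge x hx
  refine ⟨fun x hx => ?_, hh.map_unit_mul hψ hp⟩
  have := hfall x
  simp only [hf, hu0.eq_zero x hx, mul_zero, sub_zero] at this
  exact this

end

/-! ### The newvector of the principal series -/

theorem charExt_mul (χ : MulCharQp p) (x y : ℚ_[p]) :
    charExt χ (x * y) = charExt χ x * charExt χ y := by
  by_cases hx : x = 0
  · simp [hx, charExt]
  by_cases hy : y = 0
  · simp [hy, charExt]
  rw [charExt_of_ne_zero χ hx, charExt_of_ne_zero χ hy, charExt_of_ne_zero χ (mul_ne_zero hx hy),
    ← Units.val_mul, ← map_mul]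
  congr 2
  ext; rfl

theorem charExt_unit (χ : MulCharQp p) (u : ℚ_[p]ˣ) : charExt χ u = χ u := by
  rw [charExt_of_ne_zero χ u.ne_zero]; simp

theorem IsUnramified.charExt_eq_one {χ : MulCharQp p} (hχ : IsUnramified χ) {x : ℚ_[p]}
    (hx : ‖x‖ = 1) : charExt χ x = 1 := by
  have hx0 : x ≠ 0 := by rintro rfl; simp at hx
  rw [charExt_of_ne_zero χ hx0, hχ _ (by simpa using hx)]; simp

theorem IsTame.charExt_eq_one {χ : MulCharQp p} (hχ : IsTame χ) {x : ℚ_[p]}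
    (hx : ‖x - 1‖ ≤ (p : ℝ)⁻¹) : charExt χ x = 1 := by
  have hx0 : x ≠ 0 := by
    rintro rfl
    rw [zero_sub, norm_neg, norm_one] at hx
    exact absurd hx (not_le.mpr inv_prime_lt_one)
  rw [charExt_of_ne_zero χ hx0, hχ _ (by simpa using hx)]; simp

theorem charExt_ne_zero (χ : MulCharQp p) {x : ℚ_[p]} (hx : x ≠ 0) : charExt χ x ≠ 0 := by
  rw [charExt_of_ne_zero χ hx]; exact Units.ne_zero _

/-- The determinant of an element of `GL₂(ℚ_p)`, in `ℚ_p`. -/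
def gdet (y : GL2 p) : ℚ_[p] := (y : Matrix (Fin 2) (Fin 2) ℚ_[p]).det

theorem gdet_mul (x y : GL2 p) : gdet (x * y) = gdet x * gdet y := by
  simp [gdet]

theorem gdet_ne_zero (y : GL2 p) : gdet y ≠ 0 := by
  have := (Matrix.isUnit_iff_isUnit_det _).mp (Units.isUnit y)
  exact this.ne_zero

theorem gdet_eq (y : GL2 p) : gdet y = y 0 0 * y 1 1 - y 0 1 * y 1 0 := Matrix.det_fin_two _

theorem GL2_mul_apply (x y : GL2 p) (i j : Fin 2) :
    (x * y) i j = x i 0 * y 0 j + x i 1 * y 1 j := by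
  rw [Units.val_mul, Matrix.mul_apply, Fin.sum_univ_two]

theorem mem_GL2Zp_of {x : GL2 p} (h : ∀ i j, ‖x i j‖ ≤ 1) (hd : ‖gdet x‖ = 1) : x ∈ GL2Zp p := by
  refine ⟨h, fun i j => ?_⟩
  have hd' : ‖(x : Matrix (Fin 2) (Fin 2) ℚ_[p]).det‖ = 1 := hd
  rw [Matrix.coe_units_inv, Matrix.inv_def, Matrix.adjugate_fin_two, Ring.inverse_eq_inv',
    Matrix.smul_apply, smul_eq_mul, norm_mul, norm_inv, hd', inv_one, one_mul]
  fin_cases i <;> fin_cases j <;> simp [h]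

theorem norm_gdet_of_mem {x : GL2 p} (h : x ∈ GL2Zp p) : ‖gdet x‖ = 1 := by
  have key : ∀ y : GL2 p, (∀ i j, ‖y i j‖ ≤ 1) → ‖gdet y‖ ≤ 1 := by
    intro y hy
    rw [gdet_eq]
    refine norm_sub_le_of_le ?_ ?_ <;> rw [norm_mul] <;>
      exact mul_le_one₀ (hy _ _) (norm_nonneg _) (hy _ _)
  have h1 := key x h.1
  have h2 := key x⁻¹ h.2
  have h3 : ‖gdet x‖ * ‖gdet x⁻¹‖ = 1 := by
    rw [← norm_mul, ← gdet_mul, mul_inv_cancel]; simp [gdet]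
  have := norm_nonneg (gdet x)
  have := norm_nonneg (gdet x⁻¹)
  nlinarith

theorem borelMat_apply (a d : ℚ_[p]ˣ) (b : ℚ_[p]) :
    (borelMat a d b : Matrix (Fin 2) (Fin 2) ℚ_[p]) = !![(a : ℚ_[p]), b; 0, (d : ℚ_[p])] := rfl

theorem toGL_apply (x : SL2 p) (i j : Fin 2) :
    (Matrix.SpecialLinearGroup.toGL x : GL2 p) i j = x i j := rfl

/-- The newvector of `π(ξ₁, ξ₂)` with value `1` at the identity matrix. -/
def newvec (ξ₁ ξ₂ : MulCharQp p) (y : GL2 p) : ℂ :=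
  if ‖y 1 0‖ < ‖y 1 1‖ then
    charExt ξ₁ (gdet y / y 1 1) * charExt ξ₂ (y 1 1) * (√‖gdet y / y 1 1 / y 1 1‖ : ℝ)
  else 0

theorem newvec_borel_mul (ξ₁ ξ₂ : MulCharQp p) (a d : ℚ_[p]ˣ) (b : ℚ_[p]) (x : GL2 p) :
    newvec ξ₁ ξ₂ (borelMat a d b * x) =
      (ξ₁ a : ℂ) * (ξ₂ d : ℂ) * (√‖(a : ℚ_[p]) / (d : ℚ_[p])‖ : ℂ) * newvec ξ₁ ξ₂ x := by
  have hd := d.ne_zero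
  have e0 : (borelMat a d b * x) 1 0 = d * x 1 0 := by
    rw [GL2_mul_apply, borelMat_apply]; simp
  have e1 : (borelMat a d b * x) 1 1 = d * x 1 1 := by
    rw [GL2_mul_apply, borelMat_apply]; simp
  have e2 : gdet (borelMat a d b * x) = a * d * gdet x := by
    rw [gdet_mul]; congr 1; rw [gdet, borelMat_apply]; simp [Matrix.det_fin_two]
  unfold newvec
  rw [e0, e1, e2, norm_mul, norm_mul]
  have hiff : ‖(d : ℚ_[p])‖ * ‖x 1 0‖ < ‖(d : ℚ_[p])‖ * ‖x 1 1‖ ↔ ‖x 1 0‖ < ‖x 1 1‖ :=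
    mul_lt_mul_iff_right₀ (norm_pos_iff.mpr hd)
  by_cases h : ‖x 1 0‖ < ‖x 1 1‖
  · have hx : x 1 1 ≠ 0 := norm_pos_iff.mp ((norm_nonneg _).trans_lt h)
    rw [if_pos h, if_pos (hiff.mpr h),
      show (a : ℚ_[p]) * d * gdet x / (d * x 1 1) = a * (gdet x / x 1 1) by field_simp,
      show (a : ℚ_[p]) * (gdet x / x 1 1) / (d * x 1 1) = (a / d) * (gdet x / x 1 1 / x 1 1) by
        field_simp,
      charExt_mul, charExt_mul, charExt_unit, charExt_unit, norm_mul,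
      Real.sqrt_mul (norm_nonneg _)]
    push_cast
    ring
  · rw [if_neg h, if_neg (fun h' => h (hiff.mp h')), mul_zero]

/-- Right multiplication by `K₀¹` preserves the cell `‖y 1 0‖ < ‖y 1 1‖`. On it `y 1 1` changes by a
factor in `1 + pℤ_p`, invisible to the tame `ξ₂`, and the argument of `ξ₁` changes by a unit. -/
theorem newvec_mul_K01 {ξ₁ ξ₂ : MulCharQp p} (hξ₁ : IsUnramified ξ₁) (hξ₂ : IsTame ξ₂)
    (y : GL2 p) {k : GL2 p} (hk : k ∈ K01 p) : newvec ξ₁ ξ₂ (y * k) = newvec ξ₁ ξ₂ y := by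
  obtain ⟨hk1, hk2, hk3⟩ := hk
  have hq := inv_prime_lt_one (p := p)
  have hdet := norm_gdet_of_mem hk1
  have h11 : ‖k 1 1‖ = 1 := by
    have := norm_add_eq_of_lt (x := (1 : ℚ_[p])) (z := k 1 1 - 1)
      (by rw [norm_one]; exact hk3.trans_lt hq)
    rwa [add_sub_cancel, norm_one] at this
  have h01 : ‖k 0 1‖ ≤ 1 := hk1.1 0 1
  have h00 : ‖k 0 0‖ = 1 := by
    have h2 : ‖k 0 1 * k 1 0‖ < ‖gdet k‖ := by
      rw [hdet, norm_mul]
      calc _ ≤ 1 * (p : ℝ)⁻¹ := by gcongr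
        _ < 1 := by rwa [one_mul]
    have h3 := norm_add_eq_of_lt h2
    rw [gdet_eq, sub_add_cancel, norm_mul, h11, mul_one, ← gdet_eq, hdet] at h3
    exact h3
  have e0 : (y * k) 1 0 = y 1 0 * k 0 0 + y 1 1 * k 1 0 := GL2_mul_apply _ _ _ _
  have e1 : (y * k) 1 1 = y 1 1 * k 1 1 + y 1 0 * k 0 1 := by
    rw [GL2_mul_apply, add_comm]
  unfold newvec
  by_cases h : ‖y 1 0‖ < ‖y 1 1‖
  · have hy : y 1 1 ≠ 0 := norm_pos_iff.mp ((norm_nonneg _).trans_lt h)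
    have hypos : 0 < ‖y 1 1‖ := norm_pos_iff.mpr hy
    have n1 : ‖(y * k) 1 1‖ = ‖y 1 1‖ := by
      rw [e1, norm_add_eq_of_lt, norm_mul, h11, mul_one]
      rw [norm_mul, norm_mul, h11, mul_one]
      calc _ ≤ ‖y 1 0‖ * 1 := by gcongr
        _ < _ := by rwa [mul_one]
    have n0 : ‖(y * k) 1 0‖ < ‖y 1 1‖ := by
      rw [e0]
      refine (IsUltrametricDist.norm_add_le_max _ _).trans_lt (max_lt ?_ ?_)
      · rwa [norm_mul, h00, mul_one]
      · rw [norm_mul]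
        calc _ ≤ ‖y 1 1‖ * (p : ℝ)⁻¹ := by gcongr
          _ < ‖y 1 1‖ * 1 := by gcongr
          _ = _ := mul_one _
    have hy' : (y * k) 1 1 ≠ 0 := by rw [← norm_pos_iff, n1]; exact hypos
    have hr : charExt ξ₂ ((y * k) 1 1) = charExt ξ₂ (y 1 1) := by
      have : (y * k) 1 1 = y 1 1 * ((y * k) 1 1 / y 1 1) := by field_simp
      rw [this, charExt_mul, hξ₂.charExt_eq_one (x := (y * k) 1 1 / y 1 1), mul_one]
      rw [e1, show (y 1 1 * k 1 1 + y 1 0 * k 0 1) / y 1 1 - 1 =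
        (k 1 1 - 1) + y 1 0 / y 1 1 * k 0 1 by field_simp; ring]
      refine norm_add_le_of_le hk3 ?_
      rw [norm_mul]
      have : ‖y 1 0 / y 1 1‖ ≤ (p : ℝ)⁻¹ := by
        apply norm_le_inv_of_lt_one
        rw [norm_div]; exact (div_lt_one hypos).mpr h
      calc _ ≤ (p : ℝ)⁻¹ * 1 := by gcongr
        _ = _ := mul_one _
    have hr1 : charExt ξ₁ (gdet (y * k) / (y * k) 1 1) = charExt ξ₁ (gdet y / y 1 1) := by
      have : gdet (y * k) / (y * k) 1 1 =
          gdet y / y 1 1 * (gdet k * (y 1 1 / (y * k) 1 1)) := by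
        rw [gdet_mul]; field_simp
      rw [this, charExt_mul, hξ₁.charExt_eq_one (x := gdet k * _), mul_one]
      rw [norm_mul, norm_div, hdet, n1, div_self hypos.ne', one_mul]
    rw [if_pos h, if_pos (by rwa [n1]), hr, hr1]
    simp only [norm_div, n1, gdet_mul, norm_mul, hdet, mul_one]
  · rw [if_neg h, if_neg]
    push Not at h ⊢
    have hypos : 0 < ‖y 1 0‖ := by
      refine norm_pos_iff.mpr fun h0 => gdet_ne_zero y ?_
      have h1 : y 1 1 = 0 := by rw [h0, norm_zero] at h; exact norm_le_zero_iff.mp h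
      rw [gdet_eq, h0, h1]; ring
    rw [e0, e1, norm_add_eq_of_lt (x := y 1 0 * k 0 0), norm_mul (y 1 0), h00, mul_one]
    · refine norm_add_le_of_le ?_ ?_
      · rw [norm_mul, h11, mul_one]; exact h
      · rw [norm_mul]; exact mul_le_of_le_one_right (norm_nonneg _) h01
    · rw [norm_mul, norm_mul, h00, mul_one]
      calc _ ≤ ‖y 1 0‖ * (p : ℝ)⁻¹ := by gcongr
        _ < ‖y 1 0‖ * 1 := by gcongr
        _ = _ := mul_one _

theorem isOpen_GL2Zp : IsOpen (GL2Zp p) :=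
  (isOpen_integralMatrices.preimage Units.continuous_val).inter
    (isOpen_integralMatrices.preimage (Units.continuous_val.comp continuous_inv))

theorem continuous_GL2_apply (i j : Fin 2) : Continuous fun x : GL2 p => x i j :=
  Units.continuous_val.matrix_elem i j

theorem isOpen_K01 : IsOpen (K01 p) := by
  have hb : IsOpen {x : ℚ_[p] | ‖x‖ ≤ (p : ℝ)⁻¹} := by
    have := isOpen_qball (p := p) (-1)
    simpa [qball] using this
  refine isOpen_GL2Zp.inter ((hb.preimage (continuous_GL2_apply 1 0)).inter ?_)
  exact hb.preimage ((continuous_GL2_apply 1 1).sub continuous_const)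

theorem one_mem_K01 : (1 : GL2 p) ∈ K01 p := by
  refine ⟨⟨by simpa using one_mem_integralMatrices, by simpa using one_mem_integralMatrices⟩, ?_, ?_⟩
  · simp
  · simp

theorem isLocallyConstant_of_K01 {g : GL2 p → ℂ} (hg : ∀ k ∈ K01 p, ∀ y, g (y * k) = g y) :
    IsLocallyConstant g := by
  rw [IsLocallyConstant.iff_eventually_eq]
  intro y
  have h : Tendsto (fun z => y⁻¹ * z) (𝓝 y) (𝓝 1) := by
    have := (continuous_const_mul y⁻¹).tendsto y
    rwa [inv_mul_cancel] at this
  filter_upwards [h (isOpen_K01.mem_nhds one_mem_K01)] with z hz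
  have := hg _ hz y
  rwa [mul_inv_cancel_left] at this

theorem newvec_one (ξ₁ ξ₂ : MulCharQp p) : newvec ξ₁ ξ₂ 1 = 1 := by
  have e : charExt ξ₁ 1 = 1 := by simpa using charExt_unit ξ₁ 1
  have e' : charExt ξ₂ 1 = 1 := by simpa using charExt_unit ξ₂ 1
  simp [newvec, gdet, e, e']

theorem isPrincipalSeriesNewvector_newvec {ξ₁ ξ₂ : MulCharQp p} (hξ₁ : IsUnramified ξ₁)
    (hξ₂ : IsTame ξ₂) : IsPrincipalSeriesNewvector ξ₁ ξ₂ (newvec ξ₁ ξ₂) := by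
  refine ⟨⟨isLocallyConstant_of_K01 fun k hk y => newvec_mul_K01 hξ₁ hξ₂ y hk,
    newvec_borel_mul ξ₁ ξ₂⟩, fun h => ?_, fun k hk => ?_⟩
  · have := congrFun h 1
    rw [newvec_one] at this
    exact one_ne_zero this
  · funext y
    exact newvec_mul_K01 hξ₁ hξ₂ y hk

/-- The matrix with rows `(0, 1)` and `(1, 0)`. -/
def wMat (p : ℕ) [Fact p.Prime] : GL2 p :=
  Matrix.GeneralLinearGroup.mkOfDetNeZero !![0, 1; 1, 0] (by simp)

theorem wMat_apply : (wMat p : Matrix (Fin 2) (Fin 2) ℚ_[p]) = !![0, 1; 1, 0] := rfl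

theorem GL2_ext {x y : GL2 p} (h00 : x 0 0 = y 0 0) (h01 : x 0 1 = y 0 1) (h10 : x 1 0 = y 1 0)
    (h11 : x 1 1 = y 1 1) : x = y := by
  apply Units.ext
  ext i j
  fin_cases i <;> fin_cases j <;> assumption

theorem mem_K01_of {x : GL2 p} (h : ∀ i j, ‖x i j‖ ≤ 1) (hd : ‖gdet x‖ = 1)
    (h10 : ‖x 1 0‖ ≤ (p : ℝ)⁻¹) (h11 : x 1 1 = 1) : x ∈ K01 p :=
  ⟨mem_GL2Zp_of h hd, h10, by simp [h11]⟩

/-- Two double cosets of the Borel subgroup and `K₀¹` cover the group, with representatives `1` and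
`w`. A newvector is determined by its values there, and ramification of `ξ₂` kills the value at `w`.
-/
theorem IsPrincipalSeriesNewvector.eq_newvec {ξ₁ ξ₂ : MulCharQp p} (hξ₂ : ¬ IsUnramified ξ₂)
    {g : GL2 p → ℂ} (hg : IsPrincipalSeriesNewvector ξ₁ ξ₂ g) (y : GL2 p) :
    g y = g 1 * newvec ξ₁ ξ₂ y := by
  have hinv : ∀ k ∈ K01 p, ∀ y, g (y * k) = g y := fun k hk y => congrFun (hg.invariant k hk) y
  by_cases h : ‖y 1 0‖ < ‖y 1 1‖
  · have hy : y 1 1 ≠ 0 := norm_pos_iff.mp ((norm_nonneg _).trans_lt h)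
    have hypos : 0 < ‖y 1 1‖ := norm_pos_iff.mpr hy
    set l : GL2 p := Matrix.SpecialLinearGroup.toGL (lMat (y 1 0 / y 1 1)) with hl
    have hle : ‖y 1 0 / y 1 1‖ ≤ (p : ℝ)⁻¹ := by
      apply norm_le_inv_of_lt_one
      rw [norm_div]; exact (div_lt_one hypos).mpr h
    have l00 : l 0 0 = 1 := rfl
    have l01 : l 0 1 = 0 := rfl
    have l10 : l 1 0 = y 1 0 / y 1 1 := rfl
    have l11 : l 1 1 = 1 := rfl
    have hlK : l ∈ K01 p := by
      refine mem_K01_of (fun i j => ?_) ?_ ?_ l11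
      · fin_cases i <;> fin_cases j
        · simp [l00]
        · simp [l01]
        · exact hle.trans inv_prime_lt_one.le
        · simp [l11]
      · rw [gdet_eq, l00, l01, l10, l11]; simp
      · rw [l10]; exact hle
    have hdec : y = borelMat (Units.mk0 _ (div_ne_zero (gdet_ne_zero y) hy)) (Units.mk0 _ hy)
        (y 0 1) * l := by
      refine GL2_ext ?_ ?_ ?_ ?_ <;> rw [GL2_mul_apply, borelMat_apply]
      · simp [l00, l10, gdet_eq]; field_simp; ring
      · simp [l01, l11]
      · simp [l00, l10]; field_simp
      · simp [l01, l11]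
    have h1 := hg.mem.rule (Units.mk0 _ (div_ne_zero (gdet_ne_zero y) hy)) (Units.mk0 _ hy) (y 0 1) l
    have h2 : g l = g 1 := by simpa using hinv l hlK 1
    rw [← hdec, h2] at h1
    rw [h1, newvec, if_pos h, charExt_of_ne_zero ξ₁ (div_ne_zero (gdet_ne_zero y) hy),
      charExt_of_ne_zero ξ₂ hy]
    simp only [Units.val_mk0]
    ring
  · rw [newvec, if_neg h, mul_zero]
    push Not at h
    have hy0 : y 1 0 ≠ 0 := by
      intro h0
      refine gdet_ne_zero y ?_
      have h1 : y 1 1 = 0 := by rw [h0, norm_zero] at h; exact norm_le_zero_iff.mp h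
      rw [gdet_eq, h0, h1]; ring
    have hypos : 0 < ‖y 1 0‖ := norm_pos_iff.mpr hy0
    -- The matrix `diag(u, 1)` lies in `K₀¹`, and `w diag(u, 1) = diag(1, u) w`, so `g(w) = ξ₂(u)
    -- g(w)`; choose `u` with `ξ₂(u) ≠ 1`.
    have hw : g (wMat p) = 0 := by
      obtain ⟨u, hu, hu1⟩ : ∃ u : ℚ_[p]ˣ, ‖(u : ℚ_[p])‖ = 1 ∧ ξ₂ u ≠ 1 := by
        unfold IsUnramified at hξ₂
        push Not at hξ₂
        exact hξ₂
      have hk : borelMat u 1 0 ∈ K01 p := by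
        refine mem_K01_of (fun i j => ?_) ?_ ?_ ?_
        · fin_cases i <;> fin_cases j <;> simp [borelMat_apply, hu]
        · rw [gdet_eq]; simp [borelMat_apply, hu]
        · simp [borelMat_apply]
        · simp [borelMat_apply]
      have h1 := hinv _ hk (wMat p)
      have h2 : wMat p * borelMat u 1 0 = borelMat 1 u 0 * wMat p := by
        refine GL2_ext ?_ ?_ ?_ ?_ <;> rw [GL2_mul_apply, GL2_mul_apply, borelMat_apply, wMat_apply] <;>
          simp [borelMat_apply]
      rw [h2, hg.mem.rule] at h1
      simp only [map_one, Units.val_one, one_div, norm_inv, hu, inv_one, Real.sqrt_one,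
        Complex.ofReal_one, one_mul, mul_one] at h1
      by_contra h3
      apply hu1
      ext
      exact mul_right_cancel₀ h3 (by rw [h1]; simp)
    set u : GL2 p := Matrix.SpecialLinearGroup.toGL (uMat (y 1 1 / y 1 0)) with hu
    have u00 : u 0 0 = 1 := rfl
    have u01 : u 0 1 = y 1 1 / y 1 0 := rfl
    have u10 : u 1 0 = 0 := rfl
    have u11 : u 1 1 = 1 := rfl
    have hle : ‖y 1 1 / y 1 0‖ ≤ 1 := by rw [norm_div]; exact (div_le_one hypos).mpr h
    have huK : u ∈ K01 p := by
      refine mem_K01_of (fun i j => ?_) ?_ ?_ u11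
      · fin_cases i <;> fin_cases j
        · simp [u00]
        · exact hle
        · simp [u10]
        · simp [u11]
      · rw [gdet_eq, u00, u01, u10, u11]; simp
      · simp [u10]
    have hne : -(gdet y / y 1 0) ≠ 0 := neg_ne_zero.mpr (div_ne_zero (gdet_ne_zero y) hy0)
    have hdec : y = borelMat (Units.mk0 _ hne) (Units.mk0 _ hy0) (y 0 0) * wMat p * u := by
      refine GL2_ext ?_ ?_ ?_ ?_ <;> rw [GL2_mul_apply, GL2_mul_apply, GL2_mul_apply,
        borelMat_apply, wMat_apply]
      · simp [u00, u10]
      · simp [u01, u11, gdet_eq]; field_simp; ring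
      · simp [u00, u10]
      · simp [u01, u11]; field_simp
    rw [hdec, hinv u huK, hg.mem.rule, hw, mul_zero]

theorem IsPrincipalSeriesNewvector.one_ne_zero {ξ₁ ξ₂ : MulCharQp p} (hξ₂ : ¬ IsUnramified ξ₂)
    {g : GL2 p → ℂ} (hg : IsPrincipalSeriesNewvector ξ₁ ξ₂ g) : g 1 ≠ 0 := by
  intro h
  apply hg.ne_zero
  funext y
  rw [hg.eq_newvec hξ₂ y, h, zero_mul]; rfl

/-! ### Matrix coefficients of the level raised newvector -/

/-- The matrix `diag(p⁻¹, 1)`. -/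
def deltaMat (p : ℕ) [Fact p.Prime] : GL2 p := borelMat (pUnit p)⁻¹ 1 0

theorem mul_deltaMat_apply (y : GL2 p) : (y * deltaMat p) 1 0 = y 1 0 * (p : ℚ_[p])⁻¹ ∧
    (y * deltaMat p) 1 1 = y 1 1 ∧ gdet (y * deltaMat p) = gdet y * (p : ℚ_[p])⁻¹ := by
  refine ⟨?_, ?_, ?_⟩
  · rw [GL2_mul_apply, deltaMat, borelMat_apply]; simp [pUnit]
  · rw [GL2_mul_apply, deltaMat, borelMat_apply]; simp
  · rw [gdet_mul]; congr 1; rw [gdet_eq, deltaMat, borelMat_apply]; simp [pUnit]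

/-- Level raising multiplies the lower left entry by `p⁻¹`, which sharpens the support condition
from `p ∣ c` to `p² ∣ c`. -/
theorem norm_of_newvec_ne_zero {ξ₁ ξ₂ : MulCharQp p} {k : GL2 p} (hk : k ∈ GL2Zp p)
    (h : newvec ξ₁ ξ₂ (k * deltaMat p) ≠ 0) : ‖k 1 0‖ ≤ ((p : ℝ) ^ 2)⁻¹ ∧ ‖k 1 1‖ = 1 := by
  have hp0 := prime_cast_pos (p := p)
  obtain ⟨e0, e1, -⟩ := mul_deltaMat_apply k
  have h1 : ‖k 1 0‖ * p < ‖k 1 1‖ := by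
    by_contra h2
    apply h
    rw [newvec, if_neg]
    rwa [e0, e1, norm_mul, norm_inv, Padic.norm_p, inv_inv]
  have h11 : ‖k 1 1‖ ≤ 1 := hk.1 1 1
  have h00 : ‖k 0 0‖ ≤ 1 := hk.1 0 0
  have h01 : ‖k 0 1‖ ≤ 1 := hk.1 0 1
  have h2 : ‖k 1 0‖ < (p : ℝ) ^ (-2 + 1 : ℤ) := by
    rw [show (-2 + 1 : ℤ) = -1 by norm_num, zpow_neg_one, ← one_div, lt_div_iff₀ hp0]
    exact h1.trans_le h11
  have h3 := norm_le_zpow_of_lt h2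
  have h4 : ‖k 1 0‖ ≤ ((p : ℝ) ^ 2)⁻¹ := h3
  refine ⟨h4, ?_⟩
  have hlt : ‖k 0 1 * k 1 0‖ < ‖gdet k‖ := by
    rw [norm_gdet_of_mem hk, norm_mul]
    have : ((p : ℝ) ^ 2)⁻¹ < 1 := inv_lt_one_of_one_lt₀ (one_lt_pow₀ one_lt_prime_cast two_ne_zero)
    calc _ ≤ 1 * ((p : ℝ) ^ 2)⁻¹ := by gcongr
      _ < 1 := by rwa [one_mul]
  have h5 := norm_add_eq_of_lt hlt
  rw [gdet_eq, sub_add_cancel, ← gdet_eq, norm_gdet_of_mem hk, norm_mul] at h5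
  have := norm_nonneg (k 1 1)
  have := norm_nonneg (k 0 0)
  nlinarith

theorem gdet_toGL (x : SL2 p) : gdet (Matrix.SpecialLinearGroup.toGL x) = 1 := x.det_coe

theorem norm_prime_inv : ‖(p : ℚ_[p])⁻¹‖ = p := by rw [norm_inv, Padic.norm_p, inv_inv]

/-- The lower right entry of `k x` is `k 1 1 * x 1 1` times an element of `1 + pℤ_p`: the bound `‖k
1 0‖ ≤ p⁻²` absorbs an entry `b` with one power of `p` in the denominator. -/
theorem newvec_translate {ξ₁ ξ₂ : MulCharQp p} (hξ₁ : IsUnramified ξ₁) (hξ₂ : IsTame ξ₂)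
    {k : GL2 p} (hk0 : ‖k 1 0‖ ≤ ((p : ℝ) ^ 2)⁻¹) (hk1 : ‖k 1 1‖ = 1) {x : SL2 p}
    (hc : ‖x 1 0‖ ≤ ((p : ℝ) ^ 2)⁻¹) (ha : ‖x 0 0‖ ≤ 1) (hd : ‖x 1 1‖ = 1) (hb : ‖x 0 1‖ ≤ p) :
    newvec ξ₁ ξ₂ (k * Matrix.SpecialLinearGroup.toGL x * deltaMat p) =
      charExt ξ₂ (x 1 1) * newvec ξ₁ ξ₂ (k * deltaMat p) := by
  have hp0 := prime_cast_pos (p := p)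
  have hq := inv_prime_lt_one (p := p)
  obtain ⟨e0, e1, e2⟩ := mul_deltaMat_apply k
  obtain ⟨f0, f1, f2⟩ := mul_deltaMat_apply (k * Matrix.SpecialLinearGroup.toGL x)
  rw [GL2_mul_apply k, toGL_apply, toGL_apply] at f0 f1
  rw [gdet_mul k, gdet_toGL, mul_one] at f2
  have hd0 : x 1 1 ≠ 0 := by intro h; rw [h] at hd; simp at hd
  have hk10 : k 1 1 ≠ 0 := by intro h; rw [h] at hk1; simp at hk1
  have hsm : ∀ t : ℚ_[p], ‖t‖ ≤ ((p : ℝ) ^ 2)⁻¹ → ‖t * (p : ℚ_[p])⁻¹‖ < 1 := by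
    intro t ht
    rw [norm_mul, norm_prime_inv]
    calc _ ≤ ((p : ℝ) ^ 2)⁻¹ * p := by gcongr
      _ = (p : ℝ)⁻¹ := by field_simp
      _ < 1 := hq
  have n0 : ‖k 1 0 * x 0 0 + k 1 1 * x 1 0‖ ≤ ((p : ℝ) ^ 2)⁻¹ := by
    refine norm_add_le_of_le ?_ ?_ <;> rw [norm_mul]
    · exact (mul_le_of_le_one_right (norm_nonneg _) ha).trans hk0
    · rwa [hk1, one_mul]
  have hsmall : ‖k 1 0 * x 0 1 / (k 1 1 * x 1 1)‖ ≤ (p : ℝ)⁻¹ := by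
    rw [norm_div, norm_mul, norm_mul, hk1, hd, one_mul, div_one]
    calc _ ≤ ((p : ℝ) ^ 2)⁻¹ * p := by gcongr
      _ = (p : ℝ)⁻¹ := by field_simp
  set r : ℚ_[p] := 1 + k 1 0 * x 0 1 / (k 1 1 * x 1 1) with hr
  have hrn : ‖r‖ = 1 := by
    rw [hr, norm_add_eq_of_lt, norm_one]; rw [norm_one]; exact hsmall.trans_lt hq
  have hr0 : r ≠ 0 := by intro h; rw [h] at hrn; simp at hrn
  have e3 : k 1 0 * x 0 1 + k 1 1 * x 1 1 = k 1 1 * x 1 1 * r := by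
    rw [hr]; field_simp; ring
  rw [e3] at f1
  have n1 : ‖k 1 1 * x 1 1 * r‖ = 1 := by rw [norm_mul, norm_mul, hk1, hd, hrn]; norm_num
  unfold newvec
  rw [if_pos (by rw [f0, f1, n1]; exact hsm _ n0), if_pos (by rw [e0, e1, hk1]; exact hsm _ hk0),
    f1, f2, e1, e2]
  have h1 : charExt ξ₁ (gdet k * (p : ℚ_[p])⁻¹ / (k 1 1 * x 1 1 * r)) =
      charExt ξ₁ (gdet k * (p : ℚ_[p])⁻¹ / k 1 1) := by
    rw [show gdet k * (p : ℚ_[p])⁻¹ / (k 1 1 * x 1 1 * r) =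
      gdet k * (p : ℚ_[p])⁻¹ / k 1 1 * (1 / (x 1 1 * r)) by field_simp, charExt_mul,
      hξ₁.charExt_eq_one (x := 1 / (x 1 1 * r)) (by simp [hd, hrn]), mul_one]
  have h2 : charExt ξ₂ (k 1 1 * x 1 1 * r) = charExt ξ₂ (x 1 1) * charExt ξ₂ (k 1 1) := by
    rw [charExt_mul, charExt_mul, hξ₂.charExt_eq_one (x := r) (by rw [hr, add_sub_cancel_left]; exact hsmall)]
    ring
  have h3 : ‖gdet k * (p : ℚ_[p])⁻¹ / (k 1 1 * x 1 1 * r) / (k 1 1 * x 1 1 * r)‖ =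
      ‖gdet k * (p : ℚ_[p])⁻¹ / k 1 1 / k 1 1‖ := by
    rw [norm_div, norm_div, n1, norm_div, norm_div, hk1]
  rw [h1, h2, h3]
  ring

/-- In `k x` the term `k 1 1 * x 1 0` dominates the lower left entry, whose norm becomes exactly `1`
after level raising. The lower right entry has norm at most `1`, so the point is off the support of
`newvec`. -/
theorem newvec_translate_eq_zero (ξ₁ ξ₂ : MulCharQp p)
    {k : GL2 p} (hk0 : ‖k 1 0‖ ≤ ((p : ℝ) ^ 2)⁻¹) (hk1 : ‖k 1 1‖ = 1) {x : SL2 p}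
    (hc : ‖x 1 0‖ = (p : ℝ)⁻¹) (ha : ‖x 0 0‖ ≤ 1) (hd : ‖x 1 1‖ ≤ 1) :
    newvec ξ₁ ξ₂ (k * Matrix.SpecialLinearGroup.toGL x * deltaMat p) = 0 := by
  have hp0 := prime_cast_pos (p := p)
  have hp1 := one_lt_prime_cast (p := p)
  have hq := inv_prime_lt_one (p := p)
  obtain ⟨f0, f1, f2⟩ := mul_deltaMat_apply (k * Matrix.SpecialLinearGroup.toGL x)
  rw [GL2_mul_apply k, toGL_apply, toGL_apply] at f0 f1
  have hb : ‖x 0 1‖ ≤ p := by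
    have h1 : ‖x 0 1 * x 1 0‖ ≤ 1 := by
      rw [show x 0 1 * x 1 0 = x 0 0 * x 1 1 - 1 by linear_combination -(SL2_det x)]
      refine norm_sub_le_of_le ?_ (by simp)
      rw [norm_mul]; exact mul_le_one₀ ha (norm_nonneg _) hd
    rwa [norm_mul, hc, ← div_eq_mul_inv, div_le_one hp0] at h1
  have hlt : ((p : ℝ) ^ 2)⁻¹ < (p : ℝ)⁻¹ := by
    rw [sq, mul_inv]; exact mul_lt_of_lt_one_right (by positivity) hq
  rw [newvec, if_neg]
  rw [f0, f1, not_lt, norm_mul, norm_prime_inv, add_comm (k 1 0 * x 0 0),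
    norm_add_eq_of_lt (x := k 1 1 * x 1 0), norm_mul (k 1 1) (x 1 0), hk1, hc, one_mul, inv_mul_cancel₀ hp0.ne']
  · refine norm_add_le_of_le ?_ ?_ <;> rw [norm_mul]
    · calc _ ≤ ((p : ℝ) ^ 2)⁻¹ * p := by gcongr
        _ = (p : ℝ)⁻¹ := by field_simp
        _ ≤ 1 := hq.le
    · rwa [hk1, one_mul]
  · rw [norm_mul, norm_mul, hk1, hc, one_mul]
    calc _ ≤ ((p : ℝ) ^ 2)⁻¹ * 1 := by gcongr
      _ < _ := by rwa [mul_one]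

section

variable {ξ₁ ξ₂ : MulCharQp p} {g : GL2 p → ℂ}

/-- Wherever the second factor of the pairing is non-zero, `newvec_translate` turns the translation
into the scalar `ξ₂(d)`. -/
theorem pairing_levelRaise (hξ₁ : IsUnramified ξ₁) (hξ₂ : HasConductorOne ξ₂)
    (hg : IsPrincipalSeriesNewvector ξ₁ ξ₂ g) {x : SL2 p}
    (hc : ‖x 1 0‖ ≤ ((p : ℝ) ^ 2)⁻¹) (ha : ‖x 0 0‖ ≤ 1) (hd : ‖x 1 1‖ = 1) (hb : ‖x 0 1‖ ≤ p) :
    pairingGL2 (rightTranslate (Matrix.SpecialLinearGroup.toGL x) (levelRaise g)) (levelRaise g) =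
      charExt ξ₂ (x 1 1) * pairingGL2 (levelRaise g) (levelRaise g) := by
  unfold pairingGL2
  rw [← integral_const_mul]
  refine setIntegral_congr_fun isOpen_GL2Zp.measurableSet fun k hk => ?_
  change g (k * Matrix.SpecialLinearGroup.toGL x * deltaMat p) * conj (g (k * deltaMat p)) =
    charExt ξ₂ (x 1 1) * (g (k * deltaMat p) * conj (g (k * deltaMat p)))
  rw [hg.eq_newvec hξ₂.1 (k * deltaMat p), hg.eq_newvec hξ₂.1 (k * _ * deltaMat p)]
  by_cases h : newvec ξ₁ ξ₂ (k * deltaMat p) = 0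
  · rw [h]; simp
  · obtain ⟨h1, h2⟩ := norm_of_newvec_ne_zero hk h
    rw [newvec_translate hξ₁ hξ₂.2 h1 h2 hc ha hd hb]
    ring

theorem pairing_levelRaise_eq_zero (hξ₂ : HasConductorOne ξ₂)
    (hg : IsPrincipalSeriesNewvector ξ₁ ξ₂ g) {x : SL2 p}
    (hc : ‖x 1 0‖ = (p : ℝ)⁻¹) (ha : ‖x 0 0‖ ≤ 1) (hd : ‖x 1 1‖ ≤ 1) :
    pairingGL2 (rightTranslate (Matrix.SpecialLinearGroup.toGL x) (levelRaise g))
      (levelRaise g) = 0 := by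
  unfold pairingGL2
  rw [setIntegral_congr_fun (g := fun _ => (0 : ℂ)) isOpen_GL2Zp.measurableSet, integral_zero]
  intro k hk
  change g (k * Matrix.SpecialLinearGroup.toGL x * deltaMat p) * conj (g (k * deltaMat p)) = 0
  rw [hg.eq_newvec hξ₂.1 (k * deltaMat p), hg.eq_newvec hξ₂.1 (k * _ * deltaMat p)]
  by_cases h : newvec ξ₁ ξ₂ (k * deltaMat p) = 0
  · rw [h]; simp
  · obtain ⟨h1, h2⟩ := norm_of_newvec_ne_zero hk h
    rw [newvec_translate_eq_zero ξ₁ ξ₂ h1 h2 hc ha hd]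
    ring

instance instIsHaarMeasureGL2 : (haarGL2 p).IsHaarMeasure := by
  unfold haarGL2; infer_instance

/-- The integrand is continuous and non-negative, and positive at the identity, an interior point of
`GL₂(ℤ_p)`. -/
theorem pairing_levelRaise_self_ne_zero (hξ₂ : HasConductorOne ξ₂)
    (hg : IsPrincipalSeriesNewvector ξ₁ ξ₂ g) :
    pairingGL2 (levelRaise g) (levelRaise g) ≠ 0 := by
  have hcont : Continuous (levelRaise g) :=
    hg.mem.locallyConstant.continuous.comp (continuous_mul_const _)
  have e : pairingGL2 (levelRaise g) (levelRaise g) =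
      ((∫ k in GL2Zp p, ‖levelRaise g k‖ ^ 2 ∂haarGL2 p : ℝ) : ℂ) := by
    unfold pairingGL2
    rw [← integral_complex_ofReal]
    congr 1 with k
    rw [Complex.mul_conj, Complex.normSq_eq_norm_sq]
  rw [e, Ne, Complex.ofReal_eq_zero]
  refine ne_of_gt ?_
  have hc2 : Continuous fun k => ‖levelRaise g k‖ ^ 2 := by fun_prop
  rw [setIntegral_pos_iff_support_of_nonneg_ae (Eventually.of_forall fun k => by positivity)
    (hc2.continuousOn.integrableOn_compact (show IsCompact (GL2Zp p) from
      (GL2ZpCompacts p).isCompact))]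
  refine IsOpen.measure_pos _ (hc2.isOpen_support.inter isOpen_GL2Zp) ⟨1, ?_, one_mem_K01.1⟩
  rw [Function.mem_support]
  have hne : levelRaise g 1 ≠ 0 := by
    change g (1 * deltaMat p) ≠ 0
    obtain ⟨e0, e1, e2⟩ := mul_deltaMat_apply (1 : GL2 p)
    rw [hg.eq_newvec hξ₂.1]
    refine mul_ne_zero (hg.one_ne_zero hξ₂.1) ?_
    have hd : gdet (1 : GL2 p) = 1 := by simp [gdet]
    have h10 : (1 : GL2 p) 1 0 = 0 := rfl
    have h11 : (1 : GL2 p) 1 1 = 1 := rfl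
    rw [newvec, e0, e1, e2, hd, h10, h11, if_pos (by simp)]
    have hpi : (p : ℚ_[p])⁻¹ ≠ 0 := inv_ne_zero prime_cast_ne_zero
    refine mul_ne_zero (mul_ne_zero (charExt_ne_zero _ (by simpa using hpi))
      (charExt_ne_zero _ one_ne_zero)) ?_
    rw [one_mul, div_one, div_one, norm_prime_inv, Ne, Complex.ofReal_eq_zero]
    exact (Real.sqrt_pos.mpr prime_cast_pos).ne'
  positivity

end

/-! ### Matrix coefficients of the Weil representation -/

/-- The integral of `ψ(e x²)` over the units. -/
def unitGauss (ψ : AddChar ℚ_[p] Circle) (e : ℚ_[p]) : ℂ :=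
  ∫ x in unitSet p, (ψ (e * x ^ 2) : ℂ) ∂haarQp p

open Classical in
/-- The product of Weil indices in the matrix coefficients at a matrix with bottom row
`(c, d)`. -/
def weilPhase (ψ : AddChar ℚ_[p] Circle) (c d : ℚ_[p]) : ℂ :=
  if c = 0 then 1 else weilIndex (ψ.mulShift (-c⁻¹)) * weilIndex (ψ.mulShift (d / c))

theorem IsUnitVector.norm_eq {χ : MulCharQp p} (hχ : IsTame χ) {h : ℚ_[p] → ℂ}
    (hh : IsUnitVector χ h) {x : ℚ_[p]} (hx : ‖x‖ = 1) : ‖h x‖ = ‖h 1‖ := by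
  have hx0 : x ≠ 0 := by rintro rfl; simp at hx
  have := hh.equivariant (Units.mk0 x hx0) (by simpa using hx) 1
  rw [Units.val_mk0, mul_one] at this
  rw [this, norm_mul, norm_inv, hχ.norm_eq_one (by simpa using hx), inv_one, one_mul]

theorem IsUnitVector.mul_conj {χ : MulCharQp p} (hχ : IsTame χ) {h : ℚ_[p] → ℂ}
    (hh : IsUnitVector χ h) (x : ℚ_[p]) :
    h x * conj (h x) = (unitSet p).indicator (fun _ => ((‖h 1‖ ^ 2 : ℝ) : ℂ)) x := by
  by_cases hx : ‖x‖ = 1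
  · rw [Set.indicator_of_mem (mem_unitSet.mpr hx), Complex.mul_conj, Complex.normSq_eq_norm_sq,
      hh.norm_eq hχ hx]
  · rw [Set.indicator_of_notMem (fun h' => hx (mem_unitSet.mp h')), hh.eq_zero x hx, zero_mul]

theorem IsUnitVector.integral_mul_conj {χ : MulCharQp p} (hχ : IsTame χ) {h : ℚ_[p] → ℂ}
    (hh : IsUnitVector χ h) (f : ℚ_[p] → ℂ) :
    ∫ x, f x * (h x * conj (h x)) ∂haarQp p =
      ((‖h 1‖ ^ 2 : ℝ) : ℂ) * ∫ x in unitSet p, f x ∂haarQp p := by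
  rw [← integral_const_mul, ← integral_indicator measurableSet_unitSet]
  congr 1 with x
  rw [hh.mul_conj hχ]
  by_cases hx : x ∈ unitSet p
  · simp [hx, mul_comm]
  · simp [hx]

theorem IsUnitVector.pairing_self {χ : MulCharQp p} (hχ : IsTame χ) {h : ℚ_[p] → ℂ}
    (hh : IsUnitVector χ h) :
    pairingQp h h = ((‖h 1‖ ^ 2 * (1 - (p : ℝ)⁻¹) : ℝ) : ℂ) := by
  have := hh.integral_mul_conj hχ (fun _ => 1)
  simp only [one_mul, setIntegral_const, haarQp_real_unitSet, Complex.real_smul, mul_one] at this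
  rw [pairingQp, this]
  push_cast
  rfl

theorem pairingQp_indZp (f : ℚ_[p] → ℂ) :
    pairingQp f (indZp p) = ∫ x in qball p 0, f x ∂haarQp p := by
  rw [pairingQp, ← integral_indicator (measurableSet_qball 0), indZp, ← qball_zero]
  congr 1 with x
  by_cases hx : x ∈ qball p 0 <;> simp [hx]

theorem pairingQp_indZp_self : pairingQp (indZp p) (indZp p) = 1 := by
  rw [pairingQp_indZp, indZp, ← qball_zero, setIntegral_indicator (measurableSet_qball 0),
    Set.inter_self, setIntegral_const, haarQp_real_qball]
  simp

theorem pairingQp_eq_zero {χ : MulCharQp p} {h f : ℚ_[p] → ℂ} (hh : IsUnitVector χ h)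
    (hf : ∀ x, ‖x‖ = 1 → f x = 0) : pairingQp f h = 0 := by
  rw [pairingQp, ← integral_zero ℚ_[p] ℂ (μ := haarQp p)]
  congr 1 with x
  by_cases hx : ‖x‖ = 1
  · rw [hf x hx, zero_mul]
  · rw [hh.eq_zero x hx, map_zero, mul_zero]

theorem pairingQp_const_mul (c : ℂ) (f h : ℚ_[p] → ℂ) :
    pairingQp (fun x => c * f x) h = c * pairingQp f h := by
  unfold pairingQp
  rw [← integral_const_mul]
  simp only [mul_assoc]

theorem norm_d_div_c {c d : ℚ_[p]} (hc0 : c ≠ 0) (hc : ‖c‖ ≤ ((p : ℝ) ^ 2)⁻¹) (hd : ‖d‖ = 1) :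
    ∃ m : ℤ, ‖d / c‖ = (p : ℝ) ^ m ∧ 2 ≤ m := by
  have hd0 : d ≠ 0 := by rintro rfl; simp at hd
  obtain ⟨m, hm⟩ := exists_norm_eq_zpow (div_ne_zero hd0 hc0)
  refine ⟨m, hm, ?_⟩
  have h1 : (p : ℝ) ^ (2 : ℤ) ≤ (p : ℝ) ^ m := by
    rw [← hm, norm_div, hd, one_div]
    exact_mod_cast (le_inv_comm₀ (norm_pos_iff.mpr hc0) (pow_pos prime_cast_pos 2)).mp hc
  exact (zpow_le_zpow_iff_right₀ one_lt_prime_cast).mp h1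

theorem sqrt_mul_sqrt {c d : ℚ_[p]} (hc0 : c ≠ 0) (hd : ‖d‖ = 1) :
    ((√‖c‖⁻¹ : ℝ) : ℂ) * ((√‖d / c‖⁻¹ : ℝ) : ℂ) = 1 := by
  rw [norm_div, hd, one_div, inv_inv, ← Complex.ofReal_mul, ← Real.sqrt_mul (by positivity),
    inv_mul_cancel₀ (norm_ne_zero_iff.mpr hc0)]
  simp

section

variable {ψ : AddChar ℚ_[p] Circle} (hψ : ∀ x : ℚ_[p], ψ x = 1 ↔ ‖x‖ ≤ 1)
include hψ

theorem norm_weilPhase (hp : p ≠ 2) (c : ℚ_[p]) {d : ℚ_[p]} (hd : ‖d‖ = 1) :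
    ‖weilPhase ψ c d‖ = 1 := by
  have hd0 : d ≠ 0 := by rintro rfl; simp at hd
  unfold weilPhase
  split_ifs with hc
  · simp
  · rw [norm_mul, norm_weilIndex_mulShift hψ hp (neg_ne_zero.mpr (inv_ne_zero hc)),
      norm_weilIndex_mulShift hψ hp (div_ne_zero hd0 hc), one_mul]

/-- This lets the phase for `ψ(-Dx)` cancel the one for `ψ(-x)`, as `D` is a unit square. -/
theorem weilPhase_mulShift_sq (hp : p ≠ 2) (c : ℚ_[p]) {d u : ℚ_[p]} (hd : ‖d‖ = 1)
    (hu : ‖u‖ = 1) : weilPhase (ψ.mulShift (u ^ 2)) c d = weilPhase ψ c d := by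
  have hd0 : d ≠ 0 := by rintro rfl; simp at hd
  unfold weilPhase
  split_ifs with hc
  · rfl
  · rw [AddChar.mulShift_mulShift, AddChar.mulShift_mulShift, mul_comm (u ^ 2), mul_comm (u ^ 2),
      weilIndex_mulShift_mul_sq hψ hp (neg_ne_zero.mpr (inv_ne_zero hc)) hu,
      weilIndex_mulShift_mul_sq hψ hp (div_ne_zero hd0 hc) hu]

omit hψ in
-- Because `ad - bc = 1`, `a/c - 1/(dc) = b/d`.
theorem addChar_diag_mul {x : SL2 p} (hc : x 1 0 ≠ 0) (hd : x 1 1 ≠ 0) (y : ℚ_[p]) :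
    (ψ (x 0 0 / x 1 0 * y ^ 2) : ℂ) * ψ (-(y ^ 2 / (x 1 1 * x 1 0))) =
      ψ (x 0 1 / x 1 1 * y ^ 2) := by
  rw [← Circle.coe_mul, ← AddChar.map_add_eq_mul]
  congr 2
  field_simp
  linear_combination y ^ 2 * SL2_det x

/-- By stationary phase `x` acts on `h` as multiplication by `ψ((b/d) y²)`, up to a phase and
`χ(d)`; moreover `|h|` is constant on the units. -/
theorem pairing_weilRep_unitVector (hp : p ≠ 2) {χ : MulCharQp p} (hχ : IsTame χ)
    {h : ℚ_[p] → ℂ} (hh : IsUnitVector χ h) {x : SL2 p} (hc : ‖x 1 0‖ ≤ ((p : ℝ) ^ 2)⁻¹)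
    (hd : ‖x 1 1‖ = 1) :
    pairingQp (weilRep ψ ⟨x, 1⟩ h) h = weilPhase ψ (x 1 0) (x 1 1) * charExt χ (x 1 1) *
      ((‖h 1‖ ^ 2 : ℝ) : ℂ) * unitGauss ψ (x 0 1 / x 1 1) := by
  have hd0 : x 1 1 ≠ 0 := by intro h; rw [h] at hd; simp at hd
  have hdet := SL2_det x
  by_cases hc0 : x 1 0 = 0
  · rw [hc0] at hdet
    have ha : ‖x 0 0‖ = 1 := by
      have := congrArg norm (show x 0 0 * x 1 1 = 1 by linear_combination hdet)
      rwa [norm_mul, hd, mul_one, norm_one] at this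
    have e : ∀ y : ℚ_[p], weilRep ψ ⟨x, 1⟩ h y =
        charExt χ (x 1 1) * (ψ (x 0 1 / x 1 1 * y ^ 2) * h y) := by
      intro y
      have e1 : x 0 0 * y = y / x 1 1 := by field_simp; linear_combination y * hdet
      have e2 : x 0 0 * x 0 1 = x 0 1 / x 1 1 := by field_simp; linear_combination x 0 1 * hdet
      rw [weilRep_of_eq_zero ψ hc0, chiPsi_unit hψ hp ha, ha, e1, e2, hh.map_div hd]
      simp
      ring
    rw [show weilRep ψ ⟨x, 1⟩ h = _ from funext e, pairingQp_const_mul, pairingQp]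
    simp only [mul_assoc, weilPhase, if_pos hc0, one_mul]
    rw [hh.integral_mul_conj hχ, unitGauss]
  · obtain ⟨m, hm, hm2⟩ := norm_d_div_c hc0 hc hd
    have e : ∀ y : ℚ_[p], weilRep ψ ⟨x, 1⟩ h y =
        (weilPhase ψ (x 1 0) (x 1 1) * charExt χ (x 1 1)) * (ψ (x 0 1 / x 1 1 * y ^ 2) * h y) := by
      intro y
      rw [weilRep_of_ne_zero hψ hp hc0, quadFourier_unitVector hψ hp hχ hh hc0 hc hd,
        hh.map_div hd, gaussInt_eq hψ hp hm (by omega), ← addChar_diag_mul hc0 hd0, weilPhase,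
        if_neg hc0]
      simp only [Units.val_one, Int.cast_one, one_mul]
      linear_combination (weilIndex (ψ.mulShift (-(x 1 0)⁻¹)) *
        weilIndex (ψ.mulShift (x 1 1 / x 1 0)) * charExt χ (x 1 1) *
        ((ψ (x 0 0 / x 1 0 * y ^ 2) : ℂ) * ψ (-(y ^ 2 / (x 1 1 * x 1 0)))) * h y) *
        sqrt_mul_sqrt hc0 hd
    rw [show weilRep ψ ⟨x, 1⟩ h = _ from funext e, pairingQp_const_mul, pairingQp]
    simp only [mul_assoc]
    rw [hh.integral_mul_conj hχ, unitGauss]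

omit hψ in
-- Complete the square: the translation by `x/d` preserves `ℤ_p`.
theorem quadFourier_indZp {c d x : ℚ_[p]} (hc : c ≠ 0) (hd : ‖d‖ = 1) (hx : ‖x‖ ≤ 1) :
    quadFourier ψ c d (indZp p) x = ψ (-(x ^ 2 / (d * c))) * gaussInt ψ 0 (d / c) := by
  have hd0 : d ≠ 0 := by rintro rfl; simp at hd
  have e : quadFourier ψ c d (indZp p) x =
      ∫ y in qball p 0, (ψ ((d * y ^ 2 - 2 * x * y) / c) : ℂ) ∂haarQp p := by
    rw [quadFourier, ← integral_indicator (measurableSet_qball 0), indZp, ← qball_zero]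
    congr 1 with y
    by_cases hy : y ∈ qball p 0 <;> simp [hy]
  rw [e, ← setIntegral_qball_add (z := x / d) (by rw [norm_div, hd, div_one, zpow_zero]; exact hx),
    gaussInt, ← integral_const_mul]
  congr 1 with y
  rw [← Circle.coe_mul, ← AddChar.map_add_eq_mul]
  congr 2
  field_simp
  ring

theorem pairing_weilRep_indZp (hp : p ≠ 2) {x : SL2 p} (hc : ‖x 1 0‖ ≤ ((p : ℝ) ^ 2)⁻¹)
    (hd : ‖x 1 1‖ = 1) :
    pairingQp (weilRep ψ ⟨x, 1⟩ (indZp p)) (indZp p) =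
      weilPhase ψ (x 1 0) (x 1 1) * gaussInt ψ 0 (x 0 1 / x 1 1) := by
  have hd0 : x 1 1 ≠ 0 := by intro h; rw [h] at hd; simp at hd
  have hdet := SL2_det x
  rw [pairingQp_indZp, gaussInt, ← integral_const_mul]
  refine setIntegral_congr_fun (measurableSet_qball 0) fun y hy => ?_
  have hy1 : ‖y‖ ≤ 1 := by simpa using mem_qball.mp hy
  by_cases hc0 : x 1 0 = 0
  · rw [hc0] at hdet
    have ha : ‖x 0 0‖ = 1 := by
      have := congrArg norm (show x 0 0 * x 1 1 = 1 by linear_combination hdet)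
      rwa [norm_mul, hd, mul_one, norm_one] at this
    have e2 : x 0 0 * x 0 1 = x 0 1 / x 1 1 := by field_simp; linear_combination x 0 1 * hdet
    have e3 : indZp p (x 0 0 * y) = 1 :=
      Set.indicator_of_mem (show x 0 0 * y ∈ {x | ‖x‖ ≤ 1} by
        rw [Set.mem_ofPred_eq, norm_mul, ha, one_mul]; exact hy1) _
    simp only [weilRep_of_eq_zero ψ hc0, chiPsi_unit hψ hp ha, ha, e2, e3, weilPhase, if_pos hc0]
    simp
  · obtain ⟨m, hm, hm2⟩ := norm_d_div_c hc0 hc hd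
    rw [weilRep_of_ne_zero hψ hp hc0, quadFourier_indZp hc0 hd hy1,
      gaussInt_eq hψ hp hm (by omega), ← addChar_diag_mul hc0 hd0, weilPhase, if_neg hc0]
    simp only [Units.val_one, Int.cast_one, one_mul]
    linear_combination (weilIndex (ψ.mulShift (-(x 1 0)⁻¹)) *
      weilIndex (ψ.mulShift (x 1 1 / x 1 0)) *
      ((ψ (x 0 0 / x 1 0 * y ^ 2) : ℂ) * ψ (-(y ^ 2 / (x 1 1 * x 1 0))))) *
      sqrt_mul_sqrt hc0 hd

/-! ### Vanishing of oscillatory integrals and of matrix coefficients -/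

theorem unitGauss_eq_zero (hp : p ≠ 2) {e : ℚ_[p]} (he : (p : ℝ) < ‖e‖) : unitGauss ψ e = 0 := by
  have hp0 := prime_cast_pos (p := p)
  have hp1 := one_lt_prime_cast (p := p)
  have he0 : e ≠ 0 := norm_pos_iff.mp (hp0.trans he)
  obtain ⟨n, hn⟩ := exists_norm_eq_zpow he0
  have hn2 : 1 < n := by
    rw [hn] at he
    exact (zpow_lt_zpow_iff_right₀ hp1).mp (by simpa using he)
  unfold unitGauss
  rw [← integral_indicator measurableSet_unitSet]
  have hF : Integrable ((unitSet p).indicator fun x => (ψ (e * x ^ 2) : ℂ)) (haarQp p) :=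
    (integrable_indicator_iff measurableSet_unitSet).mpr
      ((integrableOn_addChar_comp hψ (by fun_prop) 0).mono_set unitSet_subset_qball)
  -- With `‖e‖ = p^n` and `n ≥ 2`, shifts of norm at most `p^(1-n)` make `e z²` integral, while on
  -- units the slope times `p^(1-n)` has norm `p > 1`: no stationary point.
  rw [integral_eq_setIntegral_of_shift hψ hF (l := fun y => 2 * e * y) (by fun_prop) (1 - n)]
  · rw [setIntegral_congr_fun (g := fun _ => (0 : ℂ))
      (isClosed_le (by fun_prop) continuous_const).measurableSet, integral_zero]
    intro y hy
    refine Set.indicator_of_notMem (fun hy1 => ?_) _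
    rw [mem_unitSet] at hy1
    rw [Set.mem_ofPred_eq, norm_mul, norm_mul, norm_two_eq_one hp, hn, hy1, one_mul, mul_one,
      ← zpow_add₀ hp0.ne', add_sub_cancel, zpow_one] at hy
    linarith
  · intro y z hz
    have h1 : ‖z‖ < 1 := by
      refine hz.trans_lt ?_
      exact zpow_lt_one_of_neg₀ hp1 (by omega)
    have h2 : ‖e * z ^ 2‖ ≤ 1 := by
      rw [norm_mul, norm_pow, hn]
      calc (p : ℝ) ^ n * ‖z‖ ^ 2 ≤ (p : ℝ) ^ n * ((p : ℝ) ^ (1 - n)) ^ 2 := by gcongr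
        _ = (p : ℝ) ^ (2 - n) := by
          rw [← zpow_natCast, ← zpow_mul, ← zpow_add₀ hp0.ne']; congr 1; push_cast; ring
        _ ≤ (p : ℝ) ^ (0 : ℤ) := zpow_le_zpow_right₀ hp1.le (by omega)
        _ = 1 := zpow_zero _
    by_cases hy : ‖y‖ = 1
    · have hyz : ‖y + z‖ = 1 := by rw [norm_add_eq_of_lt (by rwa [hy]), hy]
      rw [Set.indicator_of_mem (mem_unitSet.mpr hy), Set.indicator_of_mem (mem_unitSet.mpr hyz),
        addChar_mul_add_sq hψ h2]
    · have hyz : ‖y + z‖ ≠ 1 := by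
        intro h
        have := norm_add_eq_of_lt (x := y + z) (z := -z) (by rwa [norm_neg, h])
        rw [add_neg_cancel_right, h] at this
        exact hy this
      rw [Set.indicator_of_notMem (fun h => hy (mem_unitSet.mp h)),
        Set.indicator_of_notMem (fun h => hyz (mem_unitSet.mp h)), zero_mul]

/-- Non-stationary phase at scale `p^r`: such shifts preserve `h` and make the quadratic term
integral, while on the support of `h` the slope is too large. -/
theorem quadFourier_eq_zero (hp : p ≠ 2) {χ : MulCharQp p} (hχ : IsTame χ)
    {h : ℚ_[p] → ℂ} (hh : IsUnitVector χ h) {c d x : ℚ_[p]} (hc : c ≠ 0) {r : ℤ} (hr : r ≤ -1)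
    (hdr : ‖d‖ * ((p : ℝ) ^ r) ^ 2 ≤ ‖c‖)
    (hlarge : ∀ y, ‖y‖ = 1 → ‖c‖ < ‖d * y - x‖ * (p : ℝ) ^ r) :
    quadFourier ψ c d h x = 0 := by
  have hcpos := norm_pos_iff.mpr hc
  unfold quadFourier
  rw [integral_eq_setIntegral_of_shift hψ (integrable_quad_mul hψ (hh.integrable hχ) c d x)
    (l := fun y => 2 * (d * y - x) / c) (by fun_prop) r]
  · rw [setIntegral_congr_fun (g := fun _ => (0 : ℂ))
      (isClosed_le (by fun_prop) continuous_const).measurableSet, integral_zero]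
    intro y hy
    beta_reduce
    rw [hh.eq_zero y, mul_zero]
    intro hy1
    rw [Set.mem_ofPred_eq, norm_div, norm_mul, norm_two_eq_one hp, one_mul, div_mul_eq_mul_div,
      div_le_one hcpos] at hy
    exact absurd (hlarge y hy1) (not_lt.mpr hy)
  · intro y z hz
    refine quad_mul_shift hψ hc (hh.map_add hχ (hz.trans
      (zpow_le_zpow_right₀ one_lt_prime_cast.le hr))) ?_
    rw [norm_div, norm_mul, norm_pow, div_le_one hcpos]
    exact le_trans (by gcongr) hdr

/-- The linear term `2xy/c` is integral, so the integrand is an even function times the odd `h`. -/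
theorem quadFourier_eq_zero_of_one_le (hp : p ≠ 2) {χ : MulCharQp p} {h : ℚ_[p] → ℂ}
    (hodd : χ (-1) = -1) (hh : IsUnitVector χ h) {c d x : ℚ_[p]} (hc : 1 ≤ ‖c‖) (hx : ‖x‖ = 1) :
    quadFourier ψ c d h x = 0 := by
  have hneg : ∀ y, h (-y) = -h y := by
    intro y
    have := hh.equivariant (-1) (by simp) y
    rw [hodd] at this
    simpa [inv_neg] using this
  have e : quadFourier ψ c d h x = ∫ y, (ψ (d * y ^ 2 / c) : ℂ) * h y ∂haarQp p := by
    unfold quadFourier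
    congr 1 with y
    by_cases hy : ‖y‖ = 1
    · congr 2
      rw [sub_div, sub_eq_add_neg]
      apply addChar_add_of_norm_le hψ
      rw [norm_neg, norm_div, norm_mul, norm_mul, norm_two_eq_one hp, hx, hy, one_mul, one_mul,
        one_div]
      exact inv_le_one_of_one_le₀ hc
    · rw [hh.eq_zero y hy, mul_zero, mul_zero]
  rw [e]
  exact integral_odd_eq_zero fun y => by rw [hneg]; ring_nf

/-- Here the oscillation comes from the outer factor `ψ((a/c) y²)` of the Weil action instead of the
Fourier integral. -/
theorem pairing_weilRep_eq_zero_of_slope (hp : p ≠ 2) {χ : MulCharQp p} (hχ : IsTame χ)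
    {h : ℚ_[p] → ℂ} (hh : IsUnitVector χ h) {x : SL2 p} (hc : ‖x 1 0‖ = (p : ℝ)⁻¹)
    (ha : 1 < ‖x 0 0‖) :
    pairingQp (weilRep ψ ⟨x, 1⟩ h) h = 0 := by
  have hp0 := prime_cast_pos (p := p)
  have hp1 := one_lt_prime_cast (p := p)
  have hc0 : x 1 0 ≠ 0 := by intro h; rw [h, norm_zero, eq_comm, inv_eq_zero] at hc; exact hp0.ne' hc
  have ha0 : x 0 0 ≠ 0 := by intro h; rw [h, norm_zero] at ha; linarith
  obtain ⟨m, hm⟩ := exists_norm_eq_zpow ha0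
  have hm1 : 0 < m := by
    rw [hm] at ha
    exact (zpow_lt_zpow_iff_right₀ hp1).mp (by simpa using ha)
  set q := quadFourier ψ (x 1 0) (x 1 1) h with hq
  -- Since `c` has valuation one and `t` is a unit, `2zt/c` is integral for `z` in `pℤ_p`.
  have hqs : ∀ y z : ℚ_[p], ‖z‖ ≤ (p : ℝ) ^ (-1 : ℤ) → q (y + z) = q y := by
    intro y z hz
    rw [hq]
    unfold quadFourier
    congr 1 with t
    by_cases ht : ‖t‖ = 1
    · congr 2
      rw [show (x 1 1 * t ^ 2 - 2 * (y + z) * t) / x 1 0 =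
        (x 1 1 * t ^ 2 - 2 * y * t) / x 1 0 + -(2 * z * t / x 1 0) by ring]
      apply addChar_add_of_norm_le hψ
      rw [norm_neg, norm_div, norm_mul, norm_mul, norm_two_eq_one hp, ht, hc, one_mul, mul_one,
        div_inv_eq_mul, ← le_div_iff₀ hp0, one_div]
      simpa using hz
    · rw [hh.eq_zero t ht, mul_zero, mul_zero]
  have hqc : Continuous q :=
    (isLocallyConstant_of_shift (zpow_pos hp0 (-1)) hqs).continuous
  have e : weilRep ψ ⟨x, 1⟩ h = fun y => (weilIndex (ψ.mulShift (-(x 1 0)⁻¹)) *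
      (√‖x 1 0‖⁻¹ : ℝ)) * (ψ (x 0 0 / x 1 0 * y ^ 2) * q y) := by
    funext y
    rw [weilRep_of_ne_zero hψ hp hc0]
    simp [hq]
  rw [e, pairingQp_const_mul, pairingQp]
  set F : ℚ_[p] → ℂ := fun y => (ψ (x 0 0 / x 1 0 * y ^ 2) * q y) * conj (h y) with hF
  have hFi : Integrable F (haarQp p) := by
    refine Continuous.integrable_of_hasCompactSupport ?_ ?_
    · exact (((continuous_addChar hψ).comp (by fun_prop)).mul hqc).mul
        (Complex.continuous_conj.comp (hh.isLocallyConstant hχ).continuous)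
    · exact HasCompactSupport.intro (isCompact_qball 0) fun y hy => by
        simp only [hF]
        rw [hh.eq_zero y, map_zero, mul_zero]
        intro h1; exact hy (by rw [mem_qball, h1, zpow_zero])
  have hint : ∫ y, F y ∂haarQp p = 0 := by
    -- With `‖a‖ = p^m` and `m ≥ 1`, the quadratic term of a shift has norm at most `p^(1-m)`, while
    -- the slope on units times `p^(-m)` has norm `p`.
    rw [integral_eq_setIntegral_of_shift hψ hFi (l := fun y => 2 * (x 0 0 / x 1 0) * y)
      (by fun_prop) (-m)]
    · rw [setIntegral_congr_fun (g := fun _ => (0 : ℂ))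
        (isClosed_le (by fun_prop) continuous_const).measurableSet, integral_zero]
      intro y hy
      simp only [hF]
      rw [hh.eq_zero y, map_zero, mul_zero]
      intro hy1
      rw [Set.mem_ofPred_eq, norm_mul, norm_mul, norm_two_eq_one hp, norm_div, hm, hc, hy1, one_mul,
        mul_one, div_inv_eq_mul, mul_right_comm, ← zpow_add₀ hp0.ne', add_neg_cancel, zpow_zero,
        one_mul] at hy
      linarith
    · intro y z hz
      have hz1 : ‖z‖ ≤ (p : ℝ) ^ (-1 : ℤ) := hz.trans (zpow_le_zpow_right₀ hp1.le (by omega))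
      have h2 : ‖x 0 0 / x 1 0 * z ^ 2‖ ≤ 1 := by
        rw [norm_mul, norm_div, norm_pow, hm, hc, div_inv_eq_mul, ← zpow_add_one₀ hp0.ne']
        calc (p : ℝ) ^ (m + 1) * ‖z‖ ^ 2 ≤ (p : ℝ) ^ (m + 1) * ((p : ℝ) ^ (-m)) ^ 2 := by gcongr
          _ = (p : ℝ) ^ (1 - m) := by
            rw [← zpow_natCast, ← zpow_mul, ← zpow_add₀ hp0.ne']; congr 1; push_cast; ring
          _ ≤ (p : ℝ) ^ (0 : ℤ) := zpow_le_zpow_right₀ hp1.le (by omega)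
          _ = 1 := zpow_zero _
      simp only [hF]
      rw [hqs y z hz1, hh.map_add hχ hz1, addChar_mul_add_sq hψ h2]
      ring
  rw [hint, mul_zero]

/-- The matrix coefficient of an odd unit vector vanishes away from the matrices with
`p² ∣ c` and `d` a unit, up to those with `c` of valuation one. -/
theorem pairing_weilRep_eq_zero (hp : p ≠ 2) {χ : MulCharQp p} (hχ : IsTame χ)
    (hodd : χ (-1) = -1) {h : ℚ_[p] → ℂ} (hh : IsUnitVector χ h) {x : SL2 p}
    (hx : ¬ (‖x 1 0‖ ≤ ((p : ℝ) ^ 2)⁻¹ ∧ ‖x 1 1‖ = 1))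
    (hx' : ¬ (‖x 1 0‖ = (p : ℝ)⁻¹ ∧ ‖x 0 0‖ ≤ 1 ∧ ‖x 1 1‖ ≤ 1)) :
    pairingQp (weilRep ψ ⟨x, 1⟩ h) h = 0 := by
  have hp0 := prime_cast_pos (p := p)
  have hp1 := one_lt_prime_cast (p := p)
  by_cases hc0 : x 1 0 = 0
  · have hd : ‖x 1 1‖ ≠ 1 := fun hd => hx ⟨by rw [hc0, norm_zero]; positivity, hd⟩
    have hdet := SL2_det x
    rw [hc0] at hdet
    have hn := congrArg norm (show x 0 0 * x 1 1 = 1 by linear_combination hdet)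
    rw [norm_mul, norm_one] at hn
    -- For `c = 0`, `‖a‖ = ‖d‖⁻¹ ≠ 1`, so multiplication by `a` moves the units off the support of
    -- `h`.
    refine pairingQp_eq_zero hh fun y hy => ?_
    rw [weilRep_of_eq_zero ψ hc0, hh.eq_zero (x 0 0 * y), mul_zero, mul_zero]
    rw [norm_mul, hy, mul_one]
    intro h1; rw [h1, one_mul] at hn; exact hd hn
  have hzero : (∀ y, ‖y‖ = 1 → quadFourier ψ (x 1 0) (x 1 1) h y = 0) →
      pairingQp (weilRep ψ ⟨x, 1⟩ h) h = 0 := fun hq =>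
    pairingQp_eq_zero hh fun y hy => by
      rw [weilRep_of_ne_zero hψ hp hc0, hq y hy, mul_zero, mul_zero]
  by_cases hc1 : 1 ≤ ‖x 1 0‖
  · exact hzero fun y hy => quadFourier_eq_zero_of_one_le hψ hp hodd hh hc1 hy
  obtain ⟨n, hn⟩ := exists_norm_eq_zpow hc0
  have hn1 : n ≤ -1 := by
    rw [hn, not_le] at hc1
    have := (zpow_lt_zpow_iff_right₀ hp1).mp (show (p : ℝ) ^ n < (p : ℝ) ^ (0 : ℤ) by simpa using hc1)
    omega
  by_cases hd1 : 1 < ‖x 1 1‖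
  · have hd0 : x 1 1 ≠ 0 := by intro h; rw [h, norm_zero] at hd1; linarith
    obtain ⟨m, hm⟩ := exists_norm_eq_zpow hd0
    have hm1 : 0 < m := by
      rw [hm] at hd1
      exact (zpow_lt_zpow_iff_right₀ hp1).mp (by simpa using hd1)
    -- The slope numerator has norm `‖d‖ = p^m`, so this is the smallest scale that makes the slope
    -- too large; the quadratic condition is `n + 2 ≤ m`.
    refine hzero fun y hy => quadFourier_eq_zero hψ hp hχ hh hc0 (r := 1 + n - m) (by omega) ?_ ?_
    · rw [hm, hn, ← zpow_natCast, ← zpow_mul, ← zpow_add₀ hp0.ne']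
      exact zpow_le_zpow_right₀ hp1.le (by push_cast; omega)
    · intro t ht
      have : ‖x 1 1 * t - y‖ = (p : ℝ) ^ m := by
        rw [sub_eq_add_neg, norm_add_eq_of_lt, norm_mul, ht, mul_one, hm]
        rw [norm_neg, hy, norm_mul, ht, mul_one]; exact hd1
      rw [this, hn, ← zpow_add₀ hp0.ne']
      exact zpow_lt_zpow_right₀ hp1 (by omega)
  rw [not_lt] at hd1
  by_cases hn2 : n = -1
  · have hc : ‖x 1 0‖ = (p : ℝ)⁻¹ := by rw [hn, hn2, zpow_neg_one]
    refine pairing_weilRep_eq_zero_of_slope hψ hp hχ hh hc (not_le.mp fun ha => hx' ⟨hc, ha, hd1⟩)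
  · have hc : ‖x 1 0‖ ≤ ((p : ℝ) ^ 2)⁻¹ := by
      rw [hn]
      exact zpow_le_zpow_right₀ hp1.le (show n ≤ -2 by omega)
    have hd : ‖x 1 1‖ < 1 := lt_of_le_of_ne hd1 fun h => hx ⟨hc, h⟩
    -- Now `‖d‖ < 1`, so the slope numerator `d t - y` is a unit.
    refine hzero fun y hy => quadFourier_eq_zero hψ hp hχ hh hc0 (r := n + 1) (by omega) ?_ ?_
    · rw [hn]
      calc _ ≤ 1 * ((p : ℝ) ^ (n + 1)) ^ 2 := by gcongr
        _ = (p : ℝ) ^ (2 * n + 2) := by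
          rw [one_mul, ← zpow_natCast, ← zpow_mul]; congr 1; push_cast; ring
        _ ≤ _ := zpow_le_zpow_right₀ hp1.le (by omega)
    · intro t ht
      have : ‖x 1 1 * t - y‖ = 1 := by
        rw [sub_eq_neg_add, norm_add_eq_of_lt, norm_neg, hy]
        rw [norm_neg, hy, norm_mul, ht, mul_one]; exact hd
      rw [this, hn, one_mul]
      exact zpow_lt_zpow_right₀ hp1 (by omega)

end

/-! ### The volume of `Γ₀₀` -/

theorem continuous_SL2_apply (i j : Fin 2) : Continuous fun x : SL2 p => x i j :=
  continuous_subtype_val.matrix_elem i j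

theorem SL2_mul_apply (x y : SL2 p) (i j : Fin 2) :
    (x * y) i j = x i 0 * y 0 j + x i 1 * y 1 j := by
  rw [Matrix.SpecialLinearGroup.coe_mul, Matrix.mul_apply, Fin.sum_univ_two]

theorem isOpen_SL2Zp : IsOpen (SL2Zp p) := isOpen_integralMatrices.preimage continuous_subtype_val

theorem isOpen_Gamma00 : IsOpen (Gamma00 p) := by
  have hb : IsOpen {x : ℚ_[p] | ‖x‖ ≤ ((p : ℝ) ^ 2)⁻¹} := by
    have e : {x : ℚ_[p] | ‖x‖ ≤ ((p : ℝ) ^ 2)⁻¹} = qball p (-2) := by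
      ext x
      rw [mem_qball, zpow_neg, zpow_ofNat]
      rfl
    rw [e]
    exact isOpen_qball _
  exact isOpen_SL2Zp.inter (hb.preimage (continuous_SL2_apply 1 0))

theorem mul_mem_SL2Zp {x y : SL2 p} (hx : x ∈ SL2Zp p) (hy : y ∈ SL2Zp p) : x * y ∈ SL2Zp p := by
  intro i j
  rw [SL2_mul_apply]
  refine norm_add_le_of_le ?_ ?_ <;> rw [norm_mul] <;>
    exact mul_le_one₀ (hx _ _) (norm_nonneg _) (hy _ _)

theorem inv_mem_SL2Zp {x : SL2 p} (hx : x ∈ SL2Zp p) : x⁻¹ ∈ SL2Zp p := by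
  intro i j
  rw [Matrix.SpecialLinearGroup.coe_inv, Matrix.adjugate_fin_two]
  fin_cases i <;> fin_cases j <;> simp [hx _ _]

theorem mul_mem_SL2Zp_iff {x y : SL2 p} (hx : x ∈ SL2Zp p) : x * y ∈ SL2Zp p ↔ y ∈ SL2Zp p := by
  refine ⟨fun h => ?_, mul_mem_SL2Zp hx⟩
  have := mul_mem_SL2Zp (inv_mem_SL2Zp hx) h
  rwa [inv_mul_cancel_left] at this

theorem lMat_mem_SL2Zp {c : ℚ_[p]} (hc : ‖c‖ ≤ 1) : lMat c ∈ SL2Zp p := by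
  intro i j
  fin_cases i <;> fin_cases j <;> simp [lMat, hc]

/-- The matrix with rows `(0, 1)` and `(-1, c)`. -/
def rMat (c : ℚ_[p]) : SL2 p := ⟨!![0, 1; -1, c], by simp⟩

theorem rMat_mem_SL2Zp {c : ℚ_[p]} (hc : ‖c‖ ≤ 1) : rMat c ∈ SL2Zp p := by
  intro i j
  fin_cases i <;> fin_cases j <;> simp [rMat, hc]

theorem lMat_mul_mem_Gamma00 {c : ℚ_[p]} (hc : ‖c‖ ≤ 1) {x : SL2 p} :
    lMat (-c) * x ∈ Gamma00 p ↔ x ∈ SL2Zp p ∧ ‖x 1 0 - c * x 0 0‖ ≤ ((p : ℝ) ^ 2)⁻¹ := by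
  have e : (lMat (-c) * x) 1 0 = x 1 0 - c * x 0 0 := by
    rw [SL2_mul_apply]; simp [lMat]; ring
  rw [Gamma00, Set.mem_ofPred_eq, mul_mem_SL2Zp_iff (lMat_mem_SL2Zp (by rwa [norm_neg])), e]

theorem rMat_mul_mem_Gamma00 {c : ℚ_[p]} (hc : ‖c‖ ≤ 1) {x : SL2 p} :
    rMat c * x ∈ Gamma00 p ↔ x ∈ SL2Zp p ∧ ‖x 0 0 - c * x 1 0‖ ≤ ((p : ℝ) ^ 2)⁻¹ := by
  have e : (rMat c * x) 1 0 = -(x 0 0 - c * x 1 0) := by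
    rw [SL2_mul_apply]; simp [rMat]; ring
  rw [Gamma00, Set.mem_ofPred_eq, mul_mem_SL2Zp_iff (rMat_mem_SL2Zp hc), e, norm_neg]

theorem norm_natCast_le_one (n : ℕ) : ‖(n : ℚ_[p])‖ ≤ 1 := by
  exact_mod_cast Padic.norm_int_le_one (p := p) (n : ℤ)

theorem exists_natCast_near {t : ℚ_[p]} (ht : ‖t‖ ≤ 1) (n : ℕ) :
    ∃ j < p ^ n, ‖t - (j : ℚ_[p])‖ ≤ ((p : ℝ) ^ n)⁻¹ := by
  refine ⟨PadicInt.appr ⟨t, ht⟩ n, PadicInt.appr_lt _ _, ?_⟩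
  have h := PadicInt.appr_spec n (⟨t, ht⟩ : ℤ_[p])
  rw [← PadicInt.norm_le_pow_iff_mem_span_pow, PadicInt.norm_def, zpow_neg, zpow_natCast] at h
  exact_mod_cast h

theorem natCast_eq_of_norm_sub_le {n i j : ℕ} (hi : i < p ^ n) (hj : j < p ^ n)
    (h : ‖(i : ℚ_[p]) - j‖ ≤ ((p : ℝ) ^ n)⁻¹) : i = j := by
  have h2 : ‖(((i : ℤ) - (j : ℤ) : ℤ) : ℚ_[p])‖ ≤ (p : ℝ) ^ (-n : ℤ) := by
    rw [zpow_neg, zpow_natCast]; push_cast; exact h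
  rw [Padic.norm_int_le_pow_iff_dvd] at h2
  have := Int.eq_zero_of_abs_lt_dvd h2 (by
    rw [abs_lt]; constructor <;> push_cast <;> zify at hi hj <;> omega)
  omega

theorem norm_col_of_mem_SL2Zp {x : SL2 p} (hx : x ∈ SL2Zp p) (ha : ‖x 0 0‖ ≠ 1) :
    ‖x 0 0‖ < 1 ∧ ‖x 1 0‖ = 1 := by
  have h00 : ‖x 0 0‖ ≤ 1 := hx 0 0
  have h01 : ‖x 0 1‖ ≤ 1 := hx 0 1
  have h10 : ‖x 1 0‖ ≤ 1 := hx 1 0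
  have h11 : ‖x 1 1‖ ≤ 1 := hx 1 1
  have ha' : ‖x 0 0‖ < 1 := lt_of_le_of_ne h00 ha
  refine ⟨ha', ?_⟩
  have h1 : ‖x 0 0 * x 1 1‖ < 1 := by
    rw [norm_mul]
    exact (mul_le_of_le_one_right (norm_nonneg _) h11).trans_lt ha'
  have h2 : ‖x 0 1‖ * ‖x 1 0‖ = 1 := by
    rw [← norm_mul, show x 0 1 * x 1 0 = -1 + x 0 0 * x 1 1 by linear_combination -(SL2_det x),
      norm_add_eq_of_lt (by simpa using h1)]
    simp
  have := norm_nonneg (x 0 1)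
  have := norm_nonneg (x 1 0)
  nlinarith

/-- The subsets of `SL₂(ℤ_p)` on which `c / a` is a given residue modulo `p²`. -/
def leftCoset (p : ℕ) [Fact p.Prime] (j : ℕ) : Set (SL2 p) :=
  (fun x => lMat (-(j : ℚ_[p])) * x) ⁻¹' Gamma00 p

/-- The subsets of `SL₂(ℤ_p)` on which `a / c` is a given multiple of `p` modulo `p²`. -/
def rightCoset (p : ℕ) [Fact p.Prime] (j : ℕ) : Set (SL2 p) :=
  (fun x => rMat ((p : ℚ_[p]) * (j : ℚ_[p])) * x) ⁻¹' Gamma00 p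

theorem mem_leftCoset {j : ℕ} {x : SL2 p} : x ∈ leftCoset p j ↔
    x ∈ SL2Zp p ∧ ‖x 1 0 - j * x 0 0‖ ≤ ((p : ℝ) ^ 2)⁻¹ :=
  lMat_mul_mem_Gamma00 (norm_natCast_le_one j)

theorem norm_prime_mul_natCast_le (j : ℕ) : ‖(p : ℚ_[p]) * j‖ ≤ (p : ℝ)⁻¹ := by
  rw [norm_mul, Padic.norm_p]
  exact mul_le_of_le_one_right (by positivity) (norm_natCast_le_one j)

theorem mem_rightCoset {j : ℕ} {x : SL2 p} : x ∈ rightCoset p j ↔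
    x ∈ SL2Zp p ∧ ‖x 0 0 - p * j * x 1 0‖ ≤ ((p : ℝ) ^ 2)⁻¹ :=
  rMat_mul_mem_Gamma00 ((norm_prime_mul_natCast_le j).trans inv_prime_lt_one.le)

theorem inv_prime_sq_lt_one : ((p : ℝ) ^ 2)⁻¹ < 1 :=
  inv_lt_one_of_one_lt₀ (one_lt_pow₀ one_lt_prime_cast two_ne_zero)

theorem norm_of_mem_leftCoset {j : ℕ} {x : SL2 p} (h : x ∈ leftCoset p j) : ‖x 0 0‖ = 1 := by
  rw [mem_leftCoset] at h
  by_contra ha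
  obtain ⟨h1, h2⟩ := norm_col_of_mem_SL2Zp h.1 ha
  have h3 : ‖x 1 0 - j * x 0 0‖ = 1 := by
    rw [sub_eq_add_neg, norm_add_eq_of_lt, h2]
    rw [norm_neg, norm_mul, h2]
    exact (mul_le_of_le_one_left (norm_nonneg _) (norm_natCast_le_one j)).trans_lt h1
  have := h.2
  rw [h3] at this
  exact absurd this (not_le.mpr inv_prime_sq_lt_one)

theorem norm_of_mem_rightCoset {j : ℕ} {x : SL2 p} (h : x ∈ rightCoset p j) :
    ‖x 0 0‖ ≠ 1 := by
  rw [mem_rightCoset] at h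
  intro ha
  have h10 : ‖x 1 0‖ ≤ 1 := h.1 1 0
  have h3 : ‖x 0 0 - p * j * x 1 0‖ = 1 := by
    rw [sub_eq_add_neg, norm_add_eq_of_lt, ha]
    rw [norm_neg, norm_mul, ha]
    exact (mul_le_of_le_one_right (norm_nonneg _) h10).trans_lt
      ((norm_prime_mul_natCast_le j).trans_lt inv_prime_lt_one)
  have := h.2
  rw [h3] at this
  exact absurd this (not_le.mpr inv_prime_sq_lt_one)

/-- The first column of `x` defines a point of the projective line over `ℤ/p²`: either `a` is a unit
and `c/a` is one of `p²` residues, or `c` is a unit and `a/c` is one of the `p` multiples of `p`. -/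
theorem SL2Zp_eq_union : SL2Zp p = (⋃ j ∈ Finset.range (p ^ 2), leftCoset p j) ∪
    ⋃ j ∈ Finset.range p, rightCoset p j := by
  have hp0 := prime_cast_pos (p := p)
  ext x
  simp only [Set.mem_union, Set.mem_iUnion, Finset.mem_range, exists_prop]
  constructor
  · intro hx
    by_cases ha : ‖x 0 0‖ = 1
    · left
      have ha0 : x 0 0 ≠ 0 := by intro h; rw [h] at ha; simp at ha
      have h10 : ‖x 1 0‖ ≤ 1 := hx 1 0
      obtain ⟨j, hj, h⟩ := exists_natCast_near (t := x 1 0 / x 0 0)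
        (by rwa [norm_div, ha, div_one]) 2
      refine ⟨j, hj, mem_leftCoset.mpr ⟨hx, ?_⟩⟩
      rwa [show x 1 0 - j * x 0 0 = (x 1 0 / x 0 0 - j) * x 0 0 by field_simp, norm_mul, ha, mul_one]
    · right
      obtain ⟨h1, h2⟩ := norm_col_of_mem_SL2Zp hx ha
      have hc0 : x 1 0 ≠ 0 := by intro h; rw [h] at h2; simp at h2
      have hpn := prime_cast_ne_zero (p := p)
      obtain ⟨j, hj, h⟩ := exists_natCast_near (t := x 0 0 / ((p : ℚ_[p]) * x 1 0)) (by
        rw [norm_div, norm_mul, h2, mul_one, Padic.norm_p, div_inv_eq_mul, ← le_div_iff₀ hp0,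
          one_div]
        exact norm_le_inv_of_lt_one h1) 1
      rw [pow_one] at h hj
      refine ⟨j, hj, mem_rightCoset.mpr ⟨hx, ?_⟩⟩
      rw [show x 0 0 - p * j * x 1 0 = (x 0 0 / (p * x 1 0) - j) * (p * x 1 0) by field_simp,
        norm_mul, norm_mul, h2, mul_one, Padic.norm_p, sq, mul_inv]
      gcongr
  · rintro (⟨j, -, h⟩ | ⟨j, -, h⟩)
    · exact (mem_leftCoset.mp h).1
    · exact (mem_rightCoset.mp h).1

/-- The pieces in `SL2Zp_eq_union` are disjoint left translates of `Γ₀₀`. -/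
theorem haarMeasure_SL2Zp (μ : Measure (SL2 p)) [μ.IsMulLeftInvariant] :
    μ (SL2Zp p) = ((p ^ 2 + p : ℕ) : ENNReal) * μ (Gamma00 p) := by
  have hp0 := prime_cast_pos (p := p)
  have hmL : ∀ j, MeasurableSet (leftCoset p j) := fun j =>
    isOpen_Gamma00.measurableSet.preimage (continuous_const_mul _).measurable
  have hmR : ∀ j, MeasurableSet (rightCoset p j) := fun j =>
    isOpen_Gamma00.measurableSet.preimage (continuous_const_mul _).measurable
  have hL : ∀ j, μ (leftCoset p j) = μ (Gamma00 p) := fun j => measure_preimage_mul μ _ _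
  have hR : ∀ j, μ (rightCoset p j) = μ (Gamma00 p) := fun j => measure_preimage_mul μ _ _
  rw [SL2Zp_eq_union, measure_union, measure_biUnion_finset, measure_biUnion_finset]
  · simp only [hL, hR, Finset.sum_const, Finset.card_range, nsmul_eq_mul, ← add_mul]
    push_cast
    rfl
  · intro i hi j hj hij
    rw [Function.onFun, Set.disjoint_left]
    intro x hx hx'
    apply hij
    have ha := norm_col_of_mem_SL2Zp (mem_rightCoset.mp hx).1 (norm_of_mem_rightCoset hx)
    have h := norm_sub_le_of_le (mem_rightCoset.mp hx').2 (mem_rightCoset.mp hx).2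
    refine natCast_eq_of_norm_sub_le (n := 1) (by simpa using hi) (by simpa using hj) ?_
    rw [show x 0 0 - p * j * x 1 0 - (x 0 0 - p * i * x 1 0) = p * (((i : ℚ_[p]) - j) * x 1 0) by
      ring, norm_mul, norm_mul, ha.2, mul_one, Padic.norm_p, sq, mul_inv] at h
    rw [pow_one]
    exact le_of_mul_le_mul_left h (by positivity)
  · exact fun j _ => hmR j
  · intro i hi j hj hij
    rw [Function.onFun, Set.disjoint_left]
    intro x hx hx'
    apply hij
    have ha := norm_of_mem_leftCoset hx
    have h := norm_sub_le_of_le (mem_leftCoset.mp hx').2 (mem_leftCoset.mp hx).2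
    refine natCast_eq_of_norm_sub_le (n := 2) (by simpa using hi) (by simpa using hj) ?_
    rwa [show x 1 0 - j * x 0 0 - (x 1 0 - i * x 0 0) = ((i : ℚ_[p]) - j) * x 0 0 by
      ring, norm_mul, ha, mul_one] at h
  · exact fun j _ => hmL j
  · rw [Set.disjoint_left]
    intro x hx hx'
    simp only [Set.mem_iUnion] at hx hx'
    obtain ⟨i, -, hi⟩ := hx
    obtain ⟨j, -, hj⟩ := hx'
    exact norm_of_mem_rightCoset hj (norm_of_mem_leftCoset hi)
  · exact Finset.measurableSet_biUnion _ fun j _ => hmR j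

theorem haarSL2_Gamma00 : (haarSL2 p).real (Gamma00 p) = (1 - ((p : ℝ) ^ 2)⁻¹) / (p * (p + 1)) := by
  have hp0 := prime_cast_pos (p := p)
  have h := haarMeasure_SL2Zp (Measure.haarMeasure (SL2ZpCompacts p))
  have h1 : Measure.haarMeasure (SL2ZpCompacts p) (SL2Zp p) = 1 := Measure.haarMeasure_self
  rw [h1] at h
  have h2 := congrArg ENNReal.toReal h
  rw [ENNReal.toReal_mul, ENNReal.toReal_natCast, ENNReal.toReal_one] at h2
  rw [Measure.real, haarSL2, Measure.smul_apply, smul_eq_mul, ENNReal.toReal_mul,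
    ENNReal.toReal_ofReal (sub_nonneg.mpr inv_prime_sq_lt_one.le)]
  push_cast at h2
  rw [eq_div_iff (by positivity)]
  linear_combination -(1 - ((p : ℝ) ^ 2)⁻¹) * h2

instance instIsMulLeftInvariantSL2 : (haarSL2 p).IsMulLeftInvariant := by
  unfold haarSL2; infer_instance

theorem haarSL2_Gamma00_lt_top : haarSL2 p (Gamma00 p) < ⊤ := by
  have h : haarSL2 p (SL2Zp p) < ⊤ := by
    rw [haarSL2, Measure.smul_apply, smul_eq_mul]
    refine ENNReal.mul_lt_top ENNReal.ofReal_lt_top ?_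
    have h1 : Measure.haarMeasure (SL2ZpCompacts p) (SL2Zp p) = 1 := Measure.haarMeasure_self
    rw [h1]; exact ENNReal.one_lt_top
  exact (measure_mono fun x hx => hx.1).trans_lt h

/-! ### The support of the integrand -/

/-- The set of matrices with `p² ∣ c`, `d` a unit and `b ∈ p⁻¹ ℤ_p`. -/
def suppSet (p : ℕ) [Fact p.Prime] : Set (SL2 p) :=
  {x | ‖x 1 0‖ ≤ ((p : ℝ) ^ 2)⁻¹ ∧ ‖x 1 1‖ = 1 ∧ ‖x 0 1‖ ≤ p}

/-- The coset of `Γ₀₀` by `u(j / p)`. -/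
def suppCoset (p : ℕ) [Fact p.Prime] (j : ℕ) : Set (SL2 p) :=
  (fun x => uMat (-((j : ℚ_[p]) / (p : ℚ_[p]))) * x) ⁻¹' Gamma00 p

theorem norm_natCast_div_prime_le (j : ℕ) : ‖(j : ℚ_[p]) / p‖ ≤ p := by
  rw [norm_div, Padic.norm_p, div_inv_eq_mul]
  exact mul_le_of_le_one_left prime_cast_pos.le (norm_natCast_le_one j)

theorem norm_a_of_mem_suppSet {x : SL2 p} (hx : x ∈ suppSet p) : ‖x 0 0‖ = 1 := by
  have hp0 := prime_cast_pos (p := p)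
  obtain ⟨hc, hd, hb⟩ := hx
  have h1 : ‖x 0 1 * x 1 0‖ < 1 := by
    rw [norm_mul]
    calc _ ≤ (p : ℝ) * ((p : ℝ) ^ 2)⁻¹ := by gcongr
      _ = (p : ℝ)⁻¹ := by field_simp
      _ < 1 := inv_prime_lt_one
  have h2 : ‖x 0 0‖ * ‖x 1 1‖ = 1 := by
    rw [← norm_mul, show x 0 0 * x 1 1 = 1 + x 0 1 * x 1 0 by linear_combination SL2_det x,
      norm_add_eq_of_lt (by simpa using h1), norm_one]
  rwa [hd, mul_one] at h2

/-- Left multiplication by `u(-j/p)` replaces `b/d` by `b/d - j/p` and leaves the bottom row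
unchanged. -/
theorem mem_suppCoset {j : ℕ} {x : SL2 p} : x ∈ suppCoset p j ↔
    x ∈ suppSet p ∧ ‖x 0 1 / x 1 1 - j / p‖ ≤ 1 := by
  have hp0 := prime_cast_pos (p := p)
  set t : ℚ_[p] := (j : ℚ_[p]) / p with ht
  have htn : ‖t‖ ≤ p := norm_natCast_div_prime_le j
  have e00 : (uMat (-t) * x) 0 0 = x 0 0 - t * x 1 0 := by
    rw [SL2_mul_apply]; simp [uMat]; ring
  have e01 : (uMat (-t) * x) 0 1 = x 0 1 - t * x 1 1 := by
    rw [SL2_mul_apply]; simp [uMat]; ring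
  have e10 : (uMat (-t) * x) 1 0 = x 1 0 := by rw [SL2_mul_apply]; simp [uMat]
  have e11 : (uMat (-t) * x) 1 1 = x 1 1 := by rw [SL2_mul_apply]; simp [uMat]
  change uMat (-t) * x ∈ Gamma00 p ↔ _
  constructor
  · intro h
    have hd := (norm_diag_of_mem_Gamma00 h).2
    have hc := h.2
    have hb : ‖(uMat (-t) * x) 0 1‖ ≤ 1 := h.1 0 1
    rw [e11] at hd
    rw [e10] at hc
    rw [e01] at hb
    have hd0 : x 1 1 ≠ 0 := by intro h; rw [h] at hd; simp at hd
    refine ⟨⟨hc, hd, ?_⟩, ?_⟩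
    · have h1 : ‖t * x 1 1‖ ≤ p := by rwa [norm_mul, hd, mul_one]
      simpa using norm_add_le_of_le (hb.trans one_lt_prime_cast.le) h1
    · rwa [show x 0 1 / x 1 1 - t = (x 0 1 - t * x 1 1) / x 1 1 by field_simp, norm_div, hd,
        div_one]
  · rintro ⟨hx, h⟩
    have ha := norm_a_of_mem_suppSet hx
    obtain ⟨hc, hd, hb⟩ := hx
    have hd0 : x 1 1 ≠ 0 := by intro h; rw [h] at hd; simp at hd
    rw [show x 0 1 / x 1 1 - t = (x 0 1 - t * x 1 1) / x 1 1 by field_simp, norm_div, hd,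
      div_one] at h
    refine ⟨fun i j => ?_, by rw [e10]; exact hc⟩
    fin_cases i <;> fin_cases j
    · change ‖(uMat (-t) * x) 0 0‖ ≤ 1
      rw [e00]
      refine norm_sub_le_of_le ha.le ?_
      rw [norm_mul]
      calc _ ≤ (p : ℝ) * ((p : ℝ) ^ 2)⁻¹ := by gcongr
        _ = (p : ℝ)⁻¹ := by field_simp
        _ ≤ 1 := inv_prime_lt_one.le
    · change ‖(uMat (-t) * x) 0 1‖ ≤ 1
      rw [e01]; exact h
    · change ‖(uMat (-t) * x) 1 0‖ ≤ 1
      rw [e10]; exact hc.trans inv_prime_sq_lt_one.le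
    · change ‖(uMat (-t) * x) 1 1‖ ≤ 1
      rw [e11, hd]

theorem measurableSet_suppCoset (j : ℕ) : MeasurableSet (suppCoset p j) :=
  isOpen_Gamma00.measurableSet.preimage (continuous_const_mul _).measurable

theorem haarSL2_suppCoset (j : ℕ) : haarSL2 p (suppCoset p j) = haarSL2 p (Gamma00 p) :=
  measure_preimage_mul _ _ _

/-- The translates `u(j/p) Γ₀₀` partition `suppSet`: exactly one `j` is congruent to `p b/d` modulo
`p`. -/
theorem sum_indicator_suppCoset {f : ℚ_[p] → ℂ} (hf : ∀ b z, ‖z‖ ≤ 1 → f (b + z) = f b)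
    (x : SL2 p) :
    ∑ j ∈ Finset.range p, (suppCoset p j).indicator (fun _ => f (j / p)) x =
      (suppSet p).indicator (fun x => f (x 0 1 / x 1 1)) x := by
  have hp0 := prime_cast_pos (p := p)
  have hpn := prime_cast_ne_zero (p := p)
  by_cases hx : x ∈ suppSet p
  · rw [Set.indicator_of_mem hx]
    have hd := hx.2.1
    have hd0 : x 1 1 ≠ 0 := by intro h; rw [h] at hd; simp at hd
    have key : ∀ j : ℕ, x ∈ suppCoset p j ↔ ‖p * (x 0 1 / x 1 1) - j‖ ≤ (p : ℝ)⁻¹ := by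
      intro j
      rw [mem_suppCoset, and_iff_right hx, show (p : ℚ_[p]) * (x 0 1 / x 1 1) - j =
        p * (x 0 1 / x 1 1 - j / p) by field_simp, norm_mul, Padic.norm_p]
      exact ⟨fun h => mul_le_of_le_one_right (by positivity) h, fun h => by
        rwa [mul_le_iff_le_one_right (by positivity)] at h⟩
    obtain ⟨j, hj, h⟩ := exists_natCast_near (t := (p : ℚ_[p]) * (x 0 1 / x 1 1)) (by
      rw [norm_mul, norm_div, hd, div_one, Padic.norm_p]
      calc _ ≤ (p : ℝ)⁻¹ * p := by gcongr; exact hx.2.2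
        _ = 1 := inv_mul_cancel₀ hp0.ne') 1
    rw [pow_one] at h hj
    rw [Finset.sum_eq_single_of_mem j (Finset.mem_range.mpr hj)]
    · have hm := (key j).mpr h
      rw [Set.indicator_of_mem hm]
      have := hf (j / p) (x 0 1 / x 1 1 - j / p) (mem_suppCoset.mp hm).2
      rw [add_sub_cancel] at this
      exact this.symm
    · intro i hi hij
      refine Set.indicator_of_notMem (fun hi' => hij ?_) _
      have h2 := norm_sub_le_of_le h ((key i).mp hi')
      rw [sub_sub_sub_cancel_left] at h2
      exact natCast_eq_of_norm_sub_le (n := 1) (by simpa using hi) (by simpa using hj)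
        (by rwa [pow_one])
  · rw [Set.indicator_of_notMem hx]
    refine Finset.sum_eq_zero fun j _ => Set.indicator_of_notMem (fun h => hx ?_) _
    exact (mem_suppCoset.mp h).1

/-! ### The sum over the cosets in the support -/

theorem gaussInt_mulShift (ψ : AddChar ℚ_[p] Circle) (k : ℤ) (a e : ℚ_[p]) :
    gaussInt (ψ.mulShift a) k e = gaussInt ψ k (e * a) := by
  unfold gaussInt
  simp only [AddChar.mulShift_apply]
  congr 1 with x
  rw [show a * (e * x ^ 2) = e * a * x ^ 2 by ring]

section

variable {ψ : AddChar ℚ_[p] Circle} (hψ : ∀ x : ℚ_[p], ψ x = 1 ↔ ‖x‖ ≤ 1)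
include hψ

theorem unitGauss_eq_sub (e : ℚ_[p]) :
    unitGauss ψ e = gaussInt ψ 0 e - gaussInt ψ (-1) e :=
  setIntegral_unitSet (integrableOn_addChar_comp hψ (by fun_prop) 0)

theorem unitGauss_mulShift_sq (e : ℚ_[p]) {u : ℚ_[p]} (hu : ‖u‖ = 1) :
    unitGauss (ψ.mulShift (u ^ 2)) e = unitGauss ψ e := by
  rw [unitGauss_eq_sub hψ, unitGauss_eq_sub (kernel_mulShift_unit hψ (by rw [norm_pow, hu, one_pow])),
    gaussInt_mulShift, gaussInt_mulShift, gaussInt_mul_sq _ _ _ hu, gaussInt_mul_sq _ _ _ hu]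

theorem gaussInt_add_of_norm_le {k : ℤ} (hk : k ≤ 0) (e : ℚ_[p]) {z : ℚ_[p]} (hz : ‖z‖ ≤ 1) :
    gaussInt ψ k (e + z) = gaussInt ψ k e := by
  refine setIntegral_congr_fun (measurableSet_qball k) fun x hx => ?_
  have h1 : ‖x‖ ≤ 1 := (mem_qball.mp hx).trans (zpow_le_one_of_nonpos₀ one_lt_prime_cast.le hk)
  have h2 : ‖z * x ^ 2‖ ≤ 1 := by
    rw [norm_mul, norm_pow]
    exact mul_le_one₀ hz (by positivity) (pow_le_one₀ (norm_nonneg _) h1)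
  rw [add_mul, addChar_add_of_norm_le hψ h2]

theorem unitGauss_add_of_norm_le (e : ℚ_[p]) {z : ℚ_[p]} (hz : ‖z‖ ≤ 1) :
    unitGauss ψ (e + z) = unitGauss ψ e := by
  rw [unitGauss_eq_sub hψ, unitGauss_eq_sub hψ, gaussInt_add_of_norm_le hψ le_rfl e hz,
    gaussInt_add_of_norm_le hψ (by norm_num) e hz]

/-- A geometric sum whose ratio is a `p`-th root of unity, trivial exactly when `p ∣ w`. -/
theorem sum_addChar_natCast_div (w : ℚ_[p]) (hw : ‖w‖ ≤ 1) :
    ∑ j ∈ Finset.range p, (ψ ((j : ℚ_[p]) / (p : ℚ_[p]) * w) : ℂ) =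
      (qball p (-1)).indicator (fun _ => (p : ℂ)) w := by
  have hp0 := prime_cast_pos (p := p)
  have hpn := prime_cast_ne_zero (p := p)
  have e : ∀ j : ℕ, (ψ ((j : ℚ_[p]) / (p : ℚ_[p]) * w) : ℂ) = (ψ (w / p) : ℂ) ^ j := by
    intro j
    rw [show (j : ℚ_[p]) / (p : ℚ_[p]) * w = j • (w / p) by rw [nsmul_eq_mul]; ring,
      AddChar.map_nsmul_eq_pow, Circle.coe_pow]
  simp only [e]
  have hiff : ψ (w / p) = 1 ↔ w ∈ qball p (-1) := by
    rw [hψ, mem_qball, norm_div, Padic.norm_p, zpow_neg_one, div_le_iff₀ (by positivity), one_mul]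
  by_cases h : w ∈ qball p (-1)
  · rw [Set.indicator_of_mem h, hiff.mpr h]
    simp
  · rw [Set.indicator_of_notMem h]
    have h1 : (ψ (w / p) : ℂ) ≠ 1 := fun h' => h (hiff.mp (Circle.ext (by simpa using h')))
    have h2 : (ψ (w / p) : ℂ) ^ p = 1 := by
      rw [← Circle.coe_pow, ← AddChar.map_nsmul_eq_pow, nsmul_eq_mul, mul_div_cancel₀ _ hpn,
        (hψ w).mpr hw, Circle.coe_one]
    rw [geom_sum_eq h1, h2, sub_self, zero_div]

/-- Sum under the integral: only `x` in `pℤ_p` survives, with weight `p` and volume `1/p`. -/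
theorem sum_gaussInt_natCast_div :
    ∑ j ∈ Finset.range p, gaussInt ψ 0 ((j : ℚ_[p]) / (p : ℚ_[p])) = 1 := by
  have hpc : (p : ℂ) ≠ 0 := by exact_mod_cast (Fact.out : p.Prime).ne_zero
  have hp1 := one_lt_prime_cast (p := p)
  unfold gaussInt
  rw [← integral_finsetSum _ fun j _ => integrableOn_addChar_comp hψ (by fun_prop) 0]
  have : ∀ x ∈ qball p 0, ∑ j ∈ Finset.range p, (ψ ((j : ℚ_[p]) / (p : ℚ_[p]) * x ^ 2) : ℂ) =
      (qball p (-1)).indicator (fun _ => (p : ℂ)) x := by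
    intro x hx
    rw [mem_qball, zpow_zero] at hx
    rw [sum_addChar_natCast_div hψ _ (by rw [norm_pow]; exact pow_le_one₀ (norm_nonneg _) hx)]
    have hiff : x ^ 2 ∈ qball p (-1) ↔ x ∈ qball p (-1) := by
      rw [mem_qball, mem_qball, zpow_neg_one, norm_pow]
      constructor
      · intro h
        refine norm_le_inv_of_lt_one (lt_of_not_ge fun h1 => ?_)
        exact absurd ((one_le_pow₀ h1).trans h) (not_le.mpr inv_prime_lt_one)
      · intro h
        exact (pow_le_of_le_one (norm_nonneg _) hx two_ne_zero).trans h
    by_cases h : x ∈ qball p (-1)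
    · rw [Set.indicator_of_mem h, Set.indicator_of_mem (hiff.mpr h)]
    · rw [Set.indicator_of_notMem h, Set.indicator_of_notMem (fun h' => h (hiff.mp h'))]
  rw [setIntegral_congr_fun (measurableSet_qball 0) this,
    setIntegral_indicator (measurableSet_qball _), Set.inter_eq_right.mpr, setIntegral_const,
    haarQp_real_qball, Complex.real_smul]
  · push_cast
    rw [zpow_neg_one, inv_mul_cancel₀ hpc]
  · intro x hx
    exact (mem_qball.mp hx).trans (zpow_le_zpow_right₀ hp1.le (by norm_num))

/-- On `pℤ_p` the exponent `e x²` is integral. -/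
theorem gaussInt_neg_one_eq {e : ℚ_[p]} (he : ‖e‖ ≤ p) : gaussInt ψ (-1) e = (p : ℂ)⁻¹ := by
  have hp0 := prime_cast_pos (p := p)
  have : ∀ x ∈ qball p (-1), (ψ (e * x ^ 2) : ℂ) = 1 := by
    intro x hx
    rw [mem_qball, zpow_neg_one] at hx
    rw [(hψ _).mpr, Circle.coe_one]
    rw [norm_mul, norm_pow]
    calc _ ≤ (p : ℝ) * ((p : ℝ)⁻¹) ^ 2 := by gcongr
      _ = (p : ℝ)⁻¹ := by field_simp
      _ ≤ 1 := inv_prime_lt_one.le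
  rw [gaussInt, setIntegral_congr_fun (measurableSet_qball _) this, setIntegral_const,
    haarQp_real_qball, Complex.real_smul]
  simp

theorem sum_conj_unitGauss_mul_gaussInt (hp : p ≠ 2) :
    ∑ j ∈ Finset.range p, conj (unitGauss ψ ((j : ℚ_[p]) / (p : ℚ_[p]))) *
      gaussInt ψ 0 ((j : ℚ_[p]) / (p : ℚ_[p])) = 2 * (1 - (p : ℂ)⁻¹) := by
  have hp0 := prime_cast_pos (p := p)
  have hpP : p.Prime := Fact.out
  have hpc : (p : ℂ) ≠ 0 := by exact_mod_cast hpP.ne_zero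
  -- The product is `|G_j|² - G_j/p`, where `|G_j|²` is `1` for `j = 0` and `1/p` otherwise.
  have key : ∀ j ∈ Finset.range p, conj (unitGauss ψ ((j : ℚ_[p]) / (p : ℚ_[p]))) *
      gaussInt ψ 0 ((j : ℚ_[p]) / (p : ℚ_[p])) =
      ((p : ℂ)⁻¹ + if j = 0 then 1 - (p : ℂ)⁻¹ else 0) -
        (p : ℂ)⁻¹ * gaussInt ψ 0 ((j : ℚ_[p]) / (p : ℚ_[p])) := by
    intro j hj
    rw [unitGauss_eq_sub hψ, gaussInt_neg_one_eq hψ (norm_natCast_div_prime_le j), map_sub, sub_mul,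
      map_inv₀, Complex.conj_natCast, ← Complex.normSq_eq_conj_mul_self,
      Complex.normSq_eq_norm_sq]
    congr 1
    split_ifs with h0
    · subst h0
      simp [gaussInt, haarQp_real_qball]
    · have hn : ‖(j : ℚ_[p]) / (p : ℚ_[p])‖ = (p : ℝ) ^ (1 : ℤ) := by
        have h1 : ‖(j : ℚ_[p])‖ = 1 := by
          rw [Padic.norm_natCast_eq_one_iff]
          exact (Nat.Prime.coprime_iff_not_dvd hpP).mpr fun h =>
            absurd (Nat.le_of_dvd (Nat.pos_of_ne_zero h0) h) (not_le.mpr (Finset.mem_range.mp hj))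
        rw [norm_div, h1, Padic.norm_p, one_div, inv_inv, zpow_one]
      rw [norm_gaussInt hψ hp hn (by norm_num), hn, Real.sq_sqrt (by positivity)]
      simp
  rw [Finset.sum_congr rfl key, Finset.sum_sub_distrib, ← Finset.mul_sum,
    sum_gaussInt_natCast_div hψ, Finset.sum_add_distrib, Finset.sum_const, Finset.card_range,
    Finset.sum_ite_eq' , if_pos (Finset.mem_range.mpr hpP.pos), nsmul_eq_mul,
    mul_inv_cancel₀ hpc]
  ring

end

/-! ### The integral of the matrix coefficients -/

section

variable {θ : AddChar ℚ_[p] Circle} (hθ : ∀ x : ℚ_[p], θ x = 1 ↔ ‖x‖ ≤ 1)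
include hθ

variable {ξ₁ ξ₂ χ : MulCharQp p}

omit hθ in
theorem isTame_mul (hξ₁ : IsUnramified ξ₁) (hξ₂ : HasConductorOne ξ₂) : IsTame (ξ₁ * ξ₂) := by
  intro u hu
  have h1 : ‖(u : ℚ_[p])‖ = 1 := by
    have : ‖(1 : ℚ_[p]) + (u - 1)‖ = ‖(1 : ℚ_[p])‖ :=
      norm_add_eq_of_lt (by rw [norm_one]; exact hu.trans_lt inv_prime_lt_one)
    rwa [add_sub_cancel, norm_one] at this
  rw [MonoidHom.mul_apply, hξ₁ u h1, hξ₂.2 u hu, one_mul]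

omit hθ in
-- On units `χ` agrees with `ξ₂`, because `ξ₁` is unramified, and tameness gives modulus one.
theorem conj_charExt_mul_charExt (hξ₁ : IsUnramified ξ₁) (hξ₂ : HasConductorOne ξ₂)
    {d : ℚ_[p]} (hd : ‖d‖ = 1) : conj (charExt (ξ₁ * ξ₂) d) * charExt ξ₂ d = 1 := by
  have hd0 : d ≠ 0 := by rintro rfl; simp at hd
  have hu : ‖(Units.mk0 d hd0 : ℚ_[p])‖ = 1 := hd
  have hn : ‖(ξ₂ (Units.mk0 d hd0) : ℂ)‖ = 1 := IsTame.norm_eq_one hξ₂.2 hu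
  rw [charExt_of_ne_zero _ hd0, charExt_of_ne_zero _ hd0, MonoidHom.mul_apply, hξ₁ _ hu, one_mul,
    ← Complex.normSq_eq_conj_mul_self, Complex.normSq_eq_norm_sq, hn]
  simp

/-- Each of the three factors cuts out part of the support: the principal series kills `c` of
valuation one with `a`, `d` integral, the unit Gauss integral kills `‖b‖ > p`, and `h` kills the
rest. -/
theorem periodIntegrand_eq (hp : p ≠ 2) (hξ₁ : IsUnramified ξ₁) (hξ₂ : HasConductorOne ξ₂)
    (hodd : (ξ₁ * ξ₂) (-1) = -1) {u : ℚ_[p]} (hu : ‖u‖ = 1) {h : ℚ_[p] → ℂ}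
    (hh : IsUnitVector (ξ₁ * ξ₂) h) {g : GL2 p → ℂ} (hg : IsPrincipalSeriesNewvector ξ₁ ξ₂ g)
    (x : SL2 p) :
    periodIntegrand (θ.mulShift (u ^ 2)) θ h (levelRaise g) (indZp p) x =
      (suppSet p).indicator (fun x => ((‖h 1‖ ^ 2 : ℝ) : ℂ) *
        pairingGL2 (levelRaise g) (levelRaise g) * (conj (unitGauss θ (x 0 1 / x 1 1)) *
          gaussInt θ 0 (x 0 1 / x 1 1))) x := by
  have hχ := isTame_mul hξ₁ hξ₂
  have hψ := kernel_mulShift_unit hθ (u := u ^ 2) (by rw [norm_pow, hu, one_pow])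
  unfold periodIntegrand
  by_cases hcd : ‖x 1 0‖ ≤ ((p : ℝ) ^ 2)⁻¹ ∧ ‖x 1 1‖ = 1
  · obtain ⟨hc, hd⟩ := hcd
    rw [pairing_weilRep_unitVector hψ hp hχ hh hc hd, pairing_weilRep_indZp hθ hp hc hd,
      weilPhase_mulShift_sq hθ hp _ hd hu, unitGauss_mulShift_sq hθ _ hu]
    by_cases hb : ‖x 0 1‖ ≤ p
    · have hx : x ∈ suppSet p := ⟨hc, hd, hb⟩
      rw [Set.indicator_of_mem hx,
        pairing_levelRaise hξ₁ hξ₂ hg hc (norm_a_of_mem_suppSet hx).le hd hb]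
      have h1 := conj_charExt_mul_charExt hξ₁ hξ₂ hd
      have h2 : conj (weilPhase θ (x 1 0) (x 1 1)) * weilPhase θ (x 1 0) (x 1 1) = 1 := by
        rw [← Complex.normSq_eq_conj_mul_self, Complex.normSq_eq_norm_sq,
          norm_weilPhase hθ hp _ hd]
        simp
      simp only [map_mul, Complex.conj_ofReal]
      generalize pairingGL2 (levelRaise g) (levelRaise g) = A
      generalize conj (charExt (ξ₁ * ξ₂) (x 1 1)) = B at *
      generalize conj (weilPhase θ (x 1 0) (x 1 1)) = C at *
      linear_combination ((‖h 1‖ ^ 2 : ℝ) : ℂ) * A * conj (unitGauss θ (x 0 1 / x 1 1)) *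
        gaussInt θ 0 (x 0 1 / x 1 1) * (B * charExt ξ₂ (x 1 1) * h2 + h1)
    · rw [Set.indicator_of_notMem (fun hx => hb hx.2.2), unitGauss_eq_zero hθ hp]
      · simp
      · rw [norm_div, hd, div_one]; exact not_le.mp hb
  · rw [Set.indicator_of_notMem (fun hx => hcd ⟨hx.1, hx.2.1⟩)]
    by_cases h2 : ‖x 1 0‖ = (p : ℝ)⁻¹ ∧ ‖x 0 0‖ ≤ 1 ∧ ‖x 1 1‖ ≤ 1
    · rw [pairing_levelRaise_eq_zero hξ₂ hg h2.1 h2.2.1 h2.2.2]; simp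
    · rw [pairing_weilRep_eq_zero hψ hp hχ hodd hh hcd h2]; simp

theorem periodIntegrand_eq_sum (hp : p ≠ 2) (hξ₁ : IsUnramified ξ₁) (hξ₂ : HasConductorOne ξ₂)
    (hodd : (ξ₁ * ξ₂) (-1) = -1) {u : ℚ_[p]} (hu : ‖u‖ = 1) {h : ℚ_[p] → ℂ}
    (hh : IsUnitVector (ξ₁ * ξ₂) h) {g : GL2 p → ℂ} (hg : IsPrincipalSeriesNewvector ξ₁ ξ₂ g) :
    periodIntegrand (θ.mulShift (u ^ 2)) θ h (levelRaise g) (indZp p) = fun x =>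
      ∑ j ∈ Finset.range p, (suppCoset p j).indicator (fun _ => ((‖h 1‖ ^ 2 : ℝ) : ℂ) *
        pairingGL2 (levelRaise g) (levelRaise g) *
          (conj (unitGauss θ ((j : ℚ_[p]) / (p : ℚ_[p]))) *
            gaussInt θ 0 ((j : ℚ_[p]) / (p : ℚ_[p])))) x := by
  funext x
  rw [periodIntegrand_eq hθ hp hξ₁ hξ₂ hodd hu hh hg]
  refine (sum_indicator_suppCoset (f := fun b => ((‖h 1‖ ^ 2 : ℝ) : ℂ) *
        pairingGL2 (levelRaise g) (levelRaise g) * (conj (unitGauss θ b) * gaussInt θ 0 b))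
    (fun b z hz => ?_) x).symm
  rw [unitGauss_add_of_norm_le hθ b hz, gaussInt_add_of_norm_le hθ le_rfl b hz]

omit hθ in
theorem integrable_indicator_suppCoset (j : ℕ) (c : ℂ) :
    Integrable ((suppCoset p j).indicator fun _ => c) (haarSL2 p) :=
  (integrable_indicator_iff (measurableSet_suppCoset j)).mpr
    (integrableOn_const (by rw [haarSL2_suppCoset]; exact haarSL2_Gamma00_lt_top.ne))

theorem integrable_periodIntegrand (hp : p ≠ 2) (hξ₁ : IsUnramified ξ₁) (hξ₂ : HasConductorOne ξ₂)
    (hodd : (ξ₁ * ξ₂) (-1) = -1) {u : ℚ_[p]} (hu : ‖u‖ = 1) {h : ℚ_[p] → ℂ}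
    (hh : IsUnitVector (ξ₁ * ξ₂) h) {g : GL2 p → ℂ} (hg : IsPrincipalSeriesNewvector ξ₁ ξ₂ g) :
    Integrable (periodIntegrand (θ.mulShift (u ^ 2)) θ h (levelRaise g) (indZp p)) (haarSL2 p) := by
  rw [periodIntegrand_eq_sum hθ hp hξ₁ hξ₂ hodd hu hh hg]
  exact integrable_finsetSum _ fun j _ => integrable_indicator_suppCoset j _

theorem integral_periodIntegrand (hp : p ≠ 2) (hξ₁ : IsUnramified ξ₁) (hξ₂ : HasConductorOne ξ₂)
    (hodd : (ξ₁ * ξ₂) (-1) = -1) {u : ℚ_[p]} (hu : ‖u‖ = 1) {h : ℚ_[p] → ℂ}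
    (hh : IsUnitVector (ξ₁ * ξ₂) h) {g : GL2 p → ℂ} (hg : IsPrincipalSeriesNewvector ξ₁ ξ₂ g) :
    ∫ x, periodIntegrand (θ.mulShift (u ^ 2)) θ h (levelRaise g) (indZp p) x ∂haarSL2 p =
      2 * (1 - ((p : ℂ) ^ 2)⁻¹) / (p * (p + 1)) * (pairingQp h h *
        pairingGL2 (levelRaise g) (levelRaise g)) := by
  rw [periodIntegrand_eq_sum hθ hp hξ₁ hξ₂ hodd hu hh hg,
    integral_finsetSum _ fun j _ => integrable_indicator_suppCoset j _]
  have key : ∀ (j : ℕ) (c : ℂ), ∫ x, (suppCoset p j).indicator (fun _ => c) x ∂haarSL2 p =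
      (1 - ((p : ℂ) ^ 2)⁻¹) / (p * (p + 1)) * c := by
    intro j c
    rw [integral_indicator (measurableSet_suppCoset j), setIntegral_const, Measure.real,
      haarSL2_suppCoset, ← Measure.real, haarSL2_Gamma00, Complex.real_smul]
    push_cast
    rfl
  simp only [key]
  rw [← Finset.mul_sum, ← Finset.mul_sum, sum_conj_unitGauss_mul_gaussInt hθ hp,
    hh.pairing_self (isTame_mul hξ₁ hξ₂)]
  push_cast
  ring

omit hθ in
theorem exists_unit_sq_eq (hp : p ≠ 2) {D : ℤ} (hD : legendreSym p D = 1) :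
    ∃ u : ℚ_[p], ‖u‖ = 1 ∧ (D : ℚ_[p]) = u ^ 2 := by
  have hD0 : (D : ZMod p) ≠ 0 := by
    intro h
    rw [← legendreSym.eq_zero_iff] at h
    rw [h] at hD; exact zero_ne_one hD
  have hsq := (legendreSym.eq_one_iff p hD0).mp hD
  have hn : ‖(D : ℚ_[p])‖ = 1 := by
    refine le_antisymm (Padic.norm_int_le_one D) (not_lt.mp fun h => hD0 ?_)
    rw [Padic.norm_intCast_lt_one_iff] at h
    exact (ZMod.intCast_zmod_eq_zero_iff_dvd D p).mpr h
  have h := isSquare_of_isSquare_toZMod hp (x := (D : ℤ_[p])) (by simpa using hn) (by simpa using hsq)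
  obtain ⟨u, hu⟩ := h
  have hu' : (D : ℚ_[p]) = u * u := by simpa using hu
  refine ⟨u, ?_, by rw [hu', sq]⟩
  rw [hu', norm_mul] at hn
  nlinarith [norm_nonneg u]

end

/-! ### Local `L`-factors -/

section

variable {V W : Type*} [AddCommGroup V] [Module ℂ V] [AddCommGroup W] [Module ℂ W]

/-- On a line the determinant is the scalar by which the operator acts. All three `L`-factors are of
this kind. -/
theorem WDRep.LFactor_of_invariants_eq_span (R : WDRep p V) {v : V} (hv : v ≠ 0)
    (hR : R.invariants = Submodule.span ℂ {v}) {l : ℂ} (hl : R.ρ (pUnit p) v = l • v) (s : ℂ) :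
    R.LFactor s = (1 - (p : ℂ) ^ (-s) * l)⁻¹ := by
  have hf : Module.finrank ℂ R.invariants = 1 := by rw [hR]; exact finrank_span_singleton hv
  have e : LinearMap.id - (p : ℂ) ^ (-s) •
      (R.ρ (pUnit p)).restrict (R.mapsTo_invariants (pUnit p)) =
      (1 - (p : ℂ) ^ (-s) * l) • (LinearMap.id : R.invariants →ₗ[ℂ] R.invariants) := by
    ext ⟨w, hw⟩
    obtain ⟨a, rfl⟩ := Submodule.mem_span_singleton.mp (hR ▸ hw)
    simp only [LinearMap.sub_apply, LinearMap.id_apply, LinearMap.smul_apply, Submodule.coe_sub,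
      Submodule.coe_smul, LinearMap.coe_restrict_apply, map_smul, hl, sub_smul, one_smul, smul_smul]
    congr 2
    ring
  rw [WDRep.LFactor, e, LinearMap.det_smul, hf, pow_one, LinearMap.det_id, mul_one]

theorem WDRep.mem_invariants {R : WDRep p V} {v : V} : v ∈ R.invariants ↔
    R.N v = 0 ∧ ∀ u : ℚ_[p]ˣ, ‖(u : ℚ_[p])‖ = 1 → R.ρ u v = v := Iff.rfl

theorem WDRep.coe_adjoint_ρ (R : WDRep p V) (x : ℚ_[p]ˣ)
    (X : LinearMap.ker (LinearMap.trace ℂ V)) :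
    (R.adjoint.ρ x X : V →ₗ[ℂ] V) = R.ρ x * ((X : V →ₗ[ℂ] V) * R.ρ x⁻¹) := rfl

theorem WDRep.coe_adjoint_N (R : WDRep p V) (X : LinearMap.ker (LinearMap.trace ℂ V)) :
    (R.adjoint.N X : V →ₗ[ℂ] V) = R.N * (X : V →ₗ[ℂ] V) - X * R.N := rfl

/-- The coordinates of an element of `ℂ² ⊗ W`. -/
def tensorCoord (W : Type*) [AddCommGroup W] [Module ℂ W] (i : Fin 2) :
    (Fin 2 → ℂ) ⊗[ℂ] W →ₗ[ℂ] W :=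
  (TensorProduct.lid ℂ W).toLinearMap ∘ₗ
    TensorProduct.map (LinearMap.proj i : (Fin 2 → ℂ) →ₗ[ℂ] ℂ) LinearMap.id

theorem tensorCoord_tmul (i : Fin 2) (v : Fin 2 → ℂ) (w : W) :
    tensorCoord W i (v ⊗ₜ w) = v i • w := by
  simp [tensorCoord]

theorem eq_sum_tensorCoord (t : (Fin 2 → ℂ) ⊗[ℂ] W) :
    t = ![(1 : ℂ), 0] ⊗ₜ tensorCoord W 0 t + ![(0 : ℂ), 1] ⊗ₜ tensorCoord W 1 t := by
  induction t using TensorProduct.induction_on with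
  | zero => simp
  | tmul v w =>
    rw [tensorCoord_tmul, tensorCoord_tmul, ← TensorProduct.smul_tmul, ← TensorProduct.smul_tmul,
      ← TensorProduct.add_tmul]
    congr 1
    ext i
    fin_cases i <;> simp
  | add t t' h h' =>
    rw [map_add, map_add, TensorProduct.tmul_add, TensorProduct.tmul_add]
    nth_rewrite 1 [h, h']
    abel

theorem steinbergParameter_ρ_of_unit {ξ : MulCharQp p} (hξ : IsUnramified ξ) {u : ℚ_[p]ˣ}
    (hu : ‖(u : ℚ_[p])‖ = 1) : (steinbergParameter ξ).ρ u = LinearMap.id := by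
  change Matrix.toLin' (Matrix.diagonal _) = _
  rw [hξ u hu, hu]
  ext i j
  fin_cases i <;> fin_cases j <;> simp

theorem steinbergParameter_N (ξ : MulCharQp p) (v : Fin 2 → ℂ) :
    (steinbergParameter ξ).N v = ![v 1, 0] := by
  change Matrix.toLin' !![0, 1; 0, 0] v = _
  ext i
  fin_cases i <;> simp [Matrix.mulVec, dotProduct, Fin.sum_univ_two]

/-- Inertia acts on the second factor only and monodromy on the first only, so the invariants are
`ker N ⊗ S^I`. -/
theorem invariants_steinberg_tensor {ξ : MulCharQp p} (hξ : IsUnramified ξ) (S : WDRep p W)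
    (hS : S.N = 0) {w : W} (hw : S.invariants = Submodule.span ℂ {w}) :
    ((steinbergParameter ξ).tensor S).invariants = Submodule.span ℂ {![(1 : ℂ), 0] ⊗ₜ w} := by
  have hN : ((steinbergParameter ξ).tensor S).N =
      TensorProduct.map (steinbergParameter ξ).N LinearMap.id := by
    change TensorProduct.map _ _ + TensorProduct.map _ S.N = _
    rw [hS, TensorProduct.map_zero_right, add_zero]
  have hρ : ∀ u : ℚ_[p]ˣ, ‖(u : ℚ_[p])‖ = 1 → ((steinbergParameter ξ).tensor S).ρ u =
      TensorProduct.map LinearMap.id (S.ρ u) := by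
    intro u hu
    change TensorProduct.map _ _ = _
    rw [steinbergParameter_ρ_of_unit hξ hu]
  ext t
  rw [WDRep.mem_invariants, hN, Submodule.mem_span_singleton]
  constructor
  · rintro ⟨h1, h2⟩
    have h3 : tensorCoord W 1 t = 0 := by
      have : ∀ t : (Fin 2 → ℂ) ⊗[ℂ] W, tensorCoord W 0
          (TensorProduct.map (steinbergParameter ξ).N LinearMap.id t) = tensorCoord W 1 t := by
        intro t
        induction t using TensorProduct.induction_on with
        | zero => simp
        | tmul v w => simp [tensorCoord_tmul, steinbergParameter_N]
        | add t t' h h' => simp only [map_add, h, h']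
      rw [← this, h1, map_zero]
    have h4 : tensorCoord W 0 t ∈ S.invariants := by
      refine ⟨by rw [hS]; rfl, fun u hu => ?_⟩
      have : ∀ t : (Fin 2 → ℂ) ⊗[ℂ] W, tensorCoord W 0
          (TensorProduct.map LinearMap.id (S.ρ u) t) = S.ρ u (tensorCoord W 0 t) := by
        intro t
        induction t using TensorProduct.induction_on with
        | zero => simp
        | tmul v w => simp [tensorCoord_tmul]
        | add t t' h h' => simp only [map_add, h, h']
      rw [← this, ← hρ u hu, h2 u hu]
    rw [hw, Submodule.mem_span_singleton] at h4
    obtain ⟨a, ha⟩ := h4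
    refine ⟨a, ?_⟩
    rw [eq_sum_tensorCoord t, h3, TensorProduct.tmul_zero, add_zero, ← ha,
      TensorProduct.tmul_smul]
  · rintro ⟨a, rfl⟩
    have hw' : w ∈ S.invariants := by rw [hw]; exact Submodule.mem_span_singleton_self w
    refine ⟨?_, fun u hu => ?_⟩
    · have h0 : (steinbergParameter ξ).N ![(1 : ℂ), 0] = 0 := by
        rw [steinbergParameter_N]
        ext i
        fin_cases i <;> rfl
      rw [map_smul, TensorProduct.map_tmul, h0, TensorProduct.zero_tmul, smul_zero]
    · rw [hρ u hu, map_smul, TensorProduct.map_tmul, hw'.2 u hu, LinearMap.id_apply]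

end

/-- A matrix of trace zero, as an endomorphism of trace zero. -/
def traceZeroEnd (M : Matrix (Fin 2) (Fin 2) ℂ) (hM : M.trace = 0) :
    LinearMap.ker (LinearMap.trace ℂ (Fin 2 → ℂ)) :=
  ⟨Matrix.toLin' M, by rw [LinearMap.mem_ker, Matrix.trace_toLin'_eq, hM]⟩

theorem exists_eq_traceZeroEnd (X : LinearMap.ker (LinearMap.trace ℂ (Fin 2 → ℂ))) :
    ∃ (M : Matrix (Fin 2) (Fin 2) ℂ) (hM : M.trace = 0), X = traceZeroEnd M hM := by
  obtain ⟨X, hX⟩ := X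
  refine ⟨LinearMap.toMatrix' X, ?_, Subtype.ext (Matrix.toLin'_toMatrix' X).symm⟩
  rw [← Matrix.trace_toLin'_eq, Matrix.toLin'_toMatrix']
  exact hX

theorem traceZeroEnd_ne_zero {M : Matrix (Fin 2) (Fin 2) ℂ} (hM : M.trace = 0) (h : M ≠ 0) :
    traceZeroEnd M hM ≠ 0 := by
  intro h0
  have := congrArg Subtype.val h0
  exact h (by simpa [traceZeroEnd] using this)

/-! ### The three `L`-factors -/

theorem toLin'_diagonal_mul (a b : Fin 2 → ℂ) (M : Matrix (Fin 2) (Fin 2) ℂ) :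
    Matrix.toLin' (Matrix.diagonal a) * (Matrix.toLin' M * Matrix.toLin' (Matrix.diagonal b)) =
      Matrix.toLin' (Matrix.of fun i j => a i * b j * M i j) := by
  rw [Module.End.mul_eq_comp, Module.End.mul_eq_comp, ← Matrix.toLin'_mul, ← Matrix.toLin'_mul]
  congr 1
  ext i j
  rw [Matrix.diagonal_mul, Matrix.mul_diagonal, Matrix.of_apply]
  ring

/-- Inertia acts on the two off-diagonal entries through `ξ₂⁻¹` and `ξ₂`, which are ramified; only
the diagonal line survives. -/
theorem invariants_principalSeries_adjoint {ξ₁ ξ₂ : MulCharQp p} (hξ₁ : IsUnramified ξ₁)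
    (hξ₂ : HasConductorOne ξ₂) :
    (principalSeriesParameter ξ₁ ξ₂).adjoint.invariants =
      Submodule.span ℂ {traceZeroEnd !![1, 0; 0, -1] (by simp [Matrix.trace_fin_two])} := by
  ext X
  rw [WDRep.mem_invariants, Submodule.mem_span_singleton]
  constructor
  · rintro ⟨-, h⟩
    obtain ⟨M, hM, rfl⟩ := exists_eq_traceZeroEnd X
    obtain ⟨u, hu, hu2⟩ : ∃ u : ℚ_[p]ˣ, ‖(u : ℚ_[p])‖ = 1 ∧ ξ₂ u ≠ 1 := by
      have := hξ₂.1
      unfold IsUnramified at this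
      push Not at this
      exact this
    have h1 := congrArg Subtype.val (h u hu)
    rw [WDRep.coe_adjoint_ρ] at h1
    change Matrix.toLin' (Matrix.diagonal ![(ξ₁ u : ℂ), (ξ₂ u : ℂ)]) * (Matrix.toLin' M *
      Matrix.toLin' (Matrix.diagonal ![(ξ₁ u⁻¹ : ℂ), (ξ₂ u⁻¹ : ℂ)])) = Matrix.toLin' M at h1
    rw [toLin'_diagonal_mul] at h1
    have h2 := Matrix.toLin'.injective h1
    have hc : (ξ₂ u : ℂ) ≠ 1 := by simpa using hu2
    have h01 := congrFun (congrFun h2 0) 1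
    have h10 := congrFun (congrFun h2 1) 0
    simp only [Matrix.of_apply, Matrix.cons_val_zero, Matrix.cons_val_one, map_inv, hξ₁ u hu,
      Units.val_one, inv_one, one_mul, mul_one, Units.val_inv_eq_inv_val] at h01 h10
    have e01 : M 0 1 = 0 := by
      by_contra h0
      have := mul_right_cancel₀ h0 (h01.trans (one_mul _).symm)
      exact hc (inv_eq_one.mp this)
    have e10 : M 1 0 = 0 := by
      by_contra h0
      exact hc (mul_right_cancel₀ h0 (h10.trans (one_mul _).symm))
    refine ⟨M 0 0, Subtype.ext ?_⟩
    rw [Matrix.trace_fin_two] at hM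
    change M 0 0 • Matrix.toLin' _ = Matrix.toLin' M
    rw [← map_smul]
    congr 1
    ext i j
    fin_cases i <;> fin_cases j <;> simp [e01, e10]
    linear_combination -hM
  · rintro ⟨a, rfl⟩
    refine ⟨Subtype.ext ?_, fun u hu => Subtype.ext ?_⟩
    · rw [WDRep.coe_adjoint_N]
      change 0 * _ - _ * 0 = 0
      simp
    · rw [WDRep.coe_adjoint_ρ]
      change Matrix.toLin' (Matrix.diagonal ![(ξ₁ u : ℂ), (ξ₂ u : ℂ)]) * ((a • Matrix.toLin' _) *
        Matrix.toLin' (Matrix.diagonal ![(ξ₁ u⁻¹ : ℂ), (ξ₂ u⁻¹ : ℂ)])) = a • Matrix.toLin' _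
      rw [← map_smul, toLin'_diagonal_mul]
      congr 1
      ext i j
      fin_cases i <;> fin_cases j <;> simp

theorem principalSeries_adjoint_frob (ξ₁ ξ₂ : MulCharQp p) (x : ℚ_[p]ˣ) :
    (principalSeriesParameter ξ₁ ξ₂).adjoint.ρ x
      (traceZeroEnd !![1, 0; 0, -1] (by simp [Matrix.trace_fin_two])) =
      traceZeroEnd !![1, 0; 0, -1] (by simp [Matrix.trace_fin_two]) := by
  apply Subtype.ext
  rw [WDRep.coe_adjoint_ρ]
  change Matrix.toLin' (Matrix.diagonal ![(ξ₁ x : ℂ), (ξ₂ x : ℂ)]) * (Matrix.toLin' _ *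
    Matrix.toLin' (Matrix.diagonal ![(ξ₁ x⁻¹ : ℂ), (ξ₂ x⁻¹ : ℂ)])) = Matrix.toLin' _
  rw [toLin'_diagonal_mul]
  congr 1
  ext i j
  fin_cases i <;> fin_cases j <;> simp

theorem LFactor_principalSeries_adjoint {ξ₁ ξ₂ : MulCharQp p} (hξ₁ : IsUnramified ξ₁)
    (hξ₂ : HasConductorOne ξ₂) :
    (principalSeriesParameter ξ₁ ξ₂).adjoint.LFactor 1 = (1 - (p : ℂ)⁻¹)⁻¹ := by
  rw [WDRep.LFactor_of_invariants_eq_span _ (traceZeroEnd_ne_zero _ fun h => ?_)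
    (invariants_principalSeries_adjoint hξ₁ hξ₂) (l := 1), mul_one, Complex.cpow_neg_one]
  · rw [principalSeries_adjoint_frob, one_smul]
  · simpa using congrFun (congrFun h 0) 0

/-- Inertia acts trivially, and the matrices of trace zero commuting with `N` are the multiples of
`N`. -/
theorem invariants_steinberg_adjoint {ξ : MulCharQp p} (hξ : IsUnramified ξ) :
    (steinbergParameter ξ).adjoint.invariants =
      Submodule.span ℂ {traceZeroEnd !![0, 1; 0, 0] (by simp [Matrix.trace_fin_two])} := by
  ext X
  rw [WDRep.mem_invariants, Submodule.mem_span_singleton]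
  constructor
  · rintro ⟨h, -⟩
    obtain ⟨M, hM, rfl⟩ := exists_eq_traceZeroEnd X
    have h1 := congrArg Subtype.val h
    rw [WDRep.coe_adjoint_N] at h1
    change Matrix.toLin' !![0, 1; 0, 0] * Matrix.toLin' M -
      Matrix.toLin' M * Matrix.toLin' !![0, 1; 0, 0] = 0 at h1
    rw [Module.End.mul_eq_comp, Module.End.mul_eq_comp, ← Matrix.toLin'_mul, ← Matrix.toLin'_mul,
      ← map_sub, LinearEquiv.map_eq_zero_iff] at h1
    have h00 := congrFun (congrFun h1 0) 0
    have h01 := congrFun (congrFun h1 0) 1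
    simp only [Matrix.sub_apply, Matrix.mul_apply, Fin.sum_univ_two] at h00 h01
    simp at h00 h01
    rw [Matrix.trace_fin_two] at hM
    refine ⟨M 0 1, Subtype.ext ?_⟩
    change M 0 1 • Matrix.toLin' _ = Matrix.toLin' M
    rw [← map_smul]
    congr 1
    ext i j
    fin_cases i <;> fin_cases j <;> simp [h00]
    · linear_combination (h01 - hM) / 2
    · linear_combination -(h01 + hM) / 2
  · rintro ⟨a, rfl⟩
    refine ⟨Subtype.ext ?_, fun u hu => Subtype.ext ?_⟩
    · rw [WDRep.coe_adjoint_N]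
      change Matrix.toLin' !![0, 1; 0, 0] * (a • Matrix.toLin' !![0, 1; 0, 0]) -
        (a • Matrix.toLin' !![0, 1; 0, 0]) * Matrix.toLin' !![0, 1; 0, 0] = 0
      rw [mul_smul_comm, smul_mul_assoc, sub_self]
    · rw [WDRep.coe_adjoint_ρ, steinbergParameter_ρ_of_unit hξ hu,
        steinbergParameter_ρ_of_unit hξ (by simp [hu])]
      rfl

theorem sqrt_norm_pUnit : (√‖(pUnit p : ℚ_[p])‖ : ℂ) = (√(p : ℝ) : ℂ)⁻¹ := by
  rw [pUnit, Units.val_mk0, Padic.norm_p, Real.sqrt_inv]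
  push_cast
  rfl

/-- Conjugation by Frobenius scales `N` by the ratio of the two characters at `p`, which is `‖p‖ =
1/p`. -/
theorem LFactor_steinberg_adjoint {ξ : MulCharQp p} (hξ : IsUnramified ξ) :
    (steinbergParameter ξ).adjoint.LFactor 1 = (1 - ((p : ℂ) ^ 2)⁻¹)⁻¹ := by
  rw [WDRep.LFactor_of_invariants_eq_span _ (traceZeroEnd_ne_zero _ fun h => ?_)
    (invariants_steinberg_adjoint hξ) (l := (p : ℂ)⁻¹), Complex.cpow_neg_one, sq, mul_inv]
  · apply Subtype.ext
    rw [WDRep.coe_adjoint_ρ]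
    change Matrix.toLin' (Matrix.diagonal _) * (Matrix.toLin' _ *
      Matrix.toLin' (Matrix.diagonal _)) = (p : ℂ)⁻¹ • Matrix.toLin' _
    rw [toLin'_diagonal_mul, ← map_smul]
    congr 1
    have hs : (√(p : ℝ) : ℂ) * (√(p : ℝ) : ℂ) = p := by
      exact_mod_cast Real.mul_self_sqrt (Nat.cast_nonneg p)
    have hi : (√‖(pUnit p : ℚ_[p])⁻¹‖ : ℂ) = (√(p : ℝ) : ℂ) := by
      rw [pUnit, Units.val_mk0, norm_inv, Padic.norm_p, inv_inv]
    ext i j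
    fin_cases i <;> fin_cases j <;> simp only [Matrix.of_apply, Matrix.smul_apply]
    · simp
    · have hξp : (ξ (pUnit p) : ℂ) ≠ 0 := Units.ne_zero _
      simp only [Fin.zero_eta, Fin.mk_one, Matrix.cons_val_zero, Matrix.cons_val_one, hi,
        sqrt_norm_pUnit, map_inv, Units.val_inv_eq_inv_val, Matrix.cons_val',
        smul_eq_mul, mul_one]
      rw [← hs, mul_inv]
      field_simp
    · simp
    · simp
  · simpa using congrFun (congrFun h 0) 1

/-- On the invariant line Frobenius acts by `ξ(p) p^(-1/2) = p^(-1/2)`; the evaluation at `1/2`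
supplies another `p^(-1/2)`. -/
theorem LFactor_steinberg_tensor {ξ ξ₁ ξ₂ : MulCharQp p} (hξ : IsUnramified ξ)
    (hp : ξ (pUnit p) = 1) (hξ₁ : IsUnramified ξ₁) (hξ₂ : HasConductorOne ξ₂) :
    ((steinbergParameter ξ).tensor (principalSeriesParameter ξ₁ ξ₂).adjoint).LFactor (1 / 2) =
      (1 - (p : ℂ)⁻¹)⁻¹ := by
  have hN : (principalSeriesParameter ξ₁ ξ₂).adjoint.N = 0 := by
    ext X : 2
    rw [WDRep.coe_adjoint_N]
    change 0 * _ - _ * 0 = 0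
    simp
  rw [WDRep.LFactor_of_invariants_eq_span _ (fun h => ?_)
    (invariants_steinberg_tensor hξ _ hN (invariants_principalSeries_adjoint hξ₁ hξ₂))
    (l := (√(p : ℝ) : ℂ)⁻¹)]
  · have h1 : (p : ℂ) ^ (-(1 / 2) : ℂ) = (√(p : ℝ) : ℂ)⁻¹ := by
      rw [Complex.cpow_neg, Real.sqrt_eq_rpow, Complex.ofReal_cpow (Nat.cast_nonneg p)]
      push_cast
      rfl
    have hs : (√(p : ℝ) : ℂ) * (√(p : ℝ) : ℂ) = p := by
      exact_mod_cast Real.mul_self_sqrt (Nat.cast_nonneg p)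
    rw [h1, ← mul_inv, hs]
  · change TensorProduct.map _ _ _ = _
    rw [TensorProduct.map_tmul, principalSeries_adjoint_frob, TensorProduct.smul_tmul']
    congr 1
    change Matrix.toLin' (Matrix.diagonal _) _ = _
    rw [hp, sqrt_norm_pUnit]
    ext i
    fin_cases i <;> simp [Matrix.mulVec_diagonal]
  · have h2 := congrArg (tensorCoord (LinearMap.ker (LinearMap.trace ℂ (Fin 2 → ℂ))) 0) h
    rw [tensorCoord_tmul, map_zero] at h2
    refine traceZeroEnd_ne_zero _ (fun h3 => ?_) ((one_smul ℂ _).symm.trans h2)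
    simpa using congrFun (congrFun h3 0) 0

end

end LocalPeriod

/-! ### The value of the normalized period -/

theorem mainTheorem5 (p : ℕ) [Fact p.Prime] (hp : p ≠ 2)
    -- the additive character, of conductor `ℤ_p`
    (ψ : AddChar ℚ_[p] Circle) (hψ : ∀ x : ℚ_[p], ψ x = 1 ↔ ‖x‖ ≤ 1)
    -- `π_p = ξ₀ St`, with `ξ₀` unramified quadratic, and root number `-1`
    (ξ₀ : MulCharQp p) (hξ₀ : IsUnramified ξ₀) (hξ₀q : ξ₀ ^ 2 = 1)
    (hw : steinbergRootNumber ξ₀ = -1)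
    -- `τ_p = π(ξ₁, ξ₂)`, with odd central character `χ = ξ₁ ξ₂`
    (ξ₁ ξ₂ χ : MulCharQp p) (hξ₁ : IsUnramified ξ₁) (hξ₂ : HasConductorOne ξ₂)
    (hχ : χ = ξ₁ * ξ₂) (hodd : χ (-1) = -1)
    -- the twist in `π̃_p = r⁻` for the character `ψ^{-D}`
    (D : ℤ) (hD : ((legendreSym p D : ℤ) : ℂ) = -steinbergRootNumber ξ₀) :
    IsOddWeilNewvector (ψ.mulShift (-(D : ℚ_[p]))) χ (oddWeilVector χ) ∧
    (∃ g : GL2 p → ℂ, IsPrincipalSeriesNewvector ξ₁ ξ₂ g) ∧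
    ∀ (h : ℚ_[p] → ℂ) (g : GL2 p → ℂ),
      IsOddWeilNewvector (ψ.mulShift (-(D : ℚ_[p]))) χ h →
      IsPrincipalSeriesNewvector ξ₁ ξ₂ g →
      MeasureTheory.Integrable
        (periodIntegrand (ψ.mulShift (-(D : ℚ_[p]))) (ψ.mulShift (-1)) h (levelRaise g) (indZp p))
        (haarSL2 p) ∧
      normalizedPeriod (steinbergParameter ξ₀) (principalSeriesParameter ξ₁ ξ₂)
        (ψ.mulShift (-(D : ℚ_[p]))) (ψ.mulShift (-1)) h (levelRaise g) (indZp p) =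
          2 / ((p : ℂ) * ((p : ℂ) + 1)) := by
  subst hχ
  have hξ₀p : ξ₀ (pUnit p) = 1 := by
    apply Units.ext
    rw [steinbergRootNumber] at hw
    simpa using hw
  have hD1 : legendreSym p D = 1 := by
    rw [hw, neg_neg] at hD
    exact_mod_cast hD
  obtain ⟨u, hu, hDu⟩ := exists_unit_sq_eq hp hD1
  have hθ := kernel_mulShift_unit hψ (u := -1) (by rw [norm_neg, norm_one])
  -- Both Weil representations are now expressed through the one character `ψ(-x)`, the first with a
  -- twist by a unit square.
  have hshift : ψ.mulShift (-(D : ℚ_[p])) = (ψ.mulShift (-1)).mulShift (u ^ 2) := by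
    rw [AddChar.mulShift_mulShift, hDu, neg_one_mul]
  have hψ' := kernel_mulShift_unit hθ (u := u ^ 2) (by rw [norm_pow, hu, one_pow])
  have hχ := isTame_mul hξ₁ hξ₂
  rw [hshift]
  refine ⟨isOddWeilNewvector_oddWeilVector hψ' hp hχ hodd,
    ⟨_, isPrincipalSeriesNewvector_newvec hξ₁ hξ₂.2⟩, fun h g hh hg => ?_⟩
  have hv := hh.isUnitVector hψ' hp hχ hodd
  refine ⟨integrable_periodIntegrand hθ hp hξ₁ hξ₂ hodd hu hv hg, ?_⟩
  have hg0 := pairing_levelRaise_self_ne_zero hξ₂ hg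
  -- The modulus of `h` is constant on the units and `h` vanishes elsewhere, so `h 1 = 0` would give
  -- `h = 0`.
  have hh0 : pairingQp h h ≠ 0 := by
    have h1 : h 1 ≠ 0 := by
      intro h1
      refine hh.ne_zero (funext fun x => ?_)
      by_cases hx : ‖x‖ = 1
      · exact norm_eq_zero.mp ((hv.norm_eq hχ hx).trans (by rw [h1, norm_zero]))
      · exact hv.eq_zero x hx
    rw [hv.pairing_self hχ]
    have : 0 < 1 - (p : ℝ)⁻¹ := sub_pos.mpr inv_prime_lt_one
    exact_mod_cast (mul_pos (pow_pos (norm_pos_iff.mpr h1) 2) this).ne'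
  have hL1 : (1 - (p : ℂ)⁻¹) ≠ 0 := by
    have := Complex.ofReal_ne_zero.mpr (sub_pos.mpr (inv_prime_lt_one (p := p))).ne'
    simpa using this
  have hL2 : (1 - ((p : ℂ) ^ 2)⁻¹) ≠ 0 := by
    have := Complex.ofReal_ne_zero.mpr (sub_pos.mpr (inv_prime_sq_lt_one (p := p))).ne'
    simpa using this
  rw [normalizedPeriod, period, integral_periodIntegrand hθ hp hξ₁ hξ₂ hodd hu hv hg,
    LFactor_steinberg_adjoint hξ₀, LFactor_principalSeries_adjoint hξ₁ hξ₂,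
    LFactor_steinberg_tensor hξ₀ hξ₀p hξ₁ hξ₂, pairingQp_indZp_self]
  generalize pairingQp h h = A at *
  generalize pairingGL2 (levelRaise g) (levelRaise g) = B at *
  generalize 1 - ((p : ℂ) ^ 2)⁻¹ = L at *
  rw [mul_div_cancel_right₀ _ (inv_ne_zero hL1), mul_one, ← mul_assoc, mul_div_cancel_right₀ _
    (mul_ne_zero hh0 hg0), mul_div_assoc', mul_comm 2 L, inv_mul_cancel_left₀ hL2]
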